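/- For $t>0$ that is not the ordinate of a zero of the Riemann zeta-function $\zeta$, let $S(t)=\frac1\pi\arg\zeta(\tfrac12+it)$, where the argument is obtained by continuous variation along the line segments joining $2$, $2+it$ and $\frac12+it$, with $\arg\zeta(2)=0$; if $t>0$ is the ordinate of a zero, let $S(t)=\frac12\lim_{\varepsilon\to0^+}\{S(t+\varepsilon)+S(t-\varepsilon)\}$. Put $S_0=S$ and, for $n\ge1$ and $t>0$, $S_n(t)=\int_0^tS_{n-1}(\tau)\,d\tau+\delta_n$, where for $k\ge1$ $$\delta_{2k-1}=\frac{(-1)^{k-1}}{\pi}\int_{1/2}^\infty\int_{\sigma_{2k-2}}^\infty\cdots\int_{\sigma_1}^\infty\log|\zeta(\sigma_0)|\,d\sigma_0\,d\sigma_1\cdots d\sigma_{2k-2},$$ $$\delta_{2k}=(-1)^{k-1}\int_{1/2}^1\int_{\sigma_{2k-1}}^1\cdots\int_{\sigma_1}^1d\sigma_0\,d\sigma_1\cdots d\sigma_{2k-1}=\frac{(-1)^{k-1}}{(2k)!\,2^{2k}}.$$ For $n\ge1$ and $0<x<2$ let $$f_n(x)=\frac{x^{n+1}}{n!}\int_0^\infty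 y^n\,\frac{2\sinh(y(1-x))}{e^y+(-1)^{n+1}e^{-y}}\,dy,$$ and let $\mu_n=2^{-n-1}(1-2^{-n})\zeta(n+1)$ if $n$ is odd, $\mu_n=0$ if $n$ is even. Let $\Lambda$ be the von Mangoldt function. Assume the Riemann Hypothesis and let $n\ge1$ be an integer. Then for all $t\ge1$ and $x\ge4$, $$\begin{aligned}S_n(t)={}&\frac{1}{\pi\,n!\,(\log x)^n}\sum_\gamma\operatorname{Im}\{i^{n+2}e^{i(\gamma-t)\log x}\}\int_0^\infty\frac{y^{n+1}}{y^2+((\gamma-t)\log x)^2}\,\frac{2}{e^y+(-1)^{n+1}e^{-y}}\,dy\\&+\frac1\pi\sum_{2\le m\le x}\operatorname{Im}\{i^nm^{-it}\}\frac{\Lambda(m)}{\sqrt m\,(\log m)^{n+1}}\,f_n\!\left(\frac{\log m}{\log x}\right)\\&+\mu_n\,\frac{\operatorname{Im}\{i^n\}}{\pi(\log x)^{n+1}}\log\frac{t}{2\pi}+O\!\left(\frac{\sqrt x}{t(\log x)^{n+2}}\right),\end{aligned}$$ where the first sum runs over the ordinates $\gamma$ (positive and negative) of all non-trivial zeros of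 $\zeta$, counted with multiplicity, and converges absolutely, and the constant implied by $O$ depends only on $n$. -/

import Mathlib

noncomputable section

namespace ZetaArgument

open Complex Set Filter Topology MeasureTheory

/-- `a` is the value at `1/2 + it` of the argument of `ζ` obtained by continuous variation along
the segments from `2` to `2 + it` (where it is `α`) and from `2 + it` to `1/2 + it`
(where it is `β`), starting from the argument `0` at `2`. -/
def IsArgValue (t a : ℝ) : Prop :=
  ∃ α β : ℝ → ℝ,
    ContinuousOn α (Icc 0 t) ∧
    ContinuousOn β (Icc (1 / 2) 2) ∧
    α 0 = 0 ∧
    (∀ y ∈ Icc (0 : ℝ) t, riemannZeta (2 + y * I) ≠ 0 ∧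
      riemannZeta (2 + y * I) = ‖riemannZeta (2 + y * I)‖ * exp (α y * I)) ∧
    β 2 = α t ∧
    (∀ σ ∈ Icc (1 / 2 : ℝ) 2, riemannZeta (σ + t * I) ≠ 0 ∧
      riemannZeta (σ + t * I) = ‖riemannZeta (σ + t * I)‖ * exp (β σ * I)) ∧
    a = β (1 / 2)

/-- `arg ζ(1/2 + it)` by continuous variation, for `t > 0` that is not the ordinate of a zero
(the value `a` with `IsArgValue t a` is then unique). -/
def argZeta (t : ℝ) : ℝ := Classical.epsilon (IsArgValue t)

/-- `t` is the ordinate of a zero of `ζ`. -/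
def IsOrdinate (t : ℝ) : Prop := ∃ s : ℂ, riemannZeta s = 0 ∧ s.im = t

open Classical in
/-- The argument function `S(t)`, `t > 0`. The ordinates of the zeros are isolated, so in the
limit below only values at non-ordinates matter. -/
def S (t : ℝ) : ℝ :=
  if IsOrdinate t then
    (1 / 2) * limUnder (𝓝[>] (0 : ℝ))
      (fun ε => argZeta (t + ε) / Real.pi + argZeta (t - ε) / Real.pi)
  else argZeta t / Real.pi

/-- The `j`-fold iterated integral
`∫_σ^∞ ∫_{σ_{j-1}}^∞ … ∫_{σ_1}^∞ log|ζ(σ_0)| dσ_0 … dσ_{j-1}`. -/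
def iterLogZeta : ℕ → ℝ → ℝ
  | 0, σ => Real.log ‖riemannZeta (σ : ℂ)‖
  | j + 1, σ => ∫ v in Ioi σ, iterLogZeta j v

/-- The `j`-fold iterated integral `∫_σ^1 ∫_{σ_{j-1}}^1 … ∫_{σ_1}^1 dσ_0 … dσ_{j-1}`. -/
def iterOne : ℕ → ℝ → ℝ
  | 0, _ => 1
  | j + 1, σ => ∫ v in σ..1, iterOne j v

/-- The constants `δ_n`, `n ≥ 1`. Both for `n = 2k - 1` and for `n = 2k` the natural number
`(n - 1) / 2` is `k - 1`. -/
def delta (n : ℕ) : ℝ :=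
  if Odd n then (-1) ^ ((n - 1) / 2) / Real.pi * iterLogZeta n (1 / 2)
  else (-1) ^ ((n - 1) / 2) * iterOne n (1 / 2)

/-- The iterated antiderivatives `S_n(t)` of `S(t)`. -/
def Sn : ℕ → ℝ → ℝ
  | 0, t => S t
  | n + 1, t => (∫ τ in (0 : ℝ)..t, Sn n τ) + delta (n + 1)

/-- The weight function `f_n` on `(0, 2)`. -/
def f (n : ℕ) (x : ℝ) : ℝ :=
  x ^ (n + 1) / (n.factorial : ℝ) *
    ∫ y in Ioi (0 : ℝ), y ^ n *
      (2 * Real.sinh (y * (1 - x)) / (Real.exp y + (-1) ^ (n + 1) * Real.exp (-y)))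

/-- The kernel `∫_0^∞ y^{n+1} / (y² + v²) · 2 / (e^y + (-1)^{n+1} e^{-y}) dy`. -/
def kernel (n : ℕ) (v : ℝ) : ℝ :=
  ∫ y in Ioi (0 : ℝ), y ^ (n + 1) / (y ^ 2 + v ^ 2) *
    (2 / (Real.exp y + (-1) ^ (n + 1) * Real.exp (-y)))

/-- The constant `μ_n`. -/
def mu (n : ℕ) : ℝ :=
  if Odd n then
    (2 : ℝ)⁻¹ ^ (n + 1) * (1 - (2 : ℝ)⁻¹ ^ n) * (riemannZeta ((n : ℂ) + 1)).re
  else 0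

/-- The non-trivial zeros of `ζ`. -/
def NontrivialZero : Type := {ρ : ℂ // riemannZeta ρ = 0 ∧ 0 < ρ.re ∧ ρ.re < 1}

/-- The ordinate `γ` of a non-trivial zero. -/
def NontrivialZero.ordinate (ρ : NontrivialZero) : ℝ := ρ.1.im

/-- The multiplicity of a non-trivial zero. -/
def NontrivialZero.mult (ρ : NontrivialZero) : ℕ := analyticOrderNatAt riemannZeta ρ.1

/-- The contribution of a zero (with its multiplicity) to the sum over zeros. -/
def zeroTerm (n : ℕ) (t x : ℝ) (ρ : NontrivialZero) : ℝ :=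
  (ρ.mult : ℝ) *
    ((I ^ (n + 2) * exp (I * (((ρ.ordinate - t) * Real.log x : ℝ) : ℂ))).im *
      kernel n ((ρ.ordinate - t) * Real.log x))

end ZetaArgument

end

/-! ### Partial fractions for entire functions of order below two. -/

noncomputable section

namespace EntirePartialFractions

open Complex Set Filter Topology Metric

variable {f : ℂ → ℂ} {c : ℂ} {B : ℝ}

/-! Under RH, for n ≥ 1 and t > 0, the function S_n is a moment of ζ'/ζ to the right of the critical
line: S_n(t) = -(1/(π n!)) Im(i^n ∫_0^∞ u^n (ζ'/ζ)(1/2+u+it) du), which is `Sn_eq_momentArg`. For n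
= 0 this holds off the ordinates, because arg ζ is minus the imaginary part of ∫ ζ'/ζ along the
horizontal ray. The step from n to n+1 integrates in t. Fubini reduces it to vertical integrals of
ζ'/ζ. Those are values of log ζ, plus log|ζ| on the real axis, plus a jump π when the line lies to
the left of the pole at 1. The last two contributions are exactly what δ_{n+1} cancels
(`integral_momentArg`).

The moment is then evaluated by an explicit formula with kernel 2u/(w²-u²). Put X = log x and F =
(ζ'/ζ)(1/2+u+it). `explicit_formula` expresses F(e^{uX} - e^{-uX}) through prime powers, zeros,
trivial zeros and the pole. Its e^{-uX} part carries the sum over zeros of 2u/(u²+(γ-t)²), which is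
2 Re ξ'/ξ, that is, 2 Re F plus Gamma terms. Absorbing this turns the left side into F e^{uX} +
conj(F) e^{-uX} (`symmetrized_explicit_formula`). With y = u log x, multiplying by i^n and taking
imaginary parts gives Im(i^n F)(e^y + (-1)^{n+1} e^{-y}), which explains the denominators in the
theorem. Dividing by this factor, multiplying by y^n and integrating over y > 0 yields the sum over
zeros with its kernel, the weights f_n, and μ_n log(t/2π). The error comes from Stirling's formula,
the trivial zeros and the pole (`abs_remainder_le`). The pole, with its factor √x, dictates the size
of the error.

Contour shifting is replaced by uniqueness of Fourier transforms. Each term of the explicit formula,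
damped by e^{-(u+1)X} and cut off at X = 0, is continuous and integrable. The transforms add up to
zero by the partial fraction expansion of ζ'/ζ (`logDeriv_zeta_sub`). That expansion follows from
those of ξ'/ξ and of the digamma function. The first is proved for any entire function of growth
exponent 3/2 (`hasSum_logDeriv`), by Jensen's bound, Borel–Carathéodory and Schwarz. -/

lemma analyticOrderAt_ne_top_of_entire (hf : Differentiable ℂ f) (hc : f c ≠ 0) (z : ℂ) :
    analyticOrderAt f z ≠ ⊤ := by
  have ha : AnalyticOnNhd ℂ f univ := fun x _ => hf.analyticAt x
  refine ha.analyticOrderAt_ne_top_of_isPreconnected (x := c) isPreconnected_univ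
    (mem_univ _) (mem_univ _) ?_
  rw [(hf.analyticAt c).analyticOrderAt_eq_zero.2 hc]
  exact ENat.zero_ne_top

/-- Dividing an entire function by the full power of a linear factor. -/
lemma exists_entire_factor (hf : Differentiable ℂ f) {a : ℂ} (ha : analyticOrderAt f a ≠ ⊤) :
    ∃ k : ℂ → ℂ, Differentiable ℂ k ∧ k a ≠ 0 ∧
      ∀ z, f z = (z - a) ^ analyticOrderNatAt f a * k z := by
  obtain ⟨g, hg, hga, hfg⟩ := (hf.analyticAt a).analyticOrderAt_ne_top.1 ha
  set m := analyticOrderNatAt f a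
  classical
  let k : ℂ → ℂ := fun z => if z = a then g a else f z / (z - a) ^ m
  have hk : k =ᶠ[𝓝 a] g := by
    filter_upwards [hfg] with z hz
    by_cases h : z = a
    · simp [k, h]
    · have : (z - a) ^ m ≠ 0 := pow_ne_zero _ (sub_ne_zero.2 h)
      simp only [k, h, if_false]
      rw [hz, smul_eq_mul]
      field_simp
  refine ⟨k, fun z => ?_, by simpa [k] using hga, fun z => ?_⟩
  · by_cases h : z = a
    · rw [h]
      exact (hg.differentiableAt).congr_of_eventuallyEq hk
    · have h1 : (fun z => f z / (z - a) ^ m) =ᶠ[𝓝 z] k := by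
        filter_upwards [isOpen_ne.mem_nhds h] with w hw
        simp [k, show w ≠ a from hw]
      refine DifferentiableAt.congr_of_eventuallyEq ?_ h1.symm
      exact (hf z).div (by fun_prop) (pow_ne_zero _ (sub_ne_zero.2 h))
  · by_cases h : z = a
    · rw [h, hfg.self_of_nhds]
      simp [k]
    · have : (z - a) ^ m ≠ 0 := pow_ne_zero _ (sub_ne_zero.2 h)
      simp only [k, h, if_false]
      field_simp

/-- One factor is removed at a time. The factors already removed do not vanish at the new point, so
the cofactor has there the same order as `f`. -/
lemma exists_entire_factor_finset (hf : Differentiable ℂ f) (hc : f c ≠ 0) (T : Finset ℂ) :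
    ∃ h : ℂ → ℂ, Differentiable ℂ h ∧ (∀ a ∈ T, h a ≠ 0) ∧
      ∀ z, f z = (∏ a ∈ T, (z - a) ^ analyticOrderNatAt f a) * h z := by
  classical
  induction T using Finset.induction_on with
  | empty => exact ⟨f, hf, by simp, by simp⟩
  | insert a T ha ih =>
    obtain ⟨h, hh, hT, hfac⟩ := ih
    set p : ℂ → ℂ := fun z => ∏ b ∈ T, (z - b) ^ analyticOrderNatAt f b with hp
    have hpd : Differentiable ℂ p := by
      rw [hp]; fun_prop
    have hpa : p a ≠ 0 := Finset.prod_ne_zero_iff.2 fun b hb =>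
      pow_ne_zero _ (sub_ne_zero.2 fun hab => ha (hab ▸ hb))
    have hfeq : f = p * h := funext hfac
    have hord : analyticOrderAt f a = analyticOrderAt h a := by
      conv_lhs => rw [hfeq]
      rw [analyticOrderAt_mul (hpd.analyticAt a) (hh.analyticAt a),
        (hpd.analyticAt a).analyticOrderAt_eq_zero.2 hpa, zero_add]
    obtain ⟨k, hk, hka, hfk⟩ := exists_entire_factor hh
      (hord ▸ analyticOrderAt_ne_top_of_entire hf hc a)
    have hnat : analyticOrderNatAt h a = analyticOrderNatAt f a := by
      simp only [analyticOrderNatAt, hord]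
    refine ⟨k, hk, fun b hb => ?_, fun z => ?_⟩
    · rcases Finset.mem_insert.1 hb with rfl | hb
      · exact hka
      · intro h0
        apply hT b hb
        rw [hfk b, h0, mul_zero]
    · rw [hfac z, hfk z, Finset.prod_insert ha, hnat]
      ring

lemma finite_zeros_inter_closedBall (hf : Differentiable ℂ f) (hc : f c ≠ 0) (R : ℝ) :
    ({z | f z = 0} ∩ closedBall c R).Finite := by
  have ha : AnalyticOnNhd ℂ f univ := fun x _ => hf.analyticAt x
  have h1 := ha.preimage_zero_mem_codiscrete hc
  rw [mem_codiscrete'] at h1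
  have hcl : IsClosed {z | f z = 0} := isClosed_eq hf.continuous continuous_const
  have h2 : IsDiscrete {z | f z = 0} := by
    convert h1.2 using 1
    ext z
    simp
  have hK := (isCompact_closedBall c R).inter_left hcl
  exact hK.finite (h2.mono inter_subset_left)

/-- Jensen's bound for the number of zeros in a disc. -/
lemma sum_order_le (hf : Differentiable ℂ f) (hc : f c ≠ 0) (hB : 0 ≤ B)
    (hg : ∀ z, ‖f z‖ ≤ Real.exp (B * (1 + ‖z - c‖) ^ (3 / 2 : ℝ))) {r : ℝ} (hr : 0 < r)
    (T : Finset ℂ) (hT : ∀ a ∈ T, ‖a - c‖ ≤ r) :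
    (∑ a ∈ T, (analyticOrderNatAt f a : ℝ)) ≤
      (B * (1 + 2 * r) ^ (3 / 2 : ℝ) - Real.log ‖f c‖) / Real.log 2 := by
  have ha : AnalyticOnNhd ℂ f univ := fun x _ => hf.analyticAt x
  have hM : 1 ≤ Real.exp (B * (1 + 2 * r) ^ (3 / 2 : ℝ)) := Real.one_le_exp (by positivity)
  have h := AnalyticOnNhd.sum_divisor_le (c := c) (r := r) (R := 2 * r) (f := f)
    (abs_pos.2 hr.ne') (by rw [abs_of_pos hr, abs_of_pos (by positivity)]; linarith) hM
    (ha.mono (subset_univ _)) hc (fun z hz => by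
      rw [abs_of_pos (by positivity), mem_sphere_iff_norm] at hz
      simpa [hz] using hg z)
  have h2r : 2 * r / r = 2 := by field_simp
  rw [h2r, Real.log_div (Real.exp_pos _).ne' (norm_ne_zero_iff.2 hc), Real.log_exp,
    abs_of_pos hr] at h
  refine le_trans ?_ h
  set D := MeromorphicOn.divisor f (closedBall c r)
  have hfin : (Function.support D).Finite := D.finiteSupport (isCompact_closedBall c r)
  have hDa : ∀ a ∈ closedBall c r, D a = (analyticOrderNatAt f a : ℤ) := fun a hac => by
    have h1 := MeromorphicOn.AnalyticOnNhd.divisor_apply (ha.mono (subset_univ (closedBall c r))) hac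
    rw [h1, ← Nat.cast_analyticOrderNatAt (analyticOrderAt_ne_top_of_entire hf hc a)]
    simp
  have hD0 : ∀ a, 0 ≤ D a := fun a => by
    by_cases hac : a ∈ closedBall c r
    · rw [hDa a hac]; positivity
    · rw [D.apply_eq_zero_of_notMem hac]
  classical
  rw [finsum_eq_sum_of_support_subset (s := hfin.toFinset ∪ T) _ (by simp)]
  push_cast
  calc ∑ a ∈ T, (analyticOrderNatAt f a : ℝ) = ∑ a ∈ T, (D a : ℝ) := by
        refine Finset.sum_congr rfl fun a haT => ?_
        rw [hDa a (mem_closedBall_iff_norm.2 (hT a haT))]; simp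
    _ ≤ _ := Finset.sum_le_sum_of_subset_of_nonneg Finset.subset_union_right
        fun a _ _ => by exact_mod_cast hD0 a

/-- Spreads an inverse square over dyadic scales, so that Jensen's bound can be applied at each
radius 2^k. The least k with r ≤ 2^k satisfies 2^k ≤ 2 max(1, r), which accounts for the factor 4.
-/
lemma inv_max_sq_le_tsum (r : ℝ) :
    1 / (max 1 r) ^ 2 ≤ 4 * ∑' k : ℕ, (if r ≤ 2 ^ k then (1 / 4 : ℝ) ^ k else 0) := by
  have hs : Summable fun k : ℕ => (if r ≤ 2 ^ k then (1 / 4 : ℝ) ^ k else 0) := by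
    refine Summable.of_nonneg_of_le (fun k => by split_ifs <;> positivity) (fun k => ?_)
      (summable_geometric_of_lt_one (by norm_num : (0 : ℝ) ≤ 1 / 4) (by norm_num))
    split_ifs
    · exact le_rfl
    · positivity
  obtain ⟨k, hk1, hk2⟩ : ∃ k : ℕ, r ≤ 2 ^ k ∧ (2 : ℝ) ^ k ≤ 2 * max 1 r := by
    have hex : ∃ k : ℕ, r ≤ 2 ^ k := by
      obtain ⟨k, hk⟩ := pow_unbounded_of_one_lt r (by norm_num : (1 : ℝ) < 2)
      exact ⟨k, hk.le⟩
    classical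
    refine ⟨Nat.find hex, Nat.find_spec hex, ?_⟩
    rcases Nat.eq_zero_or_pos (Nat.find hex) with h0 | hpos
    · rw [h0]; have := le_max_left 1 r; simp; linarith
    · have := Nat.find_min hex (Nat.sub_lt hpos one_pos)
      push Not at this
      obtain ⟨j, hj⟩ : ∃ j, Nat.find hex = j + 1 := ⟨_, (Nat.sub_add_cancel hpos).symm⟩
      rw [hj] at this ⊢
      rw [pow_succ]
      simp only [Nat.add_sub_cancel] at this
      have := le_max_right 1 r
      linarith
  have h1 : (1 / 4 : ℝ) ^ k ≤ ∑' k : ℕ, (if r ≤ 2 ^ k then (1 / 4 : ℝ) ^ k else 0) := by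
    have := hs.le_tsum k (fun j _ => by split_ifs <;> positivity)
    simpa [hk1] using this
  have hmax : 0 < max 1 r := lt_max_of_lt_left one_pos
  have h2 : 1 / (max 1 r) ^ 2 ≤ 4 * (1 / 4 : ℝ) ^ k := by
    have h3 : ((2 : ℝ) ^ k) ^ 2 ≤ (2 * max 1 r) ^ 2 := by gcongr
    have h4 : ((2 : ℝ) ^ k) ^ 2 = 4 ^ k := by rw [← pow_mul, mul_comm, pow_mul]; norm_num
    rw [h4] at h3
    rw [one_div_pow, div_le_iff₀ (by positivity)]
    have : (0 : ℝ) < 4 ^ k := by positivity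
    field_simp
    nlinarith
  linarith

/-- The disc of radius 2^k holds O(2^{3k/2}) zeros and carries the weight 4^{-k}. The resulting
series converges because 3/2 < 2. -/
lemma summable_order_div_sq (hf : Differentiable ℂ f) (hc : f c ≠ 0) (hB : 0 ≤ B)
    (hg : ∀ z, ‖f z‖ ≤ Real.exp (B * (1 + ‖z - c‖) ^ (3 / 2 : ℝ))) :
    Summable fun a : {a : ℂ // f a = 0} => (analyticOrderNatAt f a : ℝ) / ‖(a : ℂ) - c‖ ^ 2 := by
  set N : ℝ → ℝ := fun r => (B * (1 + 2 * r) ^ (3 / 2 : ℝ) - Real.log ‖f c‖) / Real.log 2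
  have hl2 : 0 < Real.log 2 := Real.log_pos (by norm_num)
  have hN : Summable fun k : ℕ => (1 / 4 : ℝ) ^ k * N (2 ^ k) := by
    have h1 : Summable fun k : ℕ =>
        (B * (3 : ℝ) ^ (3 / 2 : ℝ) / Real.log 2) * ((2 : ℝ) ^ (3 / 2 : ℝ) / 4) ^ k := by
      refine (summable_geometric_of_lt_one (by positivity) ?_).mul_left _
      rw [div_lt_one (by norm_num), show (4 : ℝ) = 2 ^ (2 : ℝ) by norm_num]
      exact Real.rpow_lt_rpow_of_exponent_lt (by norm_num) (by norm_num)
    have h2 : Summable fun k : ℕ => (|Real.log ‖f c‖| / Real.log 2) * (1 / 4 : ℝ) ^ k :=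
      (summable_geometric_of_lt_one (by norm_num) (by norm_num)).mul_left _
    refine Summable.of_norm_bounded (h1.add h2) fun k => ?_
    have hp : (1 + 2 * (2 : ℝ) ^ k) ^ (3 / 2 : ℝ) ≤ 3 ^ (3 / 2 : ℝ) * ((2 : ℝ) ^ (3 / 2 : ℝ)) ^ k := by
      rw [← Real.rpow_natCast ((2 : ℝ) ^ (3 / 2 : ℝ)) k, ← Real.rpow_mul (by norm_num), mul_comm (3 / 2 : ℝ),
        Real.rpow_mul (by norm_num), Real.rpow_natCast, ← Real.mul_rpow (by norm_num) (by positivity)]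
      refine Real.rpow_le_rpow (by positivity) ?_ (by norm_num)
      have : (1 : ℝ) ≤ 2 ^ k := one_le_pow₀ (by norm_num)
      linarith
    rw [norm_mul, Real.norm_eq_abs, Real.norm_eq_abs, abs_of_pos (by positivity)]
    have hab : |N (2 ^ k)| ≤ (B * (3 ^ (3 / 2 : ℝ) * ((2 : ℝ) ^ (3 / 2 : ℝ)) ^ k) + |Real.log ‖f c‖|) / Real.log 2 := by
      simp only [N]
      rw [abs_div, abs_of_pos hl2]
      gcongr
      refine (abs_sub _ _).trans ?_
      rw [abs_of_nonneg (by positivity)]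
      gcongr
    calc _ ≤ (1 / 4 : ℝ) ^ k * ((B * (3 ^ (3 / 2 : ℝ) * ((2 : ℝ) ^ (3 / 2 : ℝ)) ^ k) + |Real.log ‖f c‖|) / Real.log 2) := by gcongr
      _ = _ := by rw [div_pow, div_pow]; ring
  have hmaxs : Summable fun a : {a : ℂ // f a = 0} =>
      (analyticOrderNatAt f a : ℝ) * (1 / (max 1 ‖(a : ℂ) - c‖) ^ 2) := by
    refine summable_of_sum_le (c := 4 * ∑' k : ℕ, (1 / 4 : ℝ) ^ k * N (2 ^ k))
      (fun a => by positivity) fun T => ?_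
    have hs : ∀ r : ℝ, Summable fun k : ℕ => (if r ≤ 2 ^ k then (1 / 4 : ℝ) ^ k else 0) := fun r => by
      refine Summable.of_nonneg_of_le (fun k => by split_ifs <;> positivity) (fun k => ?_)
        (summable_geometric_of_lt_one (by norm_num : (0 : ℝ) ≤ 1 / 4) (by norm_num))
      split_ifs
      · exact le_rfl
      · positivity
    calc _ ≤ ∑ a ∈ T, (analyticOrderNatAt f a : ℝ) *
          (4 * ∑' k : ℕ, (if ‖(a : ℂ) - c‖ ≤ 2 ^ k then (1 / 4 : ℝ) ^ k else 0)) := by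
          gcongr with a _
          exact inv_max_sq_le_tsum _
      _ = 4 * ∑ a ∈ T, ∑' k : ℕ, (analyticOrderNatAt f a : ℝ) *
          (if ‖(a : ℂ) - c‖ ≤ 2 ^ k then (1 / 4 : ℝ) ^ k else 0) := by
          rw [Finset.mul_sum]
          refine Finset.sum_congr rfl fun a _ => ?_
          rw [tsum_mul_left]; ring
      _ = 4 * ∑' k : ℕ, ∑ a ∈ T, (analyticOrderNatAt f a : ℝ) *
          (if ‖(a : ℂ) - c‖ ≤ 2 ^ k then (1 / 4 : ℝ) ^ k else 0) := by
          rw [Summable.tsum_finsetSum fun a _ => (hs _).mul_left _]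
      _ ≤ _ := by
          -- After the interchange of sums, the inner sum at level k counts the zeros within
          -- distance 2^k of c, and Jensen applies.
          refine mul_le_mul_of_nonneg_left (Summable.tsum_le_tsum (fun k => ?_)
            (summable_sum fun a _ => (hs _).mul_left _) hN) (by norm_num)
          classical
          have h1 := sum_order_le hf hc hB hg (r := 2 ^ k) (by positivity)
            ((T.filter fun a : {a : ℂ // f a = 0} => ‖(a : ℂ) - c‖ ≤ 2 ^ k).image Subtype.val) (by
              intro a ha
              simp only [Finset.mem_image, Finset.mem_filter] at ha
              obtain ⟨b, ⟨_, hb⟩, rfl⟩ := ha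
              exact hb)
          rw [Finset.sum_image (fun a _ b _ h => Subtype.ext h), Finset.sum_filter] at h1
          calc _ = (1 / 4 : ℝ) ^ k * ∑ a ∈ T, (if ‖(a : ℂ) - c‖ ≤ 2 ^ k then
                (analyticOrderNatAt f a : ℝ) else 0) := by
                rw [Finset.mul_sum]
                refine Finset.sum_congr rfl fun a _ => ?_
                split_ifs <;> ring
            _ ≤ _ := by gcongr
  -- Zeros stay away from `c`, so replacing `max 1 ‖a - c‖` by `‖a - c‖` costs only a constant.
  obtain ⟨d, hd, hdist⟩ : ∃ d > 0, ∀ a, f a = 0 → d ≤ ‖a - c‖ := by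
    have : ∀ᶠ z in 𝓝 c, f z ≠ 0 := hf.continuous.continuousAt.eventually_ne hc
    obtain ⟨d, hd, h⟩ := Metric.eventually_nhds_iff.1 this
    refine ⟨d, hd, fun a ha => ?_⟩
    by_contra hlt
    exact h (by rw [dist_eq_norm]; push Not at hlt; exact hlt) ha
  refine Summable.of_nonneg_of_le (fun a => by positivity) (fun a => ?_)
    (hmaxs.mul_left (max 1 (1 / d ^ 2)))
  have hda := hdist a a.2
  have hpos : 0 < ‖(a : ℂ) - c‖ := hd.trans_le hda
  rw [div_eq_mul_one_div, mul_left_comm]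
  refine mul_le_mul_of_nonneg_left ?_ (by positivity)
  rcases le_total 1 ‖(a : ℂ) - c‖ with h | h
  · rw [max_eq_right h]
    exact le_mul_of_one_le_left (by positivity) (le_max_left _ _)
  · rw [max_eq_left h]
    calc 1 / ‖(a : ℂ) - c‖ ^ 2 ≤ 1 / d ^ 2 := by gcongr
      _ ≤ _ := by simp

/-- The logarithmic derivative of a zero-free function of bounded growth is nearly constant. -/
lemma norm_logDeriv_sub_le {h : ℂ → ℂ} {R K : ℝ} (hR : 0 < R) (hK : 0 < K)
    (hh : Differentiable ℂ h) (h0 : ∀ z ∈ ball c R, h z ≠ 0)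
    (hbd : ∀ z ∈ ball c R, ‖h z‖ ≤ Real.exp K * ‖h c‖) {z : ℂ} (hz : ‖z - c‖ < R / 4) :
    ‖logDeriv h z - logDeriv h c‖ ≤ 64 * K / R ^ 2 * ‖z - c‖ := by
  have hld : DifferentiableOn ℂ (logDeriv h) (ball c R) := fun w hw =>
    ((hh.analyticAt w).deriv.differentiableAt.div (hh w) (h0 w hw)).differentiableWithinAt
  -- `q` is the primitive of h'/h vanishing at `c`, that is, a logarithm of h/h(c).
  obtain ⟨q, hqc, hq⟩ := (hld.isExactOn_ball).with_val_at c 0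
  have hcR : c ∈ ball c R := mem_ball_self hR
  have hexp : ∀ w ∈ ball c R, h w = h c * exp (q w) := by
    have hder : ∀ w ∈ ball c R, HasDerivAt (fun w => h w * exp (-q w)) 0 w := fun w hw => by
      have h1 := ((hh w).hasDerivAt).mul ((hq w hw).neg.cexp)
      refine h1.congr_deriv ?_
      rw [logDeriv_apply]
      have := h0 w hw
      field_simp
      ring
    intro w hw
    have hconst : h w * exp (-q w) = h c * exp (-q c) := by
      refine (convex_ball c R).is_const_of_fderivWithin_eq_zero (𝕜 := ℂ)
        (fun x hx => (hder x hx).differentiableAt.differentiableWithinAt) (fun x hx => ?_) hw hcR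
      rw [fderivWithin_of_isOpen isOpen_ball hx]
      ext
      simp [(hder x hx).hasFDerivAt.fderiv]
    rw [hqc, neg_zero, exp_zero, mul_one, exp_neg] at hconst
    rw [← hconst]
    field_simp [exp_ne_zero]
  have hre : ∀ w ∈ ball c R, (q w).re ≤ K := fun w hw => by
    have h1 := hbd w hw
    rw [hexp w hw, norm_mul, norm_exp, mul_comm] at h1
    have hpos : 0 < ‖h c‖ := norm_pos_iff.2 (h0 c hcR)
    exact Real.exp_le_exp.1 (le_of_mul_le_mul_right h1 hpos)
  have hqd : DifferentiableOn ℂ q (ball c R) := fun w hw =>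
    (hq w hw).differentiableAt.differentiableWithinAt
  -- Borel–Carathéodory: the real part of `q` is at most K on the ball, hence ‖q‖ ≤ 2K on half the
  -- radius.
  have hqb : ∀ w, ‖w - c‖ ≤ R / 2 → ‖q w‖ ≤ 2 * K := fun w hw => by
    have h1 := borelCaratheodory_zero (f := fun y => q (c + y)) (R := R) (z := w - c) hK
      (by
        refine hqd.comp (by fun_prop) fun y hy => ?_
        simpa using hy)
      (fun y hy => hre _ (by simpa using hy)) hR (by
        rw [mem_ball_zero_iff]; linarith) (by simpa using hqc)
    simp only [add_sub_cancel] at h1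
    refine h1.trans ?_
    have : 0 < R - ‖w - c‖ := by linarith
    rw [div_le_iff₀ this]
    nlinarith
  have hq' : ∀ w ∈ ball c R, deriv q w = logDeriv h w := fun w hw => (hq w hw).deriv
  -- Cauchy's estimate on circles of radius R/4.
  have hq'b : ∀ w, ‖w - c‖ < R / 4 → ‖logDeriv h w‖ ≤ 8 * K / R := fun w hw => by
    rw [← hq' w (mem_ball_iff_norm.2 (by linarith))]
    have h1 := norm_deriv_le_of_forall_mem_sphere_norm_le (f := q) (c := w) (R := R / 4) (C := 2 * K)
      (by positivity) (by
        refine (hqd.mono ?_).diffContOnCl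
        rw [closure_ball _ (by positivity)]
        intro y hy
        rw [mem_closedBall_iff_norm] at hy
        rw [mem_ball_iff_norm]
        calc ‖y - c‖ ≤ ‖y - w‖ + ‖w - c‖ := norm_sub_le_norm_sub_add_norm_sub _ _ _
          _ < R := by linarith) (fun y hy => hqb y (by
        rw [mem_sphere_iff_norm] at hy
        calc ‖y - c‖ ≤ ‖y - w‖ + ‖w - c‖ := norm_sub_le_norm_sub_add_norm_sub _ _ _
          _ ≤ R / 2 := by linarith))
    refine h1.trans (le_of_eq ?_)
    field_simp
    ring
  -- Schwarz's lemma: a variation of at most 16K/R over a ball of radius R/4 gives the slope 64K/R².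
  have h2 := dist_le_div_mul_dist_of_mapsTo_ball (f := logDeriv h) (c := c) (R₁ := R / 4)
    (R₂ := 16 * K / R) (z := z) (hld.mono (ball_subset_ball (by linarith))) (fun w hw => by
      rw [mem_closedBall_iff_norm]
      calc _ ≤ ‖logDeriv h w‖ + ‖logDeriv h c‖ := norm_sub_le _ _
        _ ≤ 8 * K / R + 8 * K / R := add_le_add (hq'b w (mem_ball_iff_norm.1 hw))
            (hq'b c (by simpa using hR))
        _ = _ := by ring) (mem_ball_iff_norm.2 hz)
  rw [dist_eq_norm, dist_eq_norm] at h2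
  refine h2.trans (le_of_eq ?_)
  field_simp
  ring

/-- Dividing out the zeros within distance R leaves a function without zeros in that disc, to which
`norm_logDeriv_sub_le` applies. The error is O(R^{3/2}/R²) for fixed z, and so tends to zero. -/
lemma norm_logDeriv_sub_sum_le (hf : Differentiable ℂ f) (hc : f c ≠ 0) (hB : 0 ≤ B)
    (hg : ∀ z, ‖f z‖ ≤ Real.exp (B * (1 + ‖z - c‖) ^ (3 / 2 : ℝ))) {R : ℝ} (hR : 0 < R)
    (T : Finset ℂ) (hT : ∀ a, a ∈ T ↔ f a = 0 ∧ ‖a - c‖ ≤ R) {z : ℂ} (hz : ‖z - c‖ < R / 4)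
    (hfz : f z ≠ 0) :
    ‖logDeriv f z - logDeriv f c -
      ∑ a ∈ T, (analyticOrderNatAt f a : ℂ) * (1 / (z - a) - 1 / (c - a))‖ ≤
      64 * (B * (1 + 2 * R) ^ (3 / 2 : ℝ) + |Real.log ‖f c‖| + 1) / R ^ 2 * ‖z - c‖ := by
  obtain ⟨h, hh, hhT, hfac⟩ := exists_entire_factor_finset hf hc T
  set p : ℂ → ℂ := fun z => ∏ a ∈ T, (z - a) ^ analyticOrderNatAt f a with hp
  have hpd : Differentiable ℂ p := by rw [hp]; fun_prop
  have hh0 : ∀ w, ‖w - c‖ ≤ R → h w ≠ 0 := fun w hw h0 => by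
    have : f w = 0 := by rw [hfac w, h0, mul_zero]
    exact hhT w ((hT w).2 ⟨this, hw⟩) h0
  have hfp : f = fun z => p z * h z := funext hfac
  have hld : ∀ w, f w ≠ 0 → logDeriv f w =
      (∑ a ∈ T, (analyticOrderNatAt f a : ℂ) * (1 / (w - a))) + logDeriv h w := fun w hw => by
    have hpw : p w ≠ 0 := fun h0 => hw (by rw [hfac w]; simp only [hp] at h0; rw [h0, zero_mul])
    have hhw : h w ≠ 0 := fun h0 => hw (by rw [hfac w, h0, mul_zero])
    conv_lhs => rw [hfp]
    rw [logDeriv_mul _ hpw hhw (hpd w) (hh w)]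
    congr 1
    have hne : ∀ a ∈ T, w - a ≠ 0 := fun a ha h0 => hw (by
      rw [sub_eq_zero.1 h0]; exact ((hT a).1 ha).1)
    rw [hp, logDeriv_prod (f := fun a z => (z - a) ^ analyticOrderNatAt f a)
      (fun a ha => pow_ne_zero _ (hne a ha)) (fun a _ => by fun_prop)]
    refine Finset.sum_congr rfl fun a ha => ?_
    rw [logDeriv_fun_pow (by fun_prop)]
    simp [logDeriv_apply]
  have hkey : logDeriv f z - logDeriv f c -
      ∑ a ∈ T, (analyticOrderNatAt f a : ℂ) * (1 / (z - a) - 1 / (c - a)) =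
      logDeriv h z - logDeriv h c := by
    rw [hld z hfz, hld c hc]
    simp only [mul_sub, Finset.sum_sub_distrib]
    ring
  rw [hkey]
  set K := B * (1 + 2 * R) ^ (3 / 2 : ℝ) + |Real.log ‖f c‖| + 1 with hKdef
  have hK : 0 < K := by positivity
  refine norm_logDeriv_sub_le hR hK hh (fun w hw => hh0 w (mem_ball_iff_norm.1 hw).le) ?_ hz
  have hpc : 0 < ‖p c‖ := norm_pos_iff.2 fun h0 => hc (by
    rw [hfac c]; simp only [hp] at h0; rw [h0, zero_mul])
  -- On the circle of radius 2R every removed factor satisfies |w - a| ≥ R ≥ |c - a|. So the growth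
  -- of h relative to h(c) is at most that of f relative to f(c), and the maximum principle carries
  -- this inside.
  have hsph : ∀ w ∈ frontier (ball c (2 * R)), ‖h w‖ ≤ Real.exp K * ‖h c‖ := fun w hw => by
    rw [frontier_ball _ (by positivity), mem_sphere_iff_norm] at hw
    have hple : ‖p c‖ ≤ ‖p w‖ := by
      simp only [hp, norm_prod, norm_pow]
      refine Finset.prod_le_prod (fun a _ => by positivity) fun a ha => ?_
      have h1 := ((hT a).1 ha).2
      have h2 : ‖w - c‖ ≤ ‖w - a‖ + ‖a - c‖ := norm_sub_le_norm_sub_add_norm_sub _ _ _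
      rw [norm_sub_rev c a]
      gcongr
      linarith
    have h1 : ‖p w‖ * ‖h w‖ ≤ Real.exp K * (‖p c‖ * ‖h c‖) := by
      rw [← norm_mul, ← norm_mul, ← hfac w, ← hfac c]
      refine (hg w).trans ?_
      rw [hw]
      have h2 : ‖f c‖ = Real.exp (Real.log ‖f c‖) := (Real.exp_log (norm_pos_iff.2 hc)).symm
      rw [h2, ← Real.exp_add]
      refine Real.exp_le_exp.2 ?_
      have := neg_abs_le (Real.log ‖f c‖)
      linarith
    have h3 : ‖p c‖ * ‖h w‖ ≤ ‖p c‖ * (Real.exp K * ‖h c‖) :=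
      (mul_le_mul_of_nonneg_right hple (norm_nonneg _)).trans (h1.trans (le_of_eq (by ring)))
    exact le_of_mul_le_mul_left h3 hpc
  intro w hw
  refine norm_le_of_forall_mem_frontier_norm_le (U := ball c (2 * R)) isBounded_ball
    hh.diffContOnCl hsph (subset_closure ?_)
  exact ball_subset_ball (by linarith) hw

/-- Partial fractions of the logarithmic derivative of an entire function of order less than two. -/
theorem hasSum_logDeriv (hf : Differentiable ℂ f) (hc : f c ≠ 0) (hB : 0 ≤ B)
    (hg : ∀ z, ‖f z‖ ≤ Real.exp (B * (1 + ‖z - c‖) ^ (3 / 2 : ℝ))) {z : ℂ} (hfz : f z ≠ 0) :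
    HasSum (fun a : {a : ℂ // f a = 0} =>
      (analyticOrderNatAt f a : ℂ) * (1 / (z - a) - 1 / (c - a)))
      (logDeriv f z - logDeriv f c) := by
  have hsum := summable_order_div_sq hf hc hB hg
  have hS : Summable (fun a : {a : ℂ // f a = 0} =>
      (analyticOrderNatAt f a : ℂ) * (1 / (z - a) - 1 / (c - a))) := by
    obtain ⟨d, hd, hdist⟩ : ∃ d > 0, ∀ a, f a = 0 → d ≤ ‖z - a‖ := by
      have : ∀ᶠ w in 𝓝 z, f w ≠ 0 := hf.continuous.continuousAt.eventually_ne hfz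
      obtain ⟨d, hd, h⟩ := Metric.eventually_nhds_iff.1 this
      refine ⟨d, hd, fun a ha => ?_⟩
      by_contra hlt
      exact h (by rw [dist_comm, dist_eq_norm]; push Not at hlt; exact hlt) ha
    refine Summable.of_norm_bounded (hsum.mul_left (‖z - c‖ * (1 + ‖z - c‖ / d))) fun a => ?_
    have hza : z - a ≠ 0 := fun h => hfz (by rw [sub_eq_zero.1 h]; exact a.2)
    have hca : c - a ≠ 0 := fun h => hc (by rw [sub_eq_zero.1 h]; exact a.2)
    -- The difference of the two fractions decays like the inverse square of ‖a - c‖, which gives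
    -- absolute convergence.
    have h1 : 1 / (z - a) - 1 / (c - a) = (c - z) / ((z - a) * (c - a)) := by
      field_simp
      ring
    have hpos : 0 < ‖(a : ℂ) - c‖ := by rw [norm_sub_rev]; exact norm_pos_iff.2 hca
    have hzp : 0 < ‖z - a‖ := norm_pos_iff.2 hza
    have h2 : ‖(a : ℂ) - c‖ ≤ (1 + ‖z - c‖ / d) * ‖z - a‖ := by
      have h3 : ‖(a : ℂ) - c‖ ≤ ‖z - a‖ + ‖z - c‖ := by
        rw [norm_sub_rev z a]; exact norm_sub_le_norm_sub_add_norm_sub _ _ _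
      have h4 : ‖z - c‖ ≤ ‖z - c‖ / d * ‖z - a‖ := by
        rw [div_mul_eq_mul_div, le_div_iff₀ hd]
        exact mul_le_mul_of_nonneg_left (hdist a a.2) (norm_nonneg _)
      linarith
    rw [h1, norm_mul, norm_div, norm_mul, norm_natCast, norm_sub_rev c z, norm_sub_rev c a]
    refine le_of_le_of_eq ?_ (mul_div_left_comm _ _ _).symm
    refine mul_le_mul_of_nonneg_left ?_ (by positivity)
    rw [div_le_div_iff₀ (by positivity) (by positivity)]
    calc ‖z - c‖ * ‖(a : ℂ) - c‖ ^ 2 = ‖z - c‖ * ‖(a : ℂ) - c‖ * ‖(a : ℂ) - c‖ := by ring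
      _ ≤ ‖z - c‖ * ‖(a : ℂ) - c‖ * ((1 + ‖z - c‖ / d) * ‖z - a‖) := by gcongr
      _ = _ := by ring
  have hfin : ∀ N : ℕ, {a : {a : ℂ // f a = 0} | ‖(a : ℂ) - c‖ ≤ N}.Finite := fun N => by
    refine Set.Finite.of_finite_image (f := Subtype.val) ?_ Subtype.val_injective.injOn
    refine (finite_zeros_inter_closedBall hf hc N).subset ?_
    rintro _ ⟨a, ha, rfl⟩
    exact ⟨a.2, mem_closedBall_iff_norm.2 ha⟩
  -- Since the series converges absolutely, its sum may be identified along the exhaustion by discs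
  -- of radius N.
  have htend : Tendsto (fun N : ℕ => (hfin N).toFinset) atTop atTop := by
    refine tendsto_atTop_finset_of_monotone (fun M N h a ha => ?_) fun a => ?_
    · simp only [Finite.mem_toFinset, mem_ofPred_eq] at ha ⊢
      exact ha.trans (by exact_mod_cast h)
    · obtain ⟨N, hN⟩ := exists_nat_ge ‖(a : ℂ) - c‖
      exact ⟨N, by simpa using hN⟩
  have hlim1 := hS.hasSum.comp htend
  have hlim2 : Tendsto (fun N : ℕ => ∑ a ∈ (hfin N).toFinset,
      (analyticOrderNatAt f a : ℂ) * (1 / (z - a) - 1 / (c - a))) atTop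
      (𝓝 (logDeriv f z - logDeriv f c)) := by
    rw [tendsto_iff_norm_sub_tendsto_zero]
    have hlim : Tendsto (fun N : ℕ => 64 * (B * (1 + 2 * (N : ℝ)) ^ (3 / 2 : ℝ) + |Real.log ‖f c‖| + 1) /
        (N : ℝ) ^ 2 * ‖z - c‖) atTop (𝓝 0) := by
      have h1 : Tendsto (fun N : ℕ => 64 * (B * 3 ^ (3 / 2 : ℝ) + |Real.log ‖f c‖| + 1) *
          ((N : ℝ) ^ (1 / 2 : ℝ))⁻¹ * ‖z - c‖) atTop (𝓝 0) := by
        have h2 : Tendsto (fun N : ℕ => ((N : ℝ) ^ (1 / 2 : ℝ))⁻¹) atTop (𝓝 0) :=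
          ((tendsto_rpow_atTop (by norm_num)).comp tendsto_natCast_atTop_atTop).inv_tendsto_atTop
        simpa using (h2.const_mul (64 * (B * 3 ^ (3 / 2 : ℝ) + |Real.log ‖f c‖| + 1))).mul_const ‖z - c‖
      refine tendsto_of_tendsto_of_tendsto_of_le_of_le' tendsto_const_nhds h1
        (Eventually.of_forall fun N => by positivity) ?_
      filter_upwards [eventually_ge_atTop 1] with N hN
      have hN1 : (1 : ℝ) ≤ N := by exact_mod_cast hN
      have hN0 : (0 : ℝ) < N := by linarith
      refine mul_le_mul_of_nonneg_right ?_ (norm_nonneg _)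
      have h3 : (1 + 2 * (N : ℝ)) ^ (3 / 2 : ℝ) ≤ 3 ^ (3 / 2 : ℝ) * (N : ℝ) ^ (3 / 2 : ℝ) := by
        rw [← Real.mul_rpow (by norm_num) (by positivity)]
        exact Real.rpow_le_rpow (by positivity) (by linarith) (by norm_num)
      have h4 : (1 : ℝ) ≤ (N : ℝ) ^ (3 / 2 : ℝ) := Real.one_le_rpow hN1 (by norm_num)
      have h5 : (N : ℝ) ^ 2 = (N : ℝ) ^ (3 / 2 : ℝ) * (N : ℝ) ^ (1 / 2 : ℝ) := by
        rw [← Real.rpow_add hN0]; norm_num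
      have h6 : 0 < (N : ℝ) ^ (1 / 2 : ℝ) := by positivity
      rw [div_le_iff₀ (by positivity), h5]
      have h7 : 64 * (B * 3 ^ (3 / 2 : ℝ) + |Real.log ‖f c‖| + 1) * ((N : ℝ) ^ (1 / 2 : ℝ))⁻¹ *
          ((N : ℝ) ^ (3 / 2 : ℝ) * (N : ℝ) ^ (1 / 2 : ℝ)) =
          64 * (B * (3 ^ (3 / 2 : ℝ) * (N : ℝ) ^ (3 / 2 : ℝ)) + (|Real.log ‖f c‖| + 1) * (N : ℝ) ^ (3 / 2 : ℝ)) := by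
        field_simp
        ring
      rw [h7]
      have h8 : |Real.log ‖f c‖| + 1 ≤ (|Real.log ‖f c‖| + 1) * (N : ℝ) ^ (3 / 2 : ℝ) :=
        le_mul_of_one_le_right (by positivity) h4
      have h9 := mul_le_mul_of_nonneg_left h3 hB
      linarith
    refine tendsto_of_tendsto_of_tendsto_of_le_of_le' tendsto_const_nhds hlim
      (Eventually.of_forall fun N => norm_nonneg _) ?_
    obtain ⟨M, hM⟩ := exists_nat_gt (4 * ‖z - c‖)
    filter_upwards [eventually_ge_atTop (M + 1)] with N hN
    have hMN : (M : ℝ) + 1 ≤ N := by exact_mod_cast hN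
    classical
    have h1 := norm_logDeriv_sub_sum_le hf hc hB hg (R := N) (by
        have : (0 : ℝ) ≤ M := by positivity
        linarith) ((hfin N).toFinset.image Subtype.val)
      (fun a => by
        simp only [Finset.mem_image, Finite.mem_toFinset, mem_ofPred_eq, Subtype.exists,
          exists_and_right, exists_eq_right]
        exact ⟨fun ⟨h, h'⟩ => ⟨h, h'⟩, fun ⟨h, h'⟩ => ⟨h, h'⟩⟩) (z := z) (by linarith) hfz
    rw [Finset.sum_image (fun a _ b _ h => Subtype.ext h)] at h1
    rwa [norm_sub_rev]
  have := tendsto_nhds_unique hlim1 hlim2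
  rw [← this]
  exact hS.hasSum

end EntirePartialFractions

end

/-! ### The entire function ξ and its growth. -/

noncomputable section

namespace ZetaArgument

open Complex Set Filter Topology MeasureTheory

/-- The entire function `s (s - 1) π ^ (-s/2) Γ(s/2) ζ(s)`. -/
def xi (s : ℂ) : ℂ := s * (s - 1) * completedRiemannZeta₀ s + 1

lemma differentiable_xi : Differentiable ℂ xi := by
  have := differentiable_completedZeta₀
  unfold xi
  fun_prop

lemma xi_one_sub (s : ℂ) : xi (1 - s) = xi s := by
  simp only [xi, completedRiemannZeta₀_one_sub]
  ring

/-- The summand 1 in `xi` makes up for the polar terms: s(s-1)(1/s + 1/(1-s)) = -1. -/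
lemma xi_eq {s : ℂ} (h0 : s ≠ 0) (h1 : s ≠ 1) (hG : Gammaℝ s ≠ 0) :
    xi s = s * (s - 1) * Gammaℝ s * riemannZeta s := by
  have h1' : 1 - s ≠ 0 := sub_ne_zero.2 h1.symm
  rw [riemannZeta_def_of_ne_zero h0, completedRiemannZeta_eq, xi]
  field_simp
  ring

lemma xi_one : xi 1 = 1 := by simp [xi]

/-- The Mellin integral defining it converges absolutely for every exponent. In this strip
|x^{s/2-1}| is at most x^{-1} + x^0, which gives one bound for all s. -/
lemma exists_norm_completedZeta₀_le :
    ∃ C : ℝ, ∀ s : ℂ, 0 ≤ s.re → s.re ≤ 2 → ‖completedRiemannZeta₀ s‖ ≤ C := by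
  set P := HurwitzZeta.hurwitzEvenFEPair 0
  have hconv : ∀ s : ℂ, MellinConvergent P.f_modif s := fun s =>
    (P.isStrongFEPair_toStrongFEPair.hasMellin s).1
  have hint : ∀ a : ℝ, IntegrableOn (fun x : ℝ => x ^ (a - 1) * ‖P.f_modif x‖) (Ioi 0) := fun a => by
    have : IntegrableOn (fun x : ℝ => ‖(x : ℂ) ^ ((a : ℂ) - 1) • P.f_modif x‖) (Ioi 0) :=
      Integrable.norm (hconv a)
    refine this.congr_fun (fun x hx => ?_) measurableSet_Ioi
    simp only [norm_smul, norm_cpow_eq_rpow_re_of_pos hx]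
    simp
  refine ⟨(∫ x in Ioi (0 : ℝ), (x ^ ((0 : ℝ) - 1) * ‖P.f_modif x‖ + x ^ ((1 : ℝ) - 1) * ‖P.f_modif x‖)) / 2,
    fun s h0 h2 => ?_⟩
  have hdef : completedRiemannZeta₀ s = mellin P.f_modif (s / 2) / 2 := rfl
  rw [hdef, norm_div, Complex.norm_ofNat]
  refine div_le_div_of_nonneg_right ?_ (by norm_num)
  rw [mellin]
  refine (norm_integral_le_integral_norm _).trans ?_
  refine setIntegral_mono_on (hconv (s / 2)).norm ((hint 0).add (hint 1)) measurableSet_Ioi fun x hx => ?_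
  have hx0 : 0 < x := hx
  rw [norm_smul, norm_cpow_eq_rpow_re_of_pos hx, ← add_mul]
  refine mul_le_mul_of_nonneg_right ?_ (norm_nonneg _)
  have hre : (s / 2 - 1).re = s.re / 2 - 1 := by simp
  rw [hre]
  rcases le_total x 1 with h | h
  · have := Real.rpow_le_rpow_of_exponent_ge hx0 h (show (0 : ℝ) - 1 ≤ s.re / 2 - 1 by linarith)
    have h' : 0 ≤ x ^ ((1 : ℝ) - 1) := by positivity
    exact this.trans (le_add_of_nonneg_right h')
  · have := Real.rpow_le_rpow_of_exponent_le h (show s.re / 2 - 1 ≤ (1 : ℝ) - 1 by linarith)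
    have h' : 0 ≤ x ^ ((0 : ℝ) - 1) := by positivity
    exact this.trans (le_add_of_nonneg_left h')

lemma norm_Gamma_le_Gamma_re {s : ℂ} (hs : 0 < s.re) : ‖Gamma s‖ ≤ Real.Gamma s.re := by
  rw [Gamma_eq_integral hs, Real.Gamma_eq_integral hs, GammaIntegral]
  refine (norm_integral_le_integral_norm _).trans (le_of_eq ?_)
  refine setIntegral_congr_fun measurableSet_Ioi fun x hx => ?_
  simp only [norm_mul, norm_cpow_eq_rpow_re_of_pos hx]
  rw [norm_real, Real.norm_of_nonneg (Real.exp_pos _).le]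
  simp

/-- Convexity gives Γ(x) ≤ n! with n = ⌈r⌉, and n! ≤ (2r)^{2r}. The power r^{3/2} is a crude
substitute for r log r that stays below order two. -/
lemma Gamma_le_exp {x r : ℝ} (h1 : 1 ≤ x) (hxr : x ≤ r) :
    Real.Gamma x ≤ Real.exp (8 * r ^ (3 / 2 : ℝ)) := by
  have hr : 1 ≤ r := h1.trans hxr
  set n := ⌈r⌉₊
  have hn : r ≤ n := Nat.le_ceil r
  have hn2 : (n : ℝ) ≤ 2 * r := by
    have := Nat.ceil_lt_add_one (show 0 ≤ r by linarith)
    linarith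
  have hΓ : Real.Gamma x ≤ (n.factorial : ℝ) := by
    have h := (Real.convexOn_Gamma).le_max_of_mem_Icc (x := 1) (y := (n : ℝ) + 1) (z := x)
      (by simp) (show (0 : ℝ) < n + 1 by positivity) ⟨h1, by linarith⟩
    rw [Real.Gamma_one, Real.Gamma_nat_eq_factorial] at h
    refine h.trans (max_le ?_ le_rfl)
    exact_mod_cast Nat.succ_le_of_lt n.factorial_pos
  refine hΓ.trans ?_
  have h2 : (n.factorial : ℝ) ≤ (2 * r) ^ n := by
    have h3 : (n.factorial : ℝ) ≤ (n : ℝ) ^ n := by exact_mod_cast Nat.factorial_le_pow n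
    exact h3.trans (by gcongr)
  refine h2.trans ?_
  have hpos : 0 < 2 * r := by linarith
  rw [← Real.exp_log hpos, ← Real.exp_nat_mul]
  refine Real.exp_le_exp.2 ?_
  have hlog : Real.log (2 * r) ≤ 4 * r ^ (1 / 2 : ℝ) := by
    have h4 := Real.log_le_rpow_div hpos.le (show (0 : ℝ) < 1 / 2 by norm_num)
    rw [Real.mul_rpow (by norm_num) (by linarith)] at h4
    have h5 : (2 : ℝ) ^ (1 / 2 : ℝ) ≤ 2 := by
      calc (2 : ℝ) ^ (1 / 2 : ℝ) ≤ 2 ^ (1 : ℝ) :=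
            Real.rpow_le_rpow_of_exponent_le (by norm_num) (by norm_num)
        _ = 2 := by norm_num
    have h6 : 0 ≤ r ^ (1 / 2 : ℝ) := by positivity
    have h7 := mul_le_mul_of_nonneg_right h5 h6
    linarith
  have h8 : r ^ (3 / 2 : ℝ) = r * r ^ (1 / 2 : ℝ) := by
    rw [← Real.rpow_one_add' (by linarith) (by norm_num)]; norm_num
  have hlog0 : 0 ≤ Real.log (2 * r) := Real.log_nonneg (by linarith)
  calc (n : ℝ) * Real.log (2 * r) ≤ 2 * r * (4 * r ^ (1 / 2 : ℝ)) := by gcongr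
    _ = _ := by rw [h8]; ring

lemma norm_zeta_le_of_two_le {s : ℂ} (hs : 2 ≤ s.re) :
    ‖riemannZeta s‖ ≤ ∑' n : ℕ, 1 / (n : ℝ) ^ 2 := by
  rw [zeta_eq_tsum_one_div_nat_cpow (by linarith)]
  have h2 : Summable fun n : ℕ => 1 / (n : ℝ) ^ 2 := Real.summable_one_div_nat_pow.2 (by norm_num)
  have hle : ∀ n : ℕ, ‖1 / (n : ℂ) ^ s‖ ≤ 1 / (n : ℝ) ^ 2 := fun n => by
    rcases Nat.eq_zero_or_pos n with rfl | hn
    · have : s ≠ 0 := fun h => by rw [h] at hs; norm_num at hs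
      simp [this]
    · rw [norm_div, norm_one, norm_natCast_cpow_of_pos hn]
      have h1 : (1 : ℝ) ≤ n := by exact_mod_cast hn
      refine one_div_le_one_div_of_le (by positivity) ?_
      rw [← Real.rpow_natCast]
      exact Real.rpow_le_rpow_of_exponent_le h1 (by simpa using hs)
  exact tsum_of_norm_bounded h2.hasSum hle

/-- Three regions: the product formula for Re s ≥ 2, boundedness of `completedRiemannZeta₀` for 0 ≤
Re s ≤ 2, and the functional equation for Re s < 0. -/
lemma exists_norm_xi_le : ∃ B : ℝ, 0 ≤ B ∧
    ∀ s, ‖xi s‖ ≤ Real.exp (B * (1 + ‖s - 2‖) ^ (3 / 2 : ℝ)) := by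
  obtain ⟨C, hC⟩ := exists_norm_completedZeta₀_le
  set Z := ∑' n : ℕ, 1 / (n : ℝ) ^ 2
  have hZ : 0 ≤ Z := tsum_nonneg fun n => by positivity
  have hquad : ∀ s : ℂ, ‖s * (s - 1)‖ ≤ 4 * Real.exp ((1 + ‖s - 2‖) ^ (3 / 2 : ℝ)) := fun s => by
    set r := 1 + ‖s - 2‖ with hr
    have hr1 : 1 ≤ r := by have := norm_nonneg (s - 2); linarith
    have h1 : ‖s‖ ≤ 2 * r := by
      calc ‖s‖ = ‖(s - 2) + 2‖ := by ring_nf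
        _ ≤ ‖s - 2‖ + ‖(2 : ℂ)‖ := norm_add_le _ _
        _ ≤ 2 * r := by rw [Complex.norm_ofNat]; linarith
    have h2 : ‖s - 1‖ ≤ r := by
      calc ‖s - 1‖ = ‖(s - 2) + 1‖ := by ring_nf
        _ ≤ ‖s - 2‖ + ‖(1 : ℂ)‖ := norm_add_le _ _
        _ = r := by rw [norm_one]; linarith
    have h3 : r ≤ r ^ (3 / 2 : ℝ) := by
      conv_lhs => rw [← Real.rpow_one r]
      exact Real.rpow_le_rpow_of_exponent_le hr1 (by norm_num)
    have h4 := Real.quadratic_le_exp_of_nonneg (show 0 ≤ r by linarith)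
    have h5 := Real.exp_le_exp.2 h3
    rw [norm_mul]
    calc ‖s‖ * ‖s - 1‖ ≤ 2 * r * r := by gcongr
      _ ≤ _ := by nlinarith
  have hr1 : ∀ s : ℂ, 1 ≤ (1 + ‖s - 2‖) ^ (3 / 2 : ℝ) := fun s =>
    Real.one_le_rpow (by have := norm_nonneg (s - 2); linarith) (by norm_num)
  have hright : ∀ s : ℂ, 0 ≤ s.re →
      ‖xi s‖ ≤ (4 * Z + 4 * |C| + 1) * Real.exp (9 * (1 + ‖s - 2‖) ^ (3 / 2 : ℝ)) := fun s hs => by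
    set r := 1 + ‖s - 2‖ with hr
    set e := r ^ (3 / 2 : ℝ)
    have he1 : 1 ≤ e := hr1 s
    rcases le_total 2 s.re with h2 | h2
    · have h0 : s ≠ 0 := fun h => by rw [h] at h2; norm_num at h2
      have h1 : s ≠ 1 := fun h => by rw [h] at h2; norm_num at h2
      have hGn : Gammaℝ s ≠ 0 := Gammaℝ_ne_zero_of_re_pos (by linarith)
      rw [xi_eq h0 h1 hGn, norm_mul, norm_mul]
      have hre : s.re / 2 ≤ r := by
        have h3 : (s - 2).re ≤ ‖s - 2‖ := re_le_norm _
        simp at h3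
        have := norm_nonneg (s - 2)
        linarith
      have hG : ‖Gammaℝ s‖ ≤ Real.exp (8 * e) := by
        rw [Gammaℝ_def, norm_mul]
        have h4 : ‖(Real.pi : ℂ) ^ (-s / 2)‖ ≤ 1 := by
          rw [norm_cpow_eq_rpow_re_of_pos Real.pi_pos]
          refine Real.rpow_le_one_of_one_le_of_nonpos ?_ ?_
          · linarith [Real.pi_gt_three]
          · simp; linarith
        have h5 : ‖Gamma (s / 2)‖ ≤ Real.Gamma (s.re / 2) := by
          have := norm_Gamma_le_Gamma_re (s := s / 2) (by simp; linarith)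
          simpa using this
        calc _ ≤ 1 * Real.Gamma (s.re / 2) := by gcongr
          _ ≤ _ := by rw [one_mul]; exact Gamma_le_exp (by linarith) hre
      calc _ ≤ 4 * Real.exp e * Real.exp (8 * e) * Z := by
            gcongr
            · exact hquad s
            · exact norm_zeta_le_of_two_le h2
        _ = 4 * Z * Real.exp (9 * e) := by rw [mul_assoc 4, ← Real.exp_add]; ring_nf
        _ ≤ _ := by
            refine mul_le_mul_of_nonneg_right ?_ (Real.exp_pos _).le
            have := abs_nonneg C
            linarith
    · have hE : Real.exp e ≤ Real.exp (9 * e) := Real.exp_le_exp.2 (by linarith)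
      have hE1 : 1 ≤ Real.exp (9 * e) := Real.one_le_exp (by linarith)
      calc ‖xi s‖ ≤ ‖s * (s - 1) * completedRiemannZeta₀ s‖ + ‖(1 : ℂ)‖ := norm_add_le _ _
        _ ≤ 4 * Real.exp e * |C| + 1 := by
            rw [norm_mul, norm_one]
            gcongr
            · exact hquad s
            · exact (hC s hs h2).trans (le_abs_self C)
        _ ≤ 4 * Real.exp (9 * e) * |C| + Real.exp (9 * e) := by gcongr
        _ ≤ _ := by nlinarith [Real.exp_pos (9 * e)]
  set K := 4 * Z + 4 * |C| + 1
  have hK : 1 ≤ K := by have := abs_nonneg C; simp only [K]; linarith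
  have hlogK : 0 ≤ Real.log K := Real.log_nonneg hK
  have hright' : ∀ s : ℂ, 0 ≤ s.re →
      ‖xi s‖ ≤ Real.exp ((9 + Real.log K) * (1 + ‖s - 2‖) ^ (3 / 2 : ℝ)) := fun s hs => by
    refine (hright s hs).trans ?_
    nth_rewrite 1 [← Real.exp_log (show 0 < K by linarith)]
    rw [← Real.exp_add]
    refine Real.exp_le_exp.2 ?_
    have := le_mul_of_one_le_right hlogK (hr1 s)
    linarith
  refine ⟨8 * (9 + Real.log K), by positivity, fun s => ?_⟩
  have hbase : (0 : ℝ) ≤ (1 + ‖s - 2‖) ^ (3 / 2 : ℝ) := by positivity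
  rcases le_total 0 s.re with h | h
  · refine (hright' s h).trans (Real.exp_le_exp.2 ?_)
    nlinarith [mul_nonneg (show 0 ≤ 9 + Real.log K by positivity) hbase]
  · rw [← xi_one_sub]
    refine (hright' (1 - s) (by simp; linarith)).trans (Real.exp_le_exp.2 ?_)
    -- Reflection enlarges 1 + ‖s - 2‖ by a factor of at most 4, and 4^{3/2} = 8.
    have h4 : (1 + ‖1 - s - 2‖) ^ (3 / 2 : ℝ) ≤ 8 * (1 + ‖s - 2‖) ^ (3 / 2 : ℝ) := by
      have h8 : (8 : ℝ) = 4 ^ (3 / 2 : ℝ) := by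
        rw [show (4 : ℝ) = 2 ^ (2 : ℝ) by norm_num, ← Real.rpow_mul (by norm_num)]
        norm_num
      rw [h8, ← Real.mul_rpow (by norm_num) (by positivity)]
      refine Real.rpow_le_rpow (by positivity) ?_ (by norm_num)
      have : ‖1 - s - 2‖ ≤ ‖s - 2‖ + 3 := by
        calc ‖1 - s - 2‖ = ‖-(s - 2) + (-3)‖ := by ring_nf
          _ ≤ ‖-(s - 2)‖ + ‖(-3 : ℂ)‖ := norm_add_le _ _
          _ = _ := by rw [norm_neg, norm_neg, Complex.norm_ofNat]
      have := norm_nonneg (s - 2)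
      linarith
    nlinarith [mul_le_mul_of_nonneg_left h4 (show 0 ≤ 9 + Real.log K by positivity)]

end ZetaArgument

end

/-! ### Zeros of ξ, and ξ'/ξ as a sum over them. -/

noncomputable section

namespace ZetaArgument

open Complex Set Filter Topology MeasureTheory ComplexConjugate

lemma xi_ne_zero_of_one_le_re {s : ℂ} (hs : 1 ≤ s.re) : xi s ≠ 0 := by
  by_cases h1 : s = 1
  · rw [h1, xi_one]; exact one_ne_zero
  have h0 : s ≠ 0 := fun h => by rw [h] at hs; norm_num at hs
  have hG : Gammaℝ s ≠ 0 := Gammaℝ_ne_zero_of_re_pos (by linarith)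
  rw [xi_eq h0 h1 hG]
  exact mul_ne_zero (mul_ne_zero (mul_ne_zero h0 (sub_ne_zero.2 h1)) hG)
    (riemannZeta_ne_zero_of_one_le_re hs)

/-- ζ has no zeros with Re s ≥ 1, the functional equation excludes Re s ≤ 0, and inside the strip
the remaining factors of ξ do not vanish. -/
lemma xi_eq_zero_iff (s : ℂ) : xi s = 0 ↔ riemannZeta s = 0 ∧ 0 < s.re ∧ s.re < 1 := by
  constructor
  · intro h
    have hlt : s.re < 1 := by
      by_contra hge
      exact xi_ne_zero_of_one_le_re (not_lt.1 hge) h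
    have hpos : 0 < s.re := by
      by_contra hle
      rw [← xi_one_sub] at h
      exact xi_ne_zero_of_one_le_re (by simp; linarith) h
    have h0 : s ≠ 0 := fun h => by rw [h] at hpos; norm_num at hpos
    have h1 : s ≠ 1 := fun h => by rw [h] at hlt; norm_num at hlt
    have hG : Gammaℝ s ≠ 0 := Gammaℝ_ne_zero_of_re_pos hpos
    rw [xi_eq h0 h1 hG] at h
    exact ⟨(mul_eq_zero.1 h).resolve_left
      (mul_ne_zero (mul_ne_zero h0 (sub_ne_zero.2 h1)) hG), hpos, hlt⟩
  · rintro ⟨hz, hpos, hlt⟩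
    have h0 : s ≠ 0 := fun h => by rw [h] at hpos; norm_num at hpos
    have h1 : s ≠ 1 := fun h => by rw [h] at hlt; norm_num at hlt
    rw [xi_eq h0 h1 (Gammaℝ_ne_zero_of_re_pos hpos), hz, mul_zero]

lemma differentiableAt_Gammaℝ {s : ℂ} (hs : 0 < s.re) : DifferentiableAt ℂ Gammaℝ s := by
  have hG : DifferentiableAt ℂ Gamma (s / 2) := by
    refine differentiableAt_Gamma _ fun m h => ?_
    have := congrArg re h
    simp at this
    have hm : (0 : ℝ) ≤ m := by positivity
    linarith
  have h1 : DifferentiableAt ℂ (fun s => (Real.pi : ℂ) ^ (-s / 2) * Gamma (s / 2)) s := by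
    refine DifferentiableAt.mul ?_ (hG.comp s (by fun_prop))
    refine DifferentiableAt.const_cpow (by fun_prop) (Or.inl ?_)
    exact_mod_cast Real.pi_ne_zero
  exact h1

lemma analyticAt_Gammaℝ {s : ℂ} (hs : 0 < s.re) : AnalyticAt ℂ Gammaℝ s := by
  have hd : DifferentiableOn ℂ Gammaℝ {z | 0 < z.re} := fun z hz =>
    (differentiableAt_Gammaℝ hz).differentiableWithinAt
  exact hd.analyticAt ((isOpen_lt continuous_const continuous_re).mem_nhds hs)

lemma xi_eventuallyEq {s : ℂ} (hs : 0 < s.re) (h1 : s ≠ 1) :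
    xi =ᶠ[𝓝 s] fun z => z * (z - 1) * Gammaℝ z * riemannZeta z := by
  filter_upwards [(isOpen_lt continuous_const continuous_re).mem_nhds hs,
    isOpen_ne.mem_nhds h1] with z hz hz1
  have hz0 : 0 < z.re := hz
  exact xi_eq (fun h => by rw [h] at hz0; norm_num at hz0) hz1 (Gammaℝ_ne_zero_of_re_pos hz)

lemma analyticOrderAt_xi {s : ℂ} (hs : 0 < s.re) (h1 : s ≠ 1) :
    analyticOrderAt xi s = analyticOrderAt riemannZeta s := by
  rw [analyticOrderAt_congr (xi_eventuallyEq hs h1)]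
  have ha : AnalyticAt ℂ (fun z : ℂ => z * (z - 1) * Gammaℝ z) s :=
    (by fun_prop : AnalyticAt ℂ (fun z : ℂ => z * (z - 1)) s).mul (analyticAt_Gammaℝ hs)
  have hζ : AnalyticAt ℂ riemannZeta s := analyticOn_riemannZeta s h1
  have h0 : s ≠ 0 := fun h => by rw [h] at hs; norm_num at hs
  have := analyticOrderAt_mul ha hζ
  rw [show (fun z : ℂ => z * (z - 1) * Gammaℝ z * riemannZeta z) =
    (fun z : ℂ => z * (z - 1) * Gammaℝ z) * riemannZeta from rfl, this,
    ha.analyticOrderAt_eq_zero.2 (mul_ne_zero (mul_ne_zero h0 (sub_ne_zero.2 h1))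
      (Gammaℝ_ne_zero_of_re_pos hs)), zero_add]

/-- The non-trivial zeros as the zeros of `xi`. -/
def zeroEquiv : NontrivialZero ≃ {s : ℂ // xi s = 0} :=
  Equiv.subtypeEquivRight fun s => (xi_eq_zero_iff s).symm

lemma zeroEquiv_coe (ρ : NontrivialZero) : (zeroEquiv ρ : ℂ) = ρ.1 := rfl

lemma analyticOrderNatAt_xi (ρ : NontrivialZero) : analyticOrderNatAt xi ρ.1 = ρ.mult := by
  have h1 : ρ.1 ≠ 1 := fun h => by
    have := ρ.2.2.2
    rw [h] at this
    norm_num at this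
  rw [NontrivialZero.mult, analyticOrderNatAt, analyticOrderNatAt,
    analyticOrderAt_xi ρ.2.2.1 h1]

lemma xi_two_ne_zero : xi 2 ≠ 0 := xi_ne_zero_of_one_le_re (by norm_num)

lemma NontrivialZero.xi_eq_zero (ρ : NontrivialZero) : xi ρ.1 = 0 := (xi_eq_zero_iff _).2 ρ.2

/-- Moves the base point from 2 to an arbitrary point `s` that is not a zero. The distances to the
zeros are comparable. -/
lemma summable_mult_div_sq {s : ℂ} (hs : xi s ≠ 0) :
    Summable fun ρ : NontrivialZero => (ρ.mult : ℝ) / ‖s - ρ.1‖ ^ 2 := by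
  obtain ⟨B, hB, hg⟩ := exists_norm_xi_le
  have h := EntirePartialFractions.summable_order_div_sq differentiable_xi xi_two_ne_zero hB hg
  rw [← zeroEquiv.summable_iff] at h
  obtain ⟨d, hd, hdist⟩ : ∃ d > 0, ∀ a, xi a = 0 → d ≤ ‖s - a‖ := by
    have : ∀ᶠ w in 𝓝 s, xi w ≠ 0 := differentiable_xi.continuous.continuousAt.eventually_ne hs
    obtain ⟨d, hd, h⟩ := Metric.eventually_nhds_iff.1 this
    refine ⟨d, hd, fun a ha => ?_⟩
    by_contra hlt
    exact h (by rw [dist_comm, dist_eq_norm]; push Not at hlt; exact hlt) ha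
  refine Summable.of_nonneg_of_le (fun ρ => by positivity) (fun ρ => ?_)
    (h.mul_left ((1 + ‖s - 2‖ / d) ^ 2))
  simp only [Function.comp, zeroEquiv_coe, analyticOrderNatAt_xi]
  have hda := hdist _ ρ.xi_eq_zero
  have hpos : 0 < ‖s - ρ.1‖ := hd.trans_le hda
  have h2 : ‖ρ.1 - 2‖ ≤ (1 + ‖s - 2‖ / d) * ‖s - ρ.1‖ := by
    have h3 : ‖ρ.1 - 2‖ ≤ ‖s - ρ.1‖ + ‖s - 2‖ := by
      rw [norm_sub_rev s ρ.1]; exact norm_sub_le_norm_sub_add_norm_sub _ _ _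
    have h4 : ‖s - 2‖ ≤ ‖s - 2‖ / d * ‖s - ρ.1‖ := by
      rw [div_mul_eq_mul_div, le_div_iff₀ hd]
      exact mul_le_mul_of_nonneg_left hda (norm_nonneg _)
    linarith
  have hpos2 : 0 < ‖ρ.1 - 2‖ := norm_pos_iff.2 fun h => xi_two_ne_zero (by
    rw [← sub_eq_zero.1 h]; exact ρ.xi_eq_zero)
  have h5 : ‖ρ.1 - 2‖ ^ 2 ≤ (1 + ‖s - 2‖ / d) ^ 2 * ‖s - ρ.1‖ ^ 2 := by
    rw [← mul_pow]; gcongr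
  refine le_of_eq_of_le (div_eq_mul_one_div _ _)
    (le_of_le_of_eq ?_ (mul_div_left_comm _ _ _).symm)
  refine mul_le_mul_of_nonneg_left ?_ (by positivity)
  rw [div_le_div_iff₀ (by positivity) (by positivity)]
  linarith

/-- Two expansions based at 2 are subtracted, so no Hadamard constant has to be computed. -/
lemma hasSum_logDeriv_xi {s w : ℂ} (hs : xi s ≠ 0) (hw : xi w ≠ 0) :
    HasSum (fun ρ : NontrivialZero => (ρ.mult : ℂ) * (1 / (s - ρ.1) - 1 / (w - ρ.1)))
      (logDeriv xi s - logDeriv xi w) := by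
  obtain ⟨B, hB, hg⟩ := exists_norm_xi_le
  have h : ∀ z, xi z ≠ 0 →
      HasSum (fun ρ : NontrivialZero => (ρ.mult : ℂ) * (1 / (z - ρ.1) - 1 / (2 - ρ.1)))
        (logDeriv xi z - logDeriv xi 2) := fun z hz => by
    have h := EntirePartialFractions.hasSum_logDeriv differentiable_xi xi_two_ne_zero hB hg hz
    rw [← zeroEquiv.hasSum_iff] at h
    convert h using 2 with ρ
    simp only [Function.comp, zeroEquiv_coe, analyticOrderNatAt_xi]
  have := (h s hs).sub (h w hw)
  rw [sub_sub_sub_cancel_right] at this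
  have e : (fun ρ : NontrivialZero => (ρ.mult : ℂ) * (1 / (s - ρ.1) - 1 / (w - ρ.1))) = fun ρ =>
      (ρ.mult : ℂ) * (1 / (s - ρ.1) - 1 / (2 - ρ.1)) -
        (ρ.mult : ℂ) * (1 / (w - ρ.1) - 1 / (2 - ρ.1)) := by
    funext ρ
    ring
  rw [e]
  exact this

lemma logDeriv_xi_one_sub (s : ℂ) : logDeriv xi (1 - s) = -logDeriv xi s := by
  have h : (fun z => xi (1 - z)) = xi := funext xi_one_sub
  have h1 : deriv xi s = -deriv xi (1 - s) := by
    conv_lhs => rw [← h]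
    rw [deriv_comp_const_sub]
  rw [logDeriv_apply, logDeriv_apply, xi_one_sub, h1]
  ring

lemma Gammaℝ_conj (s : ℂ) : Gammaℝ (conj s) = conj (Gammaℝ s) := by
  have hpi : (Real.pi : ℂ).arg ≠ Real.pi := by
    rw [arg_ofReal_of_nonneg Real.pi_pos.le]
    exact Real.pi_pos.ne
  rw [Gammaℝ_def, Gammaℝ_def, map_mul, ← Gamma_conj]
  congr 1
  · have := cpow_conj (Real.pi : ℂ) (-s / 2) hpi
    rw [conj_ofReal] at this
    rw [← this]
    simp [map_ofNat]
  · simp [map_ofNat]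

lemma xi_conj {s : ℂ} (hs : 0 < s.re) : xi (conj s) = conj (xi s) := by
  by_cases h1 : s = 1
  · rw [h1]; simp [xi_one]
  have h0 : s ≠ 0 := fun h => by rw [h] at hs; norm_num at hs
  have hs' : 0 < (conj s).re := by simpa using hs
  rw [xi_eq h0 h1 (Gammaℝ_ne_zero_of_re_pos hs), xi_eq (by simpa using h0)
    (fun h => h1 (by simpa using congrArg conj h)) (Gammaℝ_ne_zero_of_re_pos hs'), Gammaℝ_conj,
    riemannZeta_conj]
  simp

lemma logDeriv_xi_conj {s : ℂ} (hs : 0 < s.re) : logDeriv xi (conj s) = conj (logDeriv xi s) := by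
  have h : (conj ∘ xi ∘ conj) =ᶠ[𝓝 s] xi := by
    filter_upwards [(isOpen_lt continuous_const continuous_re).mem_nhds hs] with z hz
    simp [xi_conj (s := z) hz]
  have h1 := h.deriv_eq
  rw [deriv_conj_conj] at h1
  rw [logDeriv_apply, logDeriv_apply, xi_conj hs, map_div₀, ← h1]
  simp

lemma logDeriv_xi_eq {s : ℂ} (hs : 0 < s.re) (h1 : s ≠ 1) (hζ : riemannZeta s ≠ 0) :
    logDeriv xi s = 1 / s + 1 / (s - 1) + logDeriv Gammaℝ s + logDeriv riemannZeta s := by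
  have h0 : s ≠ 0 := fun h => by rw [h] at hs; norm_num at hs
  have hG := Gammaℝ_ne_zero_of_re_pos hs
  have he := xi_eventuallyEq hs h1
  have : logDeriv xi s = logDeriv (fun z => z * (z - 1) * Gammaℝ z * riemannZeta z) s := by
    rw [logDeriv_apply, logDeriv_apply, he.deriv_eq, he.self_of_nhds]
  have hs1 : s - 1 ≠ 0 := sub_ne_zero.2 h1
  rw [this, logDeriv_mul (f := fun z => z * (z - 1) * Gammaℝ z) _ (mul_ne_zero (mul_ne_zero h0 hs1) hG) hζ
    ((by fun_prop : DifferentiableAt ℂ (fun z : ℂ => z * (z - 1)) s).mul (differentiableAt_Gammaℝ hs))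
    (differentiableAt_riemannZeta h1),
    logDeriv_mul (f := fun z => z * (z - 1)) _ (mul_ne_zero h0 hs1) hG (by fun_prop) (differentiableAt_Gammaℝ hs),
    logDeriv_mul (f := fun z => z) _ h0 hs1 (by fun_prop) (by fun_prop)]
  simp [logDeriv_apply]

lemma zeta_ne_zero_of_RH (hRH : RiemannHypothesis) {s : ℂ} (hs : 1 / 2 < s.re) :
    riemannZeta s ≠ 0 := by
  intro h
  by_cases h1 : s = 1
  · rw [h1] at h; exact riemannZeta_one_ne_zero h
  · have := hRH s h (fun ⟨n, hn⟩ => by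
      rw [hn] at hs
      simp at hs
      have hm : (0 : ℝ) ≤ n := by positivity
      linarith) h1
    linarith

lemma NontrivialZero.re_eq (hRH : RiemannHypothesis) (ρ : NontrivialZero) : ρ.1.re = 1 / 2 := by
  refine hRH ρ.1 ρ.2.1 (fun ⟨n, hn⟩ => ?_) fun h => ?_
  · have := ρ.2.2.1
    rw [hn] at this
    simp at this
    have hm : (0 : ℝ) ≤ n := by positivity
    linarith
  · have := ρ.2.2.2
    rw [h] at this
    norm_num at this

lemma NontrivialZero.eq (hRH : RiemannHypothesis) (ρ : NontrivialZero) :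
    ρ.1 = 1 / 2 + ρ.ordinate * I := by
  apply Complex.ext <;> simp [ρ.re_eq hRH, NontrivialZero.ordinate]

lemma xi_ne_zero_of_RH (hRH : RiemannHypothesis) {s : ℂ} (hs : s.re ≠ 1 / 2) : xi s ≠ 0 := fun h =>
  hs (NontrivialZero.re_eq hRH ⟨s, (xi_eq_zero_iff s).1 h⟩)

/-- The real part of the logarithmic derivative of `xi` as a sum over zeros. -/
lemma hasSum_re_logDeriv_xi (hRH : RiemannHypothesis) {u t : ℝ} (hu : 0 < u) :
    HasSum (fun ρ : NontrivialZero => (ρ.mult : ℝ) * (2 * u / (u ^ 2 + (ρ.ordinate - t) ^ 2)))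
      (2 * (logDeriv xi (1 / 2 + u + t * I)).re) := by
  set s : ℂ := 1 / 2 + u + t * I with hs
  have hsre : s.re = 1 / 2 + u := by simp [hs]
  have h1 : xi s ≠ 0 := xi_ne_zero_of_RH hRH (by rw [hsre]; linarith)
  have h2 : xi (1 - conj s) ≠ 0 := by
    rw [xi_one_sub, xi_conj (by rw [hsre]; linarith)]
    simpa using h1
  -- The second point, 1 - conj s, is the reflection of `s` in the critical line. There ξ'/ξ equals
  -- -conj of its value at `s`, so the difference is twice a real part. Under RH each zero
  -- contributes 1/(u-iv) + 1/(u+iv).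
  have h := hasSum_logDeriv_xi h1 h2
  rw [logDeriv_xi_one_sub, logDeriv_xi_conj (by rw [hsre]; linarith), sub_neg_eq_add, add_conj] at h
  rw [← Complex.hasSum_ofReal]
  convert h using 2 with ρ
  rw [ρ.eq hRH]
  have hc : conj s = 1 / 2 + u - t * I := by
    apply Complex.ext <;> simp [hs]
  set v := ρ.ordinate - t with hv
  have e1 : s - (1 / 2 + ρ.ordinate * I) = u - v * I := by rw [hs, hv]; push_cast; ring
  have e2 : 1 - conj s - (1 / 2 + ρ.ordinate * I) = -(u + v * I) := by
    rw [hc, hv]; push_cast; ring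
  rw [e1, e2]
  have n1 : (u : ℂ) - v * I ≠ 0 := fun h => hu.ne' (by simpa using congrArg re h)
  have n2 : (u : ℂ) + v * I ≠ 0 := fun h => hu.ne' (by simpa using congrArg re h)
  have n3 : (u : ℂ) ^ 2 + v ^ 2 = (u - v * I) * (u + v * I) := by
    ring_nf; rw [I_sq]; ring
  push_cast
  rw [n3]
  congr 1
  field_simp
  ring

end ZetaArgument

end

/-! ### The digamma series and a Stirling estimate. -/

noncomputable section

namespace ZetaArgument

open Complex Set Filter Topology MeasureTheory ComplexConjugate

/-- The bound depends only on ε and R. This uniformity makes the series in `hasSum_digamma`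
holomorphic. -/
lemma norm_digamma_term_le {z : ℂ} {ε R : ℝ} (hε : 0 < ε) (hz : ε ≤ z.re) (hR : ‖z‖ ≤ R) (k : ℕ) :
    ‖1 / ((k : ℂ) + 1) - 1 / (z + k)‖ ≤ (R + 1) / min ε 1 * (1 / ((k : ℝ) + 1) ^ 2) := by
  have hk : (0 : ℝ) ≤ k := by positivity
  have hre : min ε 1 * ((k : ℝ) + 1) ≤ ‖z + k‖ := by
    refine le_trans ?_ (re_le_norm _)
    have h1 := min_le_left ε 1
    have h2 := min_le_right ε 1
    simp
    nlinarith
  have hm : 0 < min ε 1 := lt_min hε one_pos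
  have hzk : z + k ≠ 0 := norm_pos_iff.1 (lt_of_lt_of_le (by positivity) hre)
  have hk1 : (k : ℂ) + 1 ≠ 0 := by exact_mod_cast Nat.succ_ne_zero k
  have e : 1 / ((k : ℂ) + 1) - 1 / (z + k) = (z - 1) / (((k : ℂ) + 1) * (z + k)) := by
    field_simp
    ring
  have hn : ‖(k : ℂ) + 1‖ = (k : ℝ) + 1 := by
    have : ((k : ℂ) + 1) = (((k : ℝ) + 1 : ℝ) : ℂ) := by push_cast; rfl
    rw [this, norm_real, Real.norm_of_nonneg (by positivity)]
  rw [e, norm_div, norm_mul, hn]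
  calc ‖z - 1‖ / (((k : ℝ) + 1) * ‖z + k‖)
      ≤ (R + 1) / (((k : ℝ) + 1) * (min ε 1 * ((k : ℝ) + 1))) := by
        gcongr
        · exact (norm_nonneg z).trans hR |>.trans (by linarith)
        · exact (norm_sub_le _ _).trans (by rw [norm_one]; linarith)
    _ = _ := by field_simp

lemma summable_one_div_add_one_sq : Summable fun k : ℕ => 1 / ((k : ℝ) + 1) ^ 2 := by
  have := (summable_nat_add_iff 1).2 (Real.summable_one_div_nat_pow.2 (by norm_num : 1 < 2))
  simpa using this

lemma summable_digamma_terms {z : ℂ} (hz : 0 < z.re) :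
    Summable fun k : ℕ => (1 / ((k : ℂ) + 1) - 1 / (z + k)) :=
  Summable.of_norm_bounded (summable_one_div_add_one_sq.mul_left _)
    fun k => norm_digamma_term_le hz le_rfl le_rfl k

lemma hasDerivAt_log_Gamma {x : ℝ} (hx : 0 < x) :
    HasDerivAt (fun y => Real.log (Real.Gamma y)) ((digamma x).re) x := by
  have hd : HasDerivAt Gamma (deriv Gamma (x : ℂ)) (x : ℂ) := by
    refine (differentiableAt_Gamma _ fun m h => ?_).hasDerivAt
    have : x = -(m : ℝ) := by exact_mod_cast h
    have hm : (0 : ℝ) ≤ m := by positivity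
    linarith
  have h1 := hd.real_of_complex
  have h2 : HasDerivAt Real.Gamma (deriv Gamma (x : ℂ)).re x := by
    refine h1.congr_of_eventuallyEq (Eventually.of_forall fun y => ?_)
    simp [Gamma_ofReal]
  have hpos := Real.Gamma_pos_of_pos hx
  have h3 := h2.log hpos.ne'
  convert h3 using 1
  rw [digamma_def, logDeriv_apply, Gamma_ofReal, div_ofReal_re]

lemma digamma_ofReal_add_nat {x : ℝ} (hx : 0 < x) (N : ℕ) :
    (digamma ((x + N : ℝ) : ℂ)).re = (digamma x).re + ∑ k ∈ Finset.range N, 1 / (x + k) := by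
  induction N with
  | zero => simp
  | succ N ih =>
    have hx' : (0 : ℝ) < x + N := by positivity
    have h := digamma_apply_add_one ((x + N : ℝ) : ℂ) (fun m h => by
      have : x + N = -(m : ℝ) := by exact_mod_cast h
      have hm : (0 : ℝ) ≤ m := by positivity
      linarith)
    rw [Finset.sum_range_succ, ← add_assoc, ← ih]
    have e : ((x + (N + 1 : ℕ) : ℝ) : ℂ) = ((x + N : ℝ) : ℂ) + 1 := by push_cast; ring
    rw [e, h, add_re, ← ofReal_inv, ofReal_re, one_div]

/-- The slope of log Γ over [x, x+1] is log x. By log-convexity it lies between ψ(x) and ψ(x+1) =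
ψ(x) + 1/x. -/
lemma digamma_ofReal_bounds {x : ℝ} (hx : 0 < x) :
    (digamma x).re ≤ Real.log x ∧ Real.log x ≤ (digamma x).re + 1 / x := by
  have hc := Real.convexOn_log_Gamma
  have hslope : slope (fun y => Real.log (Real.Gamma y)) x (x + 1) = Real.log x := by
    rw [slope_def_field, Real.Gamma_add_one hx.ne', Real.log_mul hx.ne' (Real.Gamma_pos_of_pos hx).ne']
    ring
  have hx1 : (0 : ℝ) < x + 1 := by linarith
  constructor
  · rw [← hslope]
    exact hc.le_slope_of_hasDerivAt (mem_Ioi.2 hx) (mem_Ioi.2 hx1) (by linarith) (hasDerivAt_log_Gamma hx)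
  · have h := digamma_ofReal_add_nat hx 1
    simp at h
    rw [← hslope, one_div, ← h]
    have := hc.slope_le_of_hasDerivAt (mem_Ioi.2 hx) (mem_Ioi.2 hx1) (by linarith) (hasDerivAt_log_Gamma hx1)
    simpa [Function.comp_def] using this

lemma tendsto_digamma_ofReal {x : ℝ} (hx : 0 < x) :
    Tendsto (fun N : ℕ => ∑ k ∈ Finset.range N, (1 / ((k : ℝ) + 1) - 1 / (x + k))) atTop
      (𝓝 ((digamma x).re + Real.eulerMascheroniConstant)) := by
  have h1 : Tendsto (fun N : ℕ => Real.log (x + N) - ∑ k ∈ Finset.range N, 1 / (x + k)) atTop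
      (𝓝 (digamma x).re) := by
    have h0 : Tendsto (fun N : ℕ => 1 / (x + N)) atTop (𝓝 0) := by
      simp only [one_div]
      exact (tendsto_atTop_add_const_left _ x tendsto_natCast_atTop_atTop).inv_tendsto_atTop
    have h2 : Tendsto (fun N : ℕ => (digamma x).re + 1 / (x + N)) atTop (𝓝 (digamma x).re) := by
      simpa using h0.const_add (digamma x).re
    refine tendsto_of_tendsto_of_tendsto_of_le_of_le tendsto_const_nhds h2 (fun N => ?_) fun N => ?_
    all_goals
      have hb := digamma_ofReal_bounds (x := x + N) (by positivity)
      rw [digamma_ofReal_add_nat hx] at hb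
      simp only
      linarith [hb.1, hb.2]
  have h3 : Tendsto (fun N : ℕ => Real.log (N : ℝ) - Real.log (x + N)) atTop (𝓝 0) := by
    have h4 : Tendsto (fun N : ℕ => Real.log (1 + x / N)) atTop (𝓝 0) := by
      have h5 : Tendsto (fun N : ℕ => 1 + x / (N : ℝ)) atTop (𝓝 1) := by
        simpa using (tendsto_const_div_atTop_nhds_zero_nat x).const_add 1
      simpa [Function.comp_def] using (Real.continuousAt_log one_ne_zero).tendsto.comp h5
    have h6 := h4.neg
    rw [neg_zero] at h6
    refine h6.congr' ?_
    filter_upwards [eventually_gt_atTop 0] with N hN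
    have hN' : (0 : ℝ) < N := by exact_mod_cast hN
    rw [show x + N = (1 + x / N) * N by field_simp; ring, Real.log_mul (by positivity) hN'.ne']
    ring
  have h7 := (Real.tendsto_harmonic_sub_log.add h3).add h1
  rw [add_zero, add_comm] at h7
  refine h7.congr fun N => ?_
  rw [Finset.sum_sub_distrib]
  simp only [harmonic, one_div]
  push_cast
  ring

lemma digamma_ofReal_im {x : ℝ} (hx : 0 < x) : (digamma x).im = 0 := by
  have hd : HasDerivAt Gamma (deriv Gamma (x : ℂ)) (x : ℂ) := by
    refine (differentiableAt_Gamma _ fun m h => ?_).hasDerivAt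
    have : x = -(m : ℝ) := by exact_mod_cast h
    have hm : (0 : ℝ) ≤ m := by positivity
    linarith
  have h1 : HasDerivAt (fun y : ℝ => (Real.Gamma y : ℂ)) (deriv Gamma (x : ℂ)) x := by
    have := hd.comp_ofReal
    simpa [Gamma_ofReal] using this
  have h2 : HasDerivAt (fun y : ℝ => ((Real.Gamma y : ℂ)).im) (deriv Gamma (x : ℂ)).im x :=
    imCLM.hasFDerivAt.comp_hasDerivAt x h1
  simp only [ofReal_im] at h2
  have h3 := h2.unique (hasDerivAt_const x 0)
  rw [digamma_def, logDeriv_apply, Gamma_ofReal, div_ofReal_im, h3, zero_div]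

/-- Both sides are holomorphic on the right half-plane and agree on the positive reals by
`tendsto_digamma_ofReal`. The identity theorem does the rest. -/
lemma hasSum_digamma {z : ℂ} (hz : 0 < z.re) :
    HasSum (fun k : ℕ => (1 / ((k : ℂ) + 1) - 1 / (z + k)))
      (digamma z + Real.eulerMascheroniConstant) := by
  have hopen : IsOpen {z : ℂ | 0 < z.re} := isOpen_lt continuous_const continuous_re
  set F : ℂ → ℂ := fun z => ∑' k : ℕ, (1 / ((k : ℂ) + 1) - 1 / (z + k)) with hF
  have hFd : DifferentiableOn ℂ F {z : ℂ | 0 < z.re} := fun w hw => by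
    have hw0 : 0 < w.re := hw
    set V : Set ℂ := {z : ℂ | w.re / 2 < z.re} ∩ Metric.ball 0 (‖w‖ + 1)
    have hV : IsOpen V := (isOpen_lt continuous_const continuous_re).inter Metric.isOpen_ball
    have hwV : w ∈ V := ⟨by simp; linarith, by simp⟩
    have h := differentiableOn_tsum_of_summable_norm
      (F := fun (k : ℕ) (z : ℂ) => (1 / ((k : ℂ) + 1) - 1 / (z + k))) (U := V)
      (summable_one_div_add_one_sq.mul_left _) (fun k => ?_) hV
      (fun k z hz => norm_digamma_term_le (half_pos hw0) (le_of_lt hz.1)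
        (le_of_lt (mem_ball_zero_iff.1 hz.2)) k)
    · exact ((h w hwV).differentiableAt (hV.mem_nhds hwV)).differentiableWithinAt
    · intro z hz
      have hz1 : w.re / 2 < z.re := hz.1
      have hne : z + k ≠ 0 := fun h => by
        have := congrArg re h
        simp at this
        have hk : (0 : ℝ) ≤ k := by positivity
        linarith
      have hd : DifferentiableAt ℂ (fun z : ℂ => z + k) z := by fun_prop
      exact ((differentiableAt_const _).sub
        ((differentiableAt_const _).div hd hne)).differentiableWithinAt
  have hGd : DifferentiableOn ℂ (fun z => digamma z + Real.eulerMascheroniConstant)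
      {z : ℂ | 0 < z.re} := fun w hw => by
    have hw0 : 0 < w.re := hw
    have hGo : DifferentiableOn ℂ Gamma {z : ℂ | 0 < z.re} := fun z hz => by
      refine (differentiableAt_Gamma _ fun m h => ?_).differentiableWithinAt
      have hz0 : 0 < z.re := hz
      have := congrArg re h
      simp at this
      have hk : (0 : ℝ) ≤ m := by positivity
      linarith
    have hA := hGo.analyticAt (hopen.mem_nhds hw)
    exact ((hA.deriv.differentiableAt.div hA.differentiableAt
      (Gamma_ne_zero_of_re_pos hw0)).add_const _).differentiableWithinAt
  have hreal : ∀ x : ℝ, 0 < x → F x = digamma x + Real.eulerMascheroniConstant := fun x hx => by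
    have h1 := (summable_digamma_terms (z := x) (by simpa using hx)).hasSum.tendsto_sum_nat
    have h2 := (continuous_ofReal.tendsto _).comp (tendsto_digamma_ofReal hx)
    have e : digamma x + Real.eulerMascheroniConstant =
        (((digamma x).re + Real.eulerMascheroniConstant : ℝ) : ℂ) := by
      apply Complex.ext <;> simp [digamma_ofReal_im hx]
    rw [e]
    refine tendsto_nhds_unique h1 (h2.congr fun N => ?_)
    simp
  have heq : EqOn F (fun z => digamma z + Real.eulerMascheroniConstant) {z : ℂ | 0 < z.re} := by
    refine (hFd.analyticOnNhd hopen).eqOn_of_preconnected_of_frequently_eq (z₀ := 1)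
      (hGd.analyticOnNhd hopen) (convex_halfSpace_re_gt 0).isPreconnected (by simp) ?_
    have ht : Tendsto (fun n : ℕ => ((1 + 1 / ((n : ℝ) + 1) : ℝ) : ℂ)) atTop (𝓝[≠] 1) := by
      refine tendsto_nhdsWithin_iff.2 ⟨?_, Eventually.of_forall fun n => ?_⟩
      · have h3 := tendsto_one_div_add_atTop_nhds_zero_nat (𝕜 := ℝ)
        have h4 := (continuous_ofReal.tendsto _).comp (h3.const_add 1)
        simpa [Function.comp_def] using h4
      · intro h
        have h5 : (1 + 1 / ((n : ℝ) + 1) : ℝ) = 1 := ofReal_injective (by simpa using h)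
        have h6 : 0 < 1 / ((n : ℝ) + 1) := by positivity
        linarith
    refine ht.frequently (Eventually.frequently (Eventually.of_forall fun n => ?_))
    exact hreal _ (by positivity)
  have := (summable_digamma_terms hz).hasSum
  rwa [show (∑' k : ℕ, (1 / ((k : ℂ) + 1) - 1 / (z + k))) = _ from heq hz] at this

lemma logDeriv_Gammaℝ {s : ℂ} (hs : 0 < s.re) :
    logDeriv Gammaℝ s = -(Real.log Real.pi) / 2 + digamma (s / 2) / 2 := by
  have hpi : (Real.pi : ℂ) ≠ 0 := by exact_mod_cast Real.pi_ne_zero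
  have h2 : 0 < (s / 2).re := by simp; linarith
  have hG : DifferentiableAt ℂ Gamma (s / 2) := by
    refine differentiableAt_Gamma _ fun m h => ?_
    rw [h] at h2
    simp at h2
    have hm : (0 : ℝ) ≤ m := by positivity
    linarith
  have h1 : HasDerivAt Gammaℝ ((Real.pi : ℂ) ^ (-s / 2) * Complex.log Real.pi * (-1 / 2) * Gamma (s / 2) +
      (Real.pi : ℂ) ^ (-s / 2) * (deriv Gamma (s / 2) * (1 / 2))) s := by
    have ha : HasDerivAt (fun z : ℂ => (Real.pi : ℂ) ^ (-z / 2))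
        ((Real.pi : ℂ) ^ (-s / 2) * Complex.log Real.pi * (-1 / 2)) s :=
      HasDerivAt.const_cpow (((hasDerivAt_id s).neg).div_const 2) (Or.inl hpi)
    have hb : HasDerivAt (fun z : ℂ => Gamma (z / 2)) (deriv Gamma (s / 2) * (1 / 2)) s :=
      hG.hasDerivAt.comp s ((hasDerivAt_id s).div_const 2)
    exact ha.mul hb
  rw [logDeriv_apply, h1.deriv, Gammaℝ_def, digamma_def, logDeriv_apply, ofReal_log Real.pi_pos.le]
  have hp : (Real.pi : ℂ) ^ (-s / 2) ≠ 0 := by simp [cpow_eq_zero_iff, hpi]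
  have hΓ := Gamma_ne_zero_of_re_pos h2
  field_simp

lemma hasSum_logDeriv_Gammaℝ {s : ℂ} (hs : 0 < s.re) :
    HasSum (fun k : ℕ => (1 / (2 * (k : ℂ) + 2) - 1 / (2 * k + s)))
      (logDeriv Gammaℝ s + (Real.log Real.pi + Real.eulerMascheroniConstant) / 2) := by
  have h := (hasSum_digamma (z := s / 2) (by simp; linarith)).div_const 2
  have e1 : logDeriv Gammaℝ s + (Real.log Real.pi + Real.eulerMascheroniConstant) / 2 =
      (digamma (s / 2) + Real.eulerMascheroniConstant) / 2 := by
    rw [logDeriv_Gammaℝ hs]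
    ring
  have e2 : (fun k : ℕ => (1 / (2 * (k : ℂ) + 2) - 1 / (2 * k + s))) =
      fun k : ℕ => (1 / ((k : ℂ) + 1) - 1 / (s / 2 + k)) / 2 := by
    funext k
    have hk : (0 : ℝ) ≤ k := by positivity
    have h1 : (2 * k + s : ℂ) ≠ 0 := fun h => by
      have := congrArg re h
      simp at this
      linarith
    have h2 : (k : ℂ) + 1 ≠ 0 := by exact_mod_cast Nat.succ_ne_zero k
    rw [show s / 2 + (k : ℂ) = (2 * k + s) / 2 by ring, show 2 * (k : ℂ) + 2 = 2 * (k + 1) by ring]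
    field_simp
  rw [e1, e2]
  exact h

/-- Telescoping: each term is at most the decrement of 3/(2k + t). -/
lemma sum_one_div_sq_add_sq_le {t : ℝ} (ht : 1 ≤ t) (N : ℕ) :
    ∑ k ∈ Finset.range N, 1 / ((2 * (k : ℝ)) ^ 2 + t ^ 2) ≤ 3 / t := by
  suffices h : ∑ k ∈ Finset.range N, 1 / ((2 * (k : ℝ)) ^ 2 + t ^ 2) ≤ 3 / t - 3 / (2 * N + t) by
    have : 0 ≤ 3 / (2 * (N : ℝ) + t) := by positivity
    linarith
  induction N with
  | zero => simp
  | succ N ih =>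
    rw [Finset.sum_range_succ]
    have hN : (0 : ℝ) ≤ N := by positivity
    have h1 : 1 / ((2 * (N : ℝ)) ^ 2 + t ^ 2) ≤ 3 / (2 * N + t) - 3 / (2 * (N + 1 : ℕ) + t) := by
      push_cast
      rw [div_sub_div _ _ (by positivity) (by positivity), div_le_div_iff₀ (by positivity) (by positivity)]
      nlinarith [sq_nonneg (2 * (N : ℝ) - t), mul_nonneg hN (sub_nonneg.2 ht),
        mul_nonneg (show 0 ≤ t by linarith) (sub_nonneg.2 ht)]
    linarith

/-- The primitive of a/(a²+t²) is half of log(a²+t²). By the mean value theorem its increment over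
[2k, 2k+2] is twice a sample value, which is compared with the sample at 2k + 1/2. -/
lemma abs_log_sub_sum_le {t : ℝ} (ht : 1 ≤ t) (N : ℕ) :
    |(Real.log ((2 * (N : ℝ)) ^ 2 + t ^ 2) / 2 - Real.log t) -
      ∑ k ∈ Finset.range N, 2 * (2 * (k : ℝ) + 1 / 2) / ((2 * (k : ℝ) + 1 / 2) ^ 2 + t ^ 2)| ≤
      4 * ∑ k ∈ Finset.range N, 1 / ((2 * (k : ℝ)) ^ 2 + t ^ 2) := by
  have ht0 : 0 < t := by linarith
  induction N with
  | zero => simp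
  | succ N ih =>
    rw [Finset.sum_range_succ, Finset.sum_range_succ]
    have hN : (0 : ℝ) ≤ N := by positivity
    have hder : ∀ a : ℝ, HasDerivAt (fun a => Real.log (a ^ 2 + t ^ 2) / 2) (a / (a ^ 2 + t ^ 2)) a := fun a => by
      have h1 : HasDerivAt (fun a : ℝ => a ^ 2 + t ^ 2) (2 * a) a := by
        simpa using ((hasDerivAt_id a).pow 2).add_const (t ^ 2)
      refine ((h1.log (by positivity)).div_const 2).congr_deriv ?_
      field_simp
    obtain ⟨ξ, ⟨hξ1, hξ2⟩, hξ⟩ := exists_hasDerivAt_eq_slope (fun a => Real.log (a ^ 2 + t ^ 2) / 2)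
      (fun a => a / (a ^ 2 + t ^ 2)) (a := 2 * N) (b := 2 * N + 2) (by linarith)
      (fun a _ => (hder a).continuousAt.continuousWithinAt) (fun a _ => hder a)
    set a : ℝ := 2 * N + 1 / 2 with ha
    have hslope : Real.log ((2 * ((N + 1 : ℕ) : ℝ)) ^ 2 + t ^ 2) / 2 -
        Real.log ((2 * (N : ℝ)) ^ 2 + t ^ 2) / 2 = 2 * (ξ / (ξ ^ 2 + t ^ 2)) := by
      rw [hξ]
      push_cast
      rw [show 2 * (N : ℝ) + 2 = 2 * (N + 1) by ring]
      ring
    have hP : 0 < ξ ^ 2 + t ^ 2 := by positivity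
    have hQ : 0 < a ^ 2 + t ^ 2 := by positivity
    have hdiff : |2 * (ξ / (ξ ^ 2 + t ^ 2)) - 2 * a / (a ^ 2 + t ^ 2)| ≤ 4 * (1 / ((2 * (N : ℝ)) ^ 2 + t ^ 2)) := by
      have e : 2 * (ξ / (ξ ^ 2 + t ^ 2)) - 2 * a / (a ^ 2 + t ^ 2) =
          2 * ((ξ - a) * (t ^ 2 - ξ * a)) / ((ξ ^ 2 + t ^ 2) * (a ^ 2 + t ^ 2)) := by
        field_simp
        ring
      have h1 : |ξ - a| ≤ 2 := by rw [abs_le]; constructor <;> linarith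
      have h2 : |t ^ 2 - ξ * a| ≤ ((ξ ^ 2 + t ^ 2) + (a ^ 2 + t ^ 2)) / 2 := by
        rw [abs_le]; constructor <;> nlinarith [sq_nonneg (ξ - a), sq_nonneg (ξ + a)]
      have h3 : 1 / (ξ ^ 2 + t ^ 2) ≤ 1 / ((2 * (N : ℝ)) ^ 2 + t ^ 2) := by gcongr
      have h4 : 1 / (a ^ 2 + t ^ 2) ≤ 1 / ((2 * (N : ℝ)) ^ 2 + t ^ 2) := by
        gcongr
        linarith
      rw [e, abs_div, abs_mul, abs_mul, abs_two, abs_of_pos (mul_pos hP hQ)]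
      calc 2 * (|ξ - a| * |t ^ 2 - ξ * a|) / ((ξ ^ 2 + t ^ 2) * (a ^ 2 + t ^ 2))
          ≤ 2 * (2 * (((ξ ^ 2 + t ^ 2) + (a ^ 2 + t ^ 2)) / 2)) / ((ξ ^ 2 + t ^ 2) * (a ^ 2 + t ^ 2)) := by
            gcongr
        _ = 2 * (1 / (ξ ^ 2 + t ^ 2) + 1 / (a ^ 2 + t ^ 2)) := by field_simp; ring
        _ ≤ _ := by linarith
    rw [abs_le] at ih hdiff ⊢
    constructor <;> linarith [ih.1, ih.2, hdiff.1, hdiff.2]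

/-- Compares the term with its value at u = 0, where it is real. -/
lemma norm_trivial_term_sub_le {u t a : ℝ} (hu : 0 ≤ u) (ht : 1 ≤ t) (ha : 0 < a) :
    ‖(1 / ((a : ℂ) + (u - t * I)) + 1 / ((a : ℂ) - (u - t * I))) - ((2 * a / (a ^ 2 + t ^ 2) : ℝ) : ℂ)‖ ≤
      2 * u * (u + 2 * t) / t * (1 / (a ^ 2 + t ^ 2)) := by
  have ht0 : 0 < t := by linarith
  have n1 : (a : ℂ) + (u - t * I) ≠ 0 := fun h => by
    have := congrArg im h
    simp at this
    linarith
  have n2 : (a : ℂ) - (u - t * I) ≠ 0 := fun h => by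
    have := congrArg im h
    simp at this
    linarith
  have n3 : (a : ℂ) ^ 2 + t ^ 2 ≠ 0 := by
    have : (0 : ℝ) < a ^ 2 + t ^ 2 := by positivity
    exact_mod_cast this.ne'
  have e : (1 / ((a : ℂ) + (u - t * I)) + 1 / ((a : ℂ) - (u - t * I))) - ((2 * a / (a ^ 2 + t ^ 2) : ℝ) : ℂ) =
      2 * a * (u * (u - 2 * t * I)) / (((a : ℂ) + (u - t * I)) * ((a : ℂ) - (u - t * I)) * (a ^ 2 + t ^ 2)) := by
    push_cast
    field_simp
    ring_nf
    rw [I_sq]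
    ring
  have hb1 : a ≤ ‖(a : ℂ) + (u - t * I)‖ := by
    refine le_trans ?_ (re_le_norm _)
    simp; linarith
  have hb2 : t ≤ ‖(a : ℂ) - (u - t * I)‖ := by
    refine le_trans ?_ ((le_abs_self _).trans (abs_im_le_norm _))
    simp
  have hb3 : ‖(u : ℂ) - 2 * t * I‖ ≤ u + 2 * t := by
    refine (norm_sub_le _ _).trans ?_
    simp [abs_of_nonneg hu, abs_of_pos ht0]
  have hb4 : ‖(a : ℂ) ^ 2 + t ^ 2‖ = a ^ 2 + t ^ 2 := by
    have : (a : ℂ) ^ 2 + t ^ 2 = ((a ^ 2 + t ^ 2 : ℝ) : ℂ) := by push_cast; rfl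
    rw [this, norm_real, Real.norm_of_nonneg (by positivity)]
  rw [e, norm_div, norm_mul, norm_mul, norm_mul, norm_mul, norm_mul, hb4, norm_real, norm_real,
    Complex.norm_ofNat, Real.norm_of_nonneg ha.le, Real.norm_of_nonneg hu]
  calc 2 * a * (u * ‖(u : ℂ) - 2 * t * I‖) / (‖(a : ℂ) + (u - t * I)‖ * ‖(a : ℂ) - (u - t * I)‖ * (a ^ 2 + t ^ 2))
      ≤ 2 * a * (u * (u + 2 * t)) / (a * t * (a ^ 2 + t ^ 2)) := by gcongr
    _ = _ := by field_simp

/-- Stirling-type asymptotics for the logarithmic derivative of the factor in the functional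
equation. -/
lemma norm_sub_log_le {u t : ℝ} (hu : 0 ≤ u) (ht : 1 ≤ t) {r : ℂ}
    (hr : HasSum (fun k : ℕ => 1 / ((k : ℂ) + 1) -
      (1 / (((2 * k + 1 / 2 : ℝ) : ℂ) + (u - t * I)) + 1 / (((2 * k + 1 / 2 : ℝ) : ℂ) - (u - t * I))))
      (r + Real.log Real.pi + Real.eulerMascheroniConstant)) :
    ‖r - Real.log (t / (2 * Real.pi))‖ ≤ 18 * (1 + u) ^ 2 / t := by
  have ht0 : 0 < t := by linarith
  set w : ℕ → ℂ := fun k => 1 / (((2 * k + 1 / 2 : ℝ) : ℂ) + (u - t * I)) +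
    1 / (((2 * k + 1 / 2 : ℝ) : ℂ) - (u - t * I)) with hw
  set b : ℕ → ℝ := fun k => 2 * (2 * (k : ℝ) + 1 / 2) / ((2 * (k : ℝ) + 1 / 2) ^ 2 + t ^ 2) with hb
  have h1 := hr.tendsto_sum_nat
  have h2 := (continuous_ofReal.tendsto _).comp Real.tendsto_harmonic_sub_log
  -- The partial sums of 1/(k+1) minus log N tend to Euler's constant, which therefore drops out.
  have h3 : Tendsto (fun N : ℕ => ((Real.log N + Real.log 2 - Real.log t : ℝ) : ℂ) -
      ∑ k ∈ Finset.range N, w k) atTop (𝓝 (r - Real.log (t / (2 * Real.pi)))) := by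
    have h4 := (h1.sub h2).add_const ((Real.log 2 - Real.log t : ℝ) : ℂ)
    convert h4 using 2 with N
    · rw [Finset.sum_sub_distrib]
      simp only [harmonic, Function.comp, hw]
      push_cast
      simp only [one_div]
      ring
    · rw [Real.log_div ht0.ne' (by positivity), Real.log_mul (by norm_num) Real.pi_ne_zero]
      push_cast
      ring
  have hlim : Tendsto (fun N : ℕ => Real.log (1 + (t / (2 * N)) ^ 2) / 2 + 18 * (1 + u) ^ 2 / t) atTop
      (𝓝 (18 * (1 + u) ^ 2 / t)) := by
    have h5 : Tendsto (fun N : ℕ => 1 + (t / 2 / (N : ℝ)) ^ 2) atTop (𝓝 1) := by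
      simpa using ((tendsto_const_div_atTop_nhds_zero_nat (t / 2)).pow 2).const_add 1
    have h6 := ((Real.continuousAt_log one_ne_zero).tendsto.comp h5).div_const 2
    have h7 := h6.add_const (18 * (1 + u) ^ 2 / t)
    simpa [Function.comp_def, div_div] using h7
  refine le_of_tendsto_of_tendsto h3.norm hlim ?_
  filter_upwards [eventually_gt_atTop 0] with N hN
  have hN' : (0 : ℝ) < N := by exact_mod_cast hN
  have hA := abs_log_sub_sum_le ht N
  have hB := sum_one_div_sq_add_sq_le ht N
  have hC : ‖∑ k ∈ Finset.range N, w k - ∑ k ∈ Finset.range N, (b k : ℂ)‖ ≤ 6 * (1 + u) ^ 2 / t := by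
    rw [← Finset.sum_sub_distrib]
    refine (norm_sum_le _ _).trans ?_
    calc ∑ k ∈ Finset.range N, ‖w k - (b k : ℂ)‖
        ≤ ∑ k ∈ Finset.range N, 2 * u * (u + 2 * t) / t * (1 / ((2 * (k : ℝ)) ^ 2 + t ^ 2)) := by
          refine Finset.sum_le_sum fun k _ => ?_
          refine (norm_trivial_term_sub_le hu ht (by positivity)).trans ?_
          gcongr
          linarith
      _ ≤ 2 * u * (u + 2 * t) / t * (3 / t) := by
          rw [← Finset.mul_sum]
          gcongr
      _ ≤ _ := by
          rw [div_mul_div_comm, div_le_div_iff₀ (by positivity) ht0]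
          have h8 : u * (u + 2 * t) ≤ (1 + u) ^ 2 * t := by nlinarith [mul_nonneg hu hu, mul_nonneg hu (sub_nonneg.2 ht)]
          nlinarith
  have hD : Real.log ((2 * (N : ℝ)) ^ 2 + t ^ 2) / 2 - Real.log t =
      Real.log N + Real.log 2 - Real.log t + Real.log (1 + (t / (2 * N)) ^ 2) / 2 := by
    have : (2 * (N : ℝ)) ^ 2 + t ^ 2 = (2 * N) ^ 2 * (1 + (t / (2 * N)) ^ 2) := by field_simp
    rw [this, Real.log_mul (by positivity) (by positivity), Real.log_pow,
      Real.log_mul (by norm_num) hN'.ne']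
    push_cast
    ring
  have hE : |Real.log N + Real.log 2 - Real.log t - ∑ k ∈ Finset.range N, b k| ≤
      Real.log (1 + (t / (2 * N)) ^ 2) / 2 + 12 / t := by
    rw [hD] at hA
    have hlog : 0 ≤ Real.log (1 + (t / (2 * N)) ^ 2) := Real.log_nonneg (by
      have := sq_nonneg (t / (2 * (N : ℝ)))
      linarith)
    have h12 : 12 / t = 4 * (3 / t) := by ring
    rw [abs_le] at hA ⊢
    constructor <;> linarith [hA.1, hA.2]
  have hF : ((Real.log N + Real.log 2 - Real.log t : ℝ) : ℂ) - ∑ k ∈ Finset.range N, w k =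
      ((Real.log N + Real.log 2 - Real.log t - ∑ k ∈ Finset.range N, b k : ℝ) : ℂ) -
      (∑ k ∈ Finset.range N, w k - ∑ k ∈ Finset.range N, (b k : ℂ)) := by
    push_cast
    ring
  rw [hF]
  refine (norm_sub_le _ _).trans ?_
  rw [norm_real, Real.norm_eq_abs]
  -- The 12/t comes from comparing the sum at u = 0 with an integral, the 6(1+u)²/t from moving u =
  -- 0 to u.
  have h12 : 12 / t + 6 * (1 + u) ^ 2 / t ≤ 18 * (1 + u) ^ 2 / t := by
    rw [← add_div]
    gcongr
    nlinarith
  linarith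

end ZetaArgument

end

/-! ### Fourier uniqueness, and the expansions of ζ'/ζ used with it. -/

noncomputable section

namespace ZetaArgument

open Complex Set Filter Topology MeasureTheory ComplexConjugate

/-- `φ` is a continuous integrable function with Fourier transform `Φ`. -/
def HasTransform (φ : ℝ → ℂ) (Φ : ℝ → ℂ) : Prop :=
  Continuous φ ∧ Integrable φ ∧ ∀ η : ℝ, ∫ X : ℝ, exp (-(η * X : ℝ) * I) * φ X = Φ η

lemma norm_exp_neg_mul_I (x : ℝ) : ‖exp (-(x : ℂ) * I)‖ = 1 := by
  rw [← ofReal_neg]; exact norm_exp_ofReal_mul_I _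

lemma continuous_exp_phase (η : ℝ) : Continuous fun X : ℝ => exp (-(η * X : ℝ) * I) := by
  fun_prop

lemma integrable_phase_mul {φ : ℝ → ℂ} (h : Integrable φ) (η : ℝ) :
    Integrable fun X : ℝ => exp (-(η * X : ℝ) * I) * φ X := by
  refine h.bdd_mul (c := 1) (continuous_exp_phase η).aestronglyMeasurable
    (Eventually.of_forall fun X => ?_)
  rw [norm_exp_neg_mul_I]

lemma HasTransform.add {φ ψ Φ Ψ : ℝ → ℂ} (h : HasTransform φ Φ) (h' : HasTransform ψ Ψ) :
    HasTransform (fun X => φ X + ψ X) (fun η => Φ η + Ψ η) := by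
  refine ⟨h.1.add h'.1, h.2.1.add h'.2.1, fun η => ?_⟩
  simp only [mul_add]
  rw [integral_add (integrable_phase_mul h.2.1 η) (integrable_phase_mul h'.2.1 η), h.2.2, h'.2.2]

lemma HasTransform.const_mul {φ Φ : ℝ → ℂ} (c : ℂ) (h : HasTransform φ Φ) :
    HasTransform (fun X => c * φ X) (fun η => c * Φ η) := by
  refine ⟨continuous_const.mul h.1, h.2.1.const_mul c, fun η => ?_⟩
  simp only [mul_left_comm _ c]
  rw [integral_const_mul, h.2.2]

/-- Fourier inversion; continuity turns equality almost everywhere into equality at each point. -/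
lemma HasTransform.eq_zero {φ : ℝ → ℂ} (h : HasTransform φ fun _ => 0) (X : ℝ) : φ X = 0 := by
  have hF : FourierTransform.fourier φ = fun _ => (0 : ℂ) := by
    funext ξ
    rw [Real.fourier_eq']
    refine Eq.trans ?_ (h.2.2 (2 * Real.pi * ξ))
    refine integral_congr_ae (Eventually.of_forall fun v => ?_)
    simp only [smul_eq_mul, RCLike.inner_apply, conj_trivial]
    congr 2
    push_cast
    ring
  have := h.2.1.fourierInv_fourier_eq (by rw [hF]; exact integrable_zero _ _ _) (h.1.continuousAt (x := X))
  rw [← this, hF, Real.fourierInv_eq']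
  simp

/-- The bound `b i * g X` serves twice: `g ≤ 1` gives uniform convergence and so continuity, and
integrability of `g` lets sum and integral be exchanged. -/
lemma HasTransform.tsum {ι : Type*} [Countable ι] {F Φ : ι → ℝ → ℂ} {b : ι → ℝ} {g : ℝ → ℝ}
    (h : ∀ i, HasTransform (F i) (Φ i)) (hb : Summable b) (hg : Integrable g)
    (hg1 : ∀ X, g X ≤ 1) (hb0 : ∀ i, 0 ≤ b i) (hF : ∀ i X, ‖F i X‖ ≤ b i * g X) :
    HasTransform (fun X => ∑' i, F i X) (fun η => ∑' i, Φ i η) := by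
  have hF1 : ∀ i X, ‖F i X‖ ≤ b i := fun i X =>
    (hF i X).trans (mul_le_of_le_one_right (hb0 i) (hg1 X))
  have hc : Continuous fun X => ∑' i, F i X := continuous_tsum (fun i => (h i).1) hb hF1
  have hbd : ∀ X, ‖∑' i, F i X‖ ≤ (∑' i, b i) * g X := fun X =>
    tsum_of_norm_bounded (hb.hasSum.mul_right (g X)) fun i => hF i X
  refine ⟨hc, (hg.const_mul (∑' i, b i)).mono' hc.aestronglyMeasurable
    (Eventually.of_forall hbd), fun η => ?_⟩
  have h2 := hasSum_integral_of_dominated_convergence (μ := volume)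
    (F := fun i X => exp (-(η * X : ℝ) * I) * F i X)
    (f := fun X => exp (-(η * X : ℝ) * I) * ∑' i, F i X) (fun i X => b i * g X)
    (fun i => ((continuous_exp_phase η).mul (h i).1).aestronglyMeasurable)
    (fun i => Eventually.of_forall fun X => by
      rw [norm_mul, norm_exp_neg_mul_I, one_mul]; exact hF i X)
    (Eventually.of_forall fun X => hb.mul_right (g X))
    (by simp only [tsum_mul_right]; exact hg.const_mul _)
    (Eventually.of_forall fun X => ((Summable.of_norm_bounded hb fun i => hF1 i X).hasSum).mul_left _)
  rw [← h2.tsum_eq]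
  exact tsum_congr fun i => (h i).2.2 η

/-- The function `X ↦ (e^{pX} - e^{qX}) / (p - q)` for `X ≥ 0`, extended by zero. -/
def expDiff (p q : ℂ) (X : ℝ) : ℂ := if 0 ≤ X then (exp (p * X) - exp (q * X)) / (p - q) else 0

/-- The damping factor `e^{-δX}` for `X ≥ 0`, extended by zero. -/
def damping (δ X : ℝ) : ℝ := if 0 ≤ X then Real.exp (-δ * X) else 0

lemma damping_le_one {δ : ℝ} (hδ : 0 ≤ δ) (X : ℝ) : damping δ X ≤ 1 := by
  unfold damping
  split_ifs with h
  · exact Real.exp_le_one_iff.2 (by nlinarith)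
  · exact zero_le_one

lemma damping_sub_le {δ l : ℝ} (hl : 0 ≤ l) (X : ℝ) :
    damping δ (X - l) ≤ Real.exp (δ * l) * damping δ X := by
  unfold damping
  split_ifs with h h'
  · rw [← Real.exp_add]; exact le_of_eq (by ring_nf)
  · exact absurd (by linarith : 0 ≤ X) h'
  · positivity
  · simp

lemma integrable_damping {δ : ℝ} (hδ : 0 < δ) : Integrable (damping δ) := by
  have h := integrableOn_exp_mul_Ioi (a := -δ) (by linarith) 0
  rw [← integrableOn_Ici_iff_integrableOn_Ioi, ← integrable_indicator_iff measurableSet_Ici] at h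
  refine h.congr (Eventually.of_forall fun X => ?_)
  simp [damping, indicator, mem_Ici]

lemma continuous_expDiff (p q : ℂ) : Continuous (expDiff p q) := by
  unfold expDiff
  refine Continuous.if_le (by fun_prop) continuous_const continuous_const continuous_id ?_
  intro X hX
  simp [← hX]

lemma norm_expDiff_le {p q : ℂ} {δ : ℝ} (hp : p.re ≤ -δ) (hq : q.re ≤ -δ) (X : ℝ) :
    ‖expDiff p q X‖ ≤ 2 / ‖p - q‖ * damping δ X := by
  unfold expDiff damping
  split_ifs with h
  · rw [norm_div, div_mul_eq_mul_div]
    refine div_le_div_of_nonneg_right ?_ (norm_nonneg _)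
    refine (norm_sub_le _ _).trans ?_
    rw [norm_exp, norm_exp, two_mul]
    refine add_le_add (Real.exp_le_exp.2 ?_) (Real.exp_le_exp.2 ?_) <;> simp <;> nlinarith
  · simp

/-- The building block of the explicit formula. Subtracting two exponentials removes the jump at X =
0, so inversion holds at every point. -/
lemma hasTransform_expDiff {p q : ℂ} {δ : ℝ} (hδ : 0 < δ) (hp : p.re ≤ -δ) (hq : q.re ≤ -δ)
    (hpq : p ≠ q) :
    HasTransform (expDiff p q) (fun η => 1 / ((η * I - p) * (η * I - q))) := by
  refine ⟨continuous_expDiff p q, ?_, fun η => ?_⟩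
  · exact ((integrable_damping hδ).const_mul _).mono' (continuous_expDiff p q).aestronglyMeasurable
      (Eventually.of_forall (norm_expDiff_le hp hq))
  · have hpre : (p - η * I).re < 0 := by simp; linarith
    have hqre : (q - η * I).re < 0 := by simp; linarith
    have e : (fun X : ℝ => exp (-(η * X : ℝ) * I) * expDiff p q X) =
        indicator (Ici 0) fun X : ℝ => (exp ((p - η * I) * X) - exp ((q - η * I) * X)) / (p - q) := by
      funext X
      by_cases h : 0 ≤ X
      · rw [indicator_of_mem (mem_Ici.2 h), expDiff, if_pos h, mul_div_assoc', mul_sub, ← exp_add, ← exp_add]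
        congr 3 <;> push_cast <;> ring
      · rw [indicator_of_notMem (by simpa using h), expDiff, if_neg h, mul_zero]
    rw [e, integral_indicator measurableSet_Ici, integral_Ici_eq_integral_Ioi, integral_div,
      integral_sub (integrableOn_exp_mul_complex_Ioi hpre 0) (integrableOn_exp_mul_complex_Ioi hqre 0),
      integral_exp_mul_complex_Ioi hpre, integral_exp_mul_complex_Ioi hqre]
    have n1 : p - η * I ≠ 0 := fun h => by rw [h] at hpre; simp at hpre
    have n2 : q - η * I ≠ 0 := fun h => by rw [h] at hqre; simp at hqre
    have n3 : η * I - p ≠ 0 := fun h => n1 (by rw [← neg_sub, h, neg_zero])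
    have n4 : η * I - q ≠ 0 := fun h => n2 (by rw [← neg_sub, h, neg_zero])
    have n5 : p - q ≠ 0 := sub_ne_zero.2 hpq
    simp only [ofReal_zero, mul_zero, exp_zero]
    rw [← neg_sub (η * I) p, ← neg_sub (η * I) q]
    field_simp
    ring

lemma HasTransform.comp_sub {φ Φ : ℝ → ℂ} (h : HasTransform φ Φ) (l : ℝ) :
    HasTransform (fun X => φ (X - l)) (fun η => exp (-(η * l : ℝ) * I) * Φ η) := by
  refine ⟨h.1.comp (by fun_prop), h.2.1.comp_sub_right l, fun η => ?_⟩
  simp only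
  rw [← h.2.2, ← integral_const_mul]
  rw [← integral_sub_right_eq_self (fun X : ℝ => exp (-(η * l : ℝ) * I) * (exp (-(η * X : ℝ) * I) * φ X)) l]
  refine integral_congr_ae (Eventually.of_forall fun X => ?_)
  simp only
  rw [← mul_assoc, ← exp_add]
  congr 2
  push_cast
  ring

lemma NontrivialZero.one_le_mult (ρ : NontrivialZero) : 1 ≤ ρ.mult := by
  rw [← analyticOrderNatAt_xi]
  have htop := EntirePartialFractions.analyticOrderAt_ne_top_of_entire differentiable_xi
    xi_two_ne_zero ρ.1
  have h0 : analyticOrderAt xi ρ.1 ≠ 0 :=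
    (differentiable_xi.analyticAt _).analyticOrderAt_ne_zero.2 ρ.xi_eq_zero
  rw [Nat.one_le_iff_ne_zero]
  intro h
  apply h0
  rw [← Nat.cast_analyticOrderNatAt htop, h]
  rfl

/-- All terms of the convergent series of mult/‖2 - ρ‖² are nonzero, and a summable family has
countable support. -/
instance : Countable NontrivialZero := by
  have h := (summable_mult_div_sq xi_two_ne_zero).countable_support
  rw [← Set.countable_univ_iff]
  refine h.mono fun ρ _ => ?_
  have h1 : (ρ.mult : ℝ) ≠ 0 := by
    have := ρ.one_le_mult
    positivity
  have h2 : ‖2 - ρ.1‖ ≠ 0 := fun h => xi_two_ne_zero (by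
    rw [sub_eq_zero.1 (norm_eq_zero.1 h)]; exact ρ.xi_eq_zero)
  exact div_ne_zero h1 (pow_ne_zero _ h2)

/-- The partial fraction expansion of `ζ'/ζ`. -/
lemma logDeriv_zeta_sub (hRH : RiemannHypothesis) {s w : ℂ} (hs : 1 / 2 < s.re) (hw : 1 / 2 < w.re)
    (hs1 : s ≠ 1) (hw1 : w ≠ 1) :
    logDeriv riemannZeta w - logDeriv riemannZeta s =
      ∑' ρ : NontrivialZero, (ρ.mult : ℂ) * (1 / (w - ρ.1) - 1 / (s - ρ.1)) +
      ∑' k : ℕ, (1 / (2 * ((k : ℂ) + 1) + w) - 1 / (2 * ((k : ℂ) + 1) + s)) -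
      (1 / (w - 1) - 1 / (s - 1)) := by
  have h1 := logDeriv_xi_eq (by linarith) hs1 (zeta_ne_zero_of_RH hRH hs)
  have h2 := logDeriv_xi_eq (by linarith) hw1 (zeta_ne_zero_of_RH hRH hw)
  have h3 := (hasSum_logDeriv_xi (xi_ne_zero_of_RH hRH hw.ne') (xi_ne_zero_of_RH hRH hs.ne')).tsum_eq
  have h4 := (hasSum_logDeriv_Gammaℝ (s := s) (by linarith)).sub
    (hasSum_logDeriv_Gammaℝ (s := w) (by linarith))
  -- The k = 0 term of the Gamma series cancels the contribution of the factor s of ξ; only the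
  -- trivial zeros -2(k+1) remain.
  have h5 := (hasSum_nat_add_iff' 1).2 h4
  have h6 : ∑' k : ℕ, (1 / (2 * ((k : ℂ) + 1) + w) - 1 / (2 * ((k : ℂ) + 1) + s)) =
      logDeriv Gammaℝ s - logDeriv Gammaℝ w - (1 / w - 1 / s) := by
    have e : (fun k : ℕ => (1 / (2 * ((k : ℂ) + 1) + w) - 1 / (2 * ((k : ℂ) + 1) + s))) =
        fun k : ℕ => (1 / (2 * ((k + 1 : ℕ) : ℂ) + 2) - 1 / (2 * ((k + 1 : ℕ) : ℂ) + s) -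
          (1 / (2 * ((k + 1 : ℕ) : ℂ) + 2) - 1 / (2 * ((k + 1 : ℕ) : ℂ) + w))) := by
      funext k
      push_cast
      ring
    rw [e, h5.tsum_eq]
    simp
  rw [h3, h6, h1, h2]
  ring

/-- The factor that might be small, u minus the pole, is bounded below through its real part when k
+ 1 ≥ u and through its imaginary part t otherwise. -/
lemma summable_trivial_weight {u t : ℝ} (hu : 0 < u) (ht : t ≠ 0) :
    Summable fun k : ℕ => ‖2 * u / ((u : ℂ) ^ 2 - (-(2 * (k + 1) + 1 / 2) - t * I) ^ 2)‖ := by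
  set κ := min 1 (|t| / u)
  have hκ : 0 < κ := lt_min one_pos (by positivity)
  refine Summable.of_nonneg_of_le (fun _ => norm_nonneg _) (fun k => ?_)
    (summable_one_div_add_one_sq.mul_left (2 * u / κ))
  have hk : (0 : ℝ) ≤ k := by positivity
  have e : (u : ℂ) ^ 2 - (-(2 * (k + 1) + 1 / 2) - t * I) ^ 2 =
      (u + (2 * (k + 1) + 1 / 2) + t * I) * (u - (2 * (k + 1) + 1 / 2) - t * I) := by ring
  have h1 : (k : ℝ) + 1 ≤ ‖(u : ℂ) + (2 * (k + 1) + 1 / 2) + t * I‖ := by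
    refine le_trans ?_ (re_le_norm _)
    simp
    linarith
  have h2 : κ * ((k : ℝ) + 1) ≤ ‖(u : ℂ) - (2 * (k + 1) + 1 / 2) - t * I‖ := by
    rcases le_total u (k + 1) with h | h
    · refine le_trans ?_ ((neg_le_abs _).trans (abs_re_le_norm _))
      have := min_le_left 1 (|t| / u)
      simp
      nlinarith
    · refine le_trans ?_ (abs_im_le_norm _)
      have h3 : κ ≤ |t| / u := min_le_right 1 (|t| / u)
      have h4 : κ * u ≤ |t| := by rwa [le_div_iff₀ hu] at h3
      simp
      nlinarith
  rw [e, norm_div, norm_mul, norm_mul, Complex.norm_ofNat, norm_real, Real.norm_of_nonneg hu.le]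
  calc 2 * u / (‖(u : ℂ) + (2 * (k + 1) + 1 / 2) + t * I‖ * ‖(u : ℂ) - (2 * (k + 1) + 1 / 2) - t * I‖)
      ≤ 2 * u / (((k : ℝ) + 1) * (κ * ((k : ℝ) + 1))) := by gcongr
    _ = _ := by field_simp

open ArithmeticFunction in
lemma summable_vonMangoldt_rpow {a : ℝ} (ha : 1 < a) :
    Summable fun m : ℕ => Λ m * Real.exp (-a * Real.log m) := by
  have h := (LSeriesSummable_vonMangoldt (s := a) (by simpa using ha)).norm
  refine h.congr fun m => ?_
  rcases Nat.eq_zero_or_pos m with rfl | hm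
  · simp
  · have hm' : (0 : ℝ) < m := by exact_mod_cast hm
    rw [LSeries.term_of_ne_zero hm.ne', norm_div, norm_natCast_cpow_of_pos hm, norm_real,
      Real.norm_of_nonneg vonMangoldt_nonneg, ofReal_re, Real.rpow_def_of_pos hm', div_eq_mul_inv,
      ← Real.exp_neg]
    ring_nf

open ArithmeticFunction in
lemma tsum_vonMangoldt {s : ℂ} (hs : 1 < s.re) :
    ∑' m : ℕ, (Λ m : ℂ) * exp (-s * Real.log m) = -logDeriv riemannZeta s := by
  have h := LSeries_vonMangoldt_eq_deriv_riemannZeta_div hs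
  rw [logDeriv_apply, ← neg_div, ← h, LSeries]
  refine tsum_congr fun m => ?_
  rcases Nat.eq_zero_or_pos m with rfl | hm
  · simp
  · have hm' : (m : ℂ) ≠ 0 := by exact_mod_cast hm.ne'
    rw [LSeries.term_of_ne_zero hm.ne', cpow_def_of_ne_zero hm', div_eq_mul_inv, ← exp_neg,
      ← natCast_log]
    ring_nf

end ZetaArgument

end

/-! ### The explicit formula and its symmetrization. -/

noncomputable section

namespace ZetaArgument

open Complex Set Filter Topology MeasureTheory ComplexConjugate

/-- The function with transform proportional to `1 / (w - a) - 1 / (u - a)`, where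
`w = c + iη`. -/
def poleTerm (u c : ℝ) (a : ℂ) (X : ℝ) : ℂ := 2 * u / (u - a) * expDiff (a - c) (-u - c) X

lemma norm_poleTerm_le {u c δ : ℝ} {a : ℂ} (hu : 0 < u) (hc : δ ≤ c) (ha : a.re - c ≤ -δ) (X : ℝ) :
    ‖poleTerm u c a X‖ ≤ 2 * ‖2 * u / ((u : ℂ) ^ 2 - a ^ 2)‖ * damping δ X := by
  have h := norm_expDiff_le (p := a - c) (q := -u - c) (δ := δ) (by simpa using ha)
    (by simp; linarith) X
  rw [poleTerm, norm_mul]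
  refine (mul_le_mul_of_nonneg_left h (norm_nonneg _)).trans (le_of_eq ?_)
  rw [← mul_assoc]
  congr 1
  rw [show a - c - (-u - c) = u + a by ring, show (u : ℂ) ^ 2 - a ^ 2 = (u - a) * (u + a) by ring,
    ← div_div, norm_div (_ / _) (_ + _)]
  ring

lemma hasTransform_poleTerm {u c δ : ℝ} {a : ℂ} (hδ : 0 < δ) (hu : 0 < u) (hc : u + δ ≤ c)
    (ha : a.re - c ≤ -δ) (ha1 : (u : ℂ) + a ≠ 0) (ha2 : (u : ℂ) - a ≠ 0) :
    HasTransform (poleTerm u c a) (fun η => -(2 * u / ((c + η * I - u) * (c + η * I + u))) *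
      (1 / (c + η * I - a) - 1 / (u - a))) := by
  have h := (hasTransform_expDiff (p := a - c) (q := -u - c) (δ := δ) hδ (by simpa using ha)
    (by simp; linarith) (fun h => ha1 (by linear_combination h))).const_mul (2 * u / (u - a))
  have e : (fun η : ℝ => 2 * u / (u - a) * (1 / ((η * I - (a - c)) * (η * I - (-u - c))))) =
      (fun η : ℝ => -(2 * u / ((c + η * I - u) * (c + η * I + u))) *
      (1 / (c + η * I - a) - 1 / (u - a))) := by
    funext η
    have n1 : c + η * I - (u : ℂ) ≠ 0 := fun h => by
      have := congrArg re h; simp at this; linarith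
    have n2 : c + η * I + (u : ℂ) ≠ 0 := fun h => by
      have := congrArg re h; simp at this; linarith
    have n3 : c + η * I - a ≠ 0 := fun h => by
      have := congrArg re h; simp at this; linarith
    rw [show η * I - (a - c) = c + η * I - a by ring,
      show η * I - (-u - (c : ℂ)) = c + η * I + u by ring]
    field_simp
    ring
  rw [← e]
  exact h

/-- Removes the damping e^{-cX} that made the term integrable. -/
lemma exp_mul_poleTerm {u c : ℝ} {a : ℂ} (ha1 : (u : ℂ) + a ≠ 0) (ha2 : (u : ℂ) - a ≠ 0) {X : ℝ}
    (hX : 0 ≤ X) :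
    exp (c * X) * poleTerm u c a X =
      2 * u / ((u : ℂ) ^ 2 - a ^ 2) * (exp (a * X) - exp (-u * X)) := by
  rw [poleTerm, expDiff, if_pos hX]
  have e1 : exp (a * X) = exp (c * X) * exp ((a - c) * X) := by rw [← exp_add]; ring_nf
  have e2 : exp (-u * X) = exp (c * X) * exp ((-u - c) * X) := by rw [← exp_add]; ring_nf
  rw [e1, e2, show a - c - (-u - c) = u + a by ring,
    show (u : ℂ) ^ 2 - a ^ 2 = (u - a) * (u + a) by ring]
  field_simp

/-- The contribution of a prime power with logarithm `l` to the explicit formula. -/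
def primeTerm (u c l X : ℝ) : ℂ :=
  2 * u * exp (-c * l) * expDiff (u - c) (-u - c) (X - l)

lemma norm_primeTerm_le {u c δ l : ℝ} (hu : 0 < u) (hc : u + δ ≤ c) (hl : 0 ≤ l) (X : ℝ) :
    ‖primeTerm u c l X‖ ≤ 2 * Real.exp (-(c - δ) * l) * damping δ X := by
  have h := norm_expDiff_le (p := u - c) (q := -u - c) (δ := δ) (by simp; linarith)
    (by simp; linarith) (X - l)
  have h2 := damping_sub_le (δ := δ) hl X
  have e : ‖(u : ℂ) - c - (-u - c)‖ = 2 * u := by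
    rw [show (u : ℂ) - c - (-u - c) = ((2 * u : ℝ) : ℂ) by push_cast; ring, norm_real,
      Real.norm_of_nonneg (by linarith)]
  rw [e] at h
  rw [primeTerm, norm_mul, norm_mul, norm_mul, Complex.norm_ofNat, norm_real,
    Real.norm_of_nonneg hu.le, norm_exp]
  have e2 : ((-c : ℂ) * l).re = -c * l := by simp
  rw [e2]
  calc 2 * u * Real.exp (-c * l) * ‖expDiff (u - c) (-u - c) (X - l)‖
      ≤ 2 * u * Real.exp (-c * l) * (2 / (2 * u) * (Real.exp (δ * l) * damping δ X)) := by
        gcongr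
        exact h.trans (by gcongr)
    _ = 2 * (Real.exp (-c * l) * Real.exp (δ * l)) * damping δ X := by field_simp
    _ = _ := by rw [← Real.exp_add]; ring_nf

lemma hasTransform_primeTerm {u c δ l : ℝ} (hu : 0 < u) (hδ : 0 < δ) (hc : u + δ ≤ c) :
    HasTransform (primeTerm u c l) (fun η => 2 * u / ((c + η * I - u) * (c + η * I + u)) *
      exp (-(c + η * I) * l)) := by
  have hu' : (u : ℂ) ≠ 0 := by exact_mod_cast hu.ne'
  have h := ((hasTransform_expDiff (p := u - c) (q := -u - c) (δ := δ) hδ (by simp; linarith)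
    (by simp; linarith) (fun h => hu' (by linear_combination h / 2))).comp_sub l).const_mul
    (2 * u * exp (-c * l))
  have e : (fun η : ℝ => 2 * u * exp (-c * l) * (exp (-(η * l : ℝ) * I) *
      (1 / ((η * I - (u - c)) * (η * I - (-u - c)))))) =
      (fun η : ℝ => 2 * u / ((c + η * I - u) * (c + η * I + u)) *
      exp (-(c + η * I) * l)) := by
    funext η
    rw [show η * I - ((u : ℂ) - c) = c + η * I - u by ring,
      show η * I - (-u - (c : ℂ)) = c + η * I + u by ring,
      show -(c + η * I) * (l : ℂ) = -c * l + -(η * l : ℝ) * I by push_cast; ring, exp_add]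
    ring
  rw [← e]
  exact h

lemma exp_mul_primeTerm {u c : ℝ} (hu : 0 < u) (l X : ℝ) :
    exp (c * X) * primeTerm u c l X =
      if l ≤ X then exp (u * (X - l)) - exp (-u * (X - l)) else 0 := by
  have hu' : (u : ℂ) ≠ 0 := by exact_mod_cast hu.ne'
  rw [primeTerm, expDiff]
  split_ifs with h1 h2 h2
  · have e1 : exp (u * (X - l)) = exp (c * X) * exp (-c * l) * exp ((u - c) * (X - l : ℝ)) := by
      rw [← exp_add, ← exp_add]; push_cast; ring_nf
    have e2 : exp (-u * (X - l)) = exp (c * X) * exp (-c * l) * exp ((-u - c) * (X - l : ℝ)) := by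
      rw [← exp_add, ← exp_add]; push_cast; ring_nf
    rw [e1, e2, show (u : ℂ) - c - (-u - c) = 2 * u by ring]
    field_simp
  · linarith
  · linarith
  · simp

/-- The poles of `w ↦ ζ'/ζ (1/2 + it + w)` at the trivial zeros. -/
def trivialPole (t : ℝ) (k : ℕ) : ℂ := -(2 * (k + 1) + 1 / 2) - t * I

/-- The location of the pole of `w ↦ ζ (1/2 + it + w)`. -/
def zetaPole (t : ℝ) : ℂ := 1 / 2 - t * I

lemma add_ne_zero_of_im {u : ℝ} {a : ℂ} (h : a.im ≠ 0) : (u : ℂ) + a ≠ 0 := fun h' => by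
  have := congrArg im h'
  simp at this
  exact h this

lemma sub_ne_zero_of_im {u : ℝ} {a : ℂ} (h : a.im ≠ 0) : (u : ℂ) - a ≠ 0 := fun h' => by
  have := congrArg im h'
  simp at this
  exact h this

lemma ofReal_add_mul_I_ne_zero {u v : ℝ} (hu : u ≠ 0) : (u : ℂ) + v * I ≠ 0 := fun h' => by
  have := congrArg re h'
  simp at this
  exact hu this

lemma ofReal_sub_mul_I_ne_zero {u v : ℝ} (hu : u ≠ 0) : (u : ℂ) - v * I ≠ 0 := fun h' => by
  have := congrArg re h'
  simp at this
  exact hu this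

lemma summable_zero_weight (hRH : RiemannHypothesis) {u : ℝ} (hu : 0 < u) (t : ℝ) :
    Summable fun ρ : NontrivialZero => (ρ.mult : ℝ) * (2 * u / (u ^ 2 + (ρ.ordinate - t) ^ 2)) :=
  (hasSum_re_logDeriv_xi hRH hu).summable

lemma ofReal_zero_weight (u t : ℝ) (γ : ℝ) :
    2 * (u : ℂ) / ((u : ℂ) ^ 2 - ((γ - t : ℝ) * I) ^ 2) = ((2 * u / (u ^ 2 + (γ - t) ^ 2) : ℝ) : ℂ) := by
  push_cast
  rw [mul_pow, I_sq]
  ring_nf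

open ArithmeticFunction in
-- At frequency η put w = u + 1 + iη. Every transform carries the factor 2u/((w-u)(w+u)), and the
-- cofactors cancel by `logDeriv_zeta_sub`, with the Dirichlet series supplying ζ'/ζ at 1/2 + it +
-- w. So the damped sum has transform zero.
lemma explicit_formula_transform (hRH : RiemannHypothesis) {u t : ℝ} (hu : 0 < u) (ht : t ≠ 0) (X : ℝ) :
    ∑' m : ℕ, (Λ m : ℂ) * exp (-(1 / 2 + t * I) * Real.log m) * primeTerm u (u + 1) (Real.log m) X
      + logDeriv riemannZeta (1 / 2 + u + t * I) * primeTerm u (u + 1) 0 X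
      + -1 * ∑' ρ : NontrivialZero, (ρ.mult : ℂ) * poleTerm u (u + 1) ((ρ.ordinate - t : ℝ) * I) X
      + -1 * ∑' k : ℕ, poleTerm u (u + 1) (trivialPole t k) X
      + poleTerm u (u + 1) (zetaPole t) X = 0 := by
  -- With c = u + 1 and decay rate 1/4, all poles (real part at most 1/2) lie far enough to the
  -- left, and the Dirichlet series is majorized at the exponent 1/2 + c - 1/4 = u + 5/4 > 1.
  have hc : u + 1 / 4 ≤ u + 1 := by linarith
  have hc' : 1 / 4 ≤ u + 1 := by linarith
  have hδ : (0 : ℝ) < 1 / 4 := by norm_num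
  have im1 : ∀ k, (trivialPole t k).im ≠ 0 := fun k => by simp [trivialPole, ht]
  have im2 : (zetaPole t).im ≠ 0 := by simp [zetaPole, ht]
  have re1 : ∀ k, (trivialPole t k).re - (u + 1) ≤ -(1 / 4) := fun k => by
    have : (0 : ℝ) ≤ k := by positivity
    simp [trivialPole]; linarith
  have re2 : (zetaPole t).re - (u + 1) ≤ -(1 / 4) := by
    simp [zetaPole]; linarith
  have re3 : ∀ ρ : NontrivialZero, (((ρ.ordinate - t : ℝ) * I : ℂ)).re - (u + 1) ≤ -(1 / 4) := fun ρ => by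
    simp; linarith
  have T1 := HasTransform.tsum (fun m : ℕ => (hasTransform_primeTerm (l := Real.log m) hu hδ hc).const_mul
      ((Λ m : ℂ) * exp (-(1 / 2 + t * I) * Real.log m)))
    ((summable_vonMangoldt_rpow (a := u + 5 / 4) (by linarith)).mul_left 2) (integrable_damping hδ)
    (damping_le_one hδ.le) (fun m => mul_nonneg zero_le_two
      (mul_nonneg vonMangoldt_nonneg (Real.exp_nonneg _)))
    (fun m X => by
      have := norm_primeTerm_le hu hc (Real.log_natCast_nonneg m) X
      rw [norm_mul, norm_mul, norm_real, Real.norm_of_nonneg vonMangoldt_nonneg, norm_exp]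
      have e : (-(1 / 2 + t * I) * (Real.log m : ℂ)).re = -(1 / 2) * Real.log m := by
        rw [re_mul_ofReal]; simp
      rw [e]
      refine (mul_le_mul_of_nonneg_left this
        (mul_nonneg vonMangoldt_nonneg (Real.exp_nonneg _))).trans (le_of_eq ?_)
      rw [show -(u + 5 / 4) * Real.log m = -(1 / 2) * Real.log m + -(u + 1 - 1 / 4) * Real.log m by ring,
        Real.exp_add]
      ring)
  have T2 := (hasTransform_primeTerm (l := 0) hu hδ hc).const_mul (logDeriv riemannZeta (1 / 2 + u + t * I))
  have T3 := HasTransform.tsum (fun ρ : NontrivialZero => (hasTransform_poleTerm hδ hu hc (re3 ρ)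
      (ofReal_add_mul_I_ne_zero hu.ne') (ofReal_sub_mul_I_ne_zero hu.ne')).const_mul (ρ.mult : ℂ))
    ((summable_zero_weight hRH hu t).mul_left 2) (integrable_damping hδ)
    (damping_le_one hδ.le) (fun ρ => by positivity)
    (fun ρ X => by
      have := norm_poleTerm_le hu hc' (re3 ρ) X
      rw [ofReal_zero_weight, norm_real, Real.norm_of_nonneg (by positivity)] at this
      rw [norm_mul, norm_natCast]
      refine (mul_le_mul_of_nonneg_left this (by positivity)).trans (le_of_eq ?_)
      ring)
  have T4 := HasTransform.tsum (fun k : ℕ => (hasTransform_poleTerm hδ hu hc (re1 k)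
      (add_ne_zero_of_im (im1 k)) (sub_ne_zero_of_im (im1 k))))
    ((summable_trivial_weight hu ht).mul_left 2) (integrable_damping hδ)
    (damping_le_one hδ.le) (fun ρ => by positivity)
    (fun k X => norm_poleTerm_le hu hc' (re1 k) X)
  have T5 := hasTransform_poleTerm hδ hu hc re2 (add_ne_zero_of_im im2) (sub_ne_zero_of_im im2)
  have T := (((T1.add T2).add (T3.const_mul (-1))).add (T4.const_mul (-1))).add T5
  refine HasTransform.eq_zero (φ := fun X => _) ⟨T.1, T.2.1, fun η => ?_⟩ X
  rw [T.2.2 η]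
  simp only
  have P := logDeriv_zeta_sub hRH (s := 1 / 2 + u + t * I) (w := 1 / 2 + t * I + ((u + 1 : ℝ) + η * I))
    (by simp [hu]) (by simp; linarith) (fun h => ht (by simpa using congrArg im h))
    (fun h => by have := congrArg re h; simp at this; linarith)
  have Q := tsum_vonMangoldt (s := 1 / 2 + t * I + ((u + 1 : ℝ) + η * I)) (by simp; linarith)
  set w : ℂ := (u + 1 : ℝ) + η * I
  set K : ℂ := 2 * u / ((w - u) * (w + u))
  have S1 : ∑' m : ℕ, (Λ m : ℂ) * exp (-(1 / 2 + t * I) * Real.log m) * (K * exp (-w * Real.log m)) =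
      -K * logDeriv riemannZeta (1 / 2 + t * I + w) := by
    rw [neg_mul, ← mul_neg, ← Q, ← tsum_mul_left]
    refine tsum_congr fun m => ?_
    rw [show -(1 / 2 + t * I + w) * (Real.log m : ℂ) = -(1 / 2 + t * I) * Real.log m + -w * Real.log m by ring,
      exp_add]
    ring
  have S3 : ∑' ρ : NontrivialZero, (ρ.mult : ℂ) * (-K * (1 / (w - (ρ.ordinate - t : ℝ) * I) -
      1 / (u - (ρ.ordinate - t : ℝ) * I))) = -K * ∑' ρ : NontrivialZero, (ρ.mult : ℂ) *
        (1 / (1 / 2 + t * I + w - ρ.1) - 1 / (1 / 2 + u + t * I - ρ.1)) := by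
    rw [← tsum_mul_left]
    refine tsum_congr fun ρ => ?_
    rw [ρ.eq hRH]
    push_cast
    ring_nf
  have S4 : ∑' k : ℕ, (-K * (1 / (w - trivialPole t k) - 1 / (u - trivialPole t k))) =
      -K * ∑' k : ℕ, (1 / (2 * ((k : ℂ) + 1) + (1 / 2 + t * I + w)) -
        1 / (2 * ((k : ℂ) + 1) + (1 / 2 + u + t * I))) := by
    rw [← tsum_mul_left]
    refine tsum_congr fun ρ => ?_
    rw [trivialPole]
    ring_nf
  rw [S1, S3, S4, zetaPole]
  have e1 : 1 / 2 + t * I + w - 1 = w - (1 / 2 - t * I) := by ring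
  have e2 : (1 / 2 + u + t * I : ℂ) - 1 = u - (1 / 2 - t * I) := by ring
  rw [e1, e2] at P
  simp only [ofReal_zero, mul_zero, exp_zero, mul_one]
  -- `P` is the partial fraction identity between the base point 1/2 + u + it and 1/2 + it + w.
  linear_combination (-K) * P

open ArithmeticFunction in
/-- The explicit formula for `ζ'/ζ` with the kernel `2u / (w² - u²)`. -/
theorem explicit_formula (hRH : RiemannHypothesis) {u t X : ℝ} (hu : 0 < u) (ht : t ≠ 0) (hX : 0 ≤ X) :
    ∑' m : ℕ, (Λ m : ℂ) * exp (-(1 / 2 + t * I) * Real.log m) *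
        (if Real.log m ≤ X then exp (u * (X - Real.log m)) - exp (-u * (X - Real.log m)) else 0)
      + logDeriv riemannZeta (1 / 2 + u + t * I) * (exp (u * X) - exp (-u * X))
      = ∑' ρ : NontrivialZero, (ρ.mult : ℂ) * ((2 * u / (u ^ 2 + (ρ.ordinate - t) ^ 2) : ℝ) *
          (exp ((ρ.ordinate - t : ℝ) * I * X) - exp (-u * X)))
        + ∑' k : ℕ, 2 * u / ((u : ℂ) ^ 2 - trivialPole t k ^ 2) *
          (exp (trivialPole t k * X) - exp (-u * X))
        - 2 * u / ((u : ℂ) ^ 2 - zetaPole t ^ 2) * (exp (zetaPole t * X) - exp (-u * X)) := by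
  have im1 : ∀ k, (trivialPole t k).im ≠ 0 := fun k => by simp [trivialPole, ht]
  have im2 : (zetaPole t).im ≠ 0 := by simp [zetaPole, ht]
  have h := congrArg (fun z => exp ((u + 1 : ℝ) * X) * z) (explicit_formula_transform hRH hu ht X)
  simp only [mul_zero, mul_add, mul_left_comm (exp ((u + 1 : ℝ) * X)), ← tsum_mul_left] at h
  simp only [exp_mul_primeTerm hu, exp_mul_poleTerm (add_ne_zero_of_im im2) (sub_ne_zero_of_im im2) hX,
    exp_mul_poleTerm (add_ne_zero_of_im (im1 _)) (sub_ne_zero_of_im (im1 _)) hX,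
    exp_mul_poleTerm (ofReal_add_mul_I_ne_zero hu.ne') (ofReal_sub_mul_I_ne_zero hu.ne') hX,
    if_pos hX, ofReal_zero, sub_zero, ofReal_zero_weight] at h
  rw [tsum_mul_left, tsum_mul_left] at h
  linear_combination h

lemma trivial_weight_eq {t : ℝ} (ht : t ≠ 0) (u : ℝ) (k : ℕ) :
    2 * u / ((u : ℂ) ^ 2 - trivialPole t k ^ 2) =
      1 / (2 * ((k + 1 : ℕ) : ℂ) + (1 / 2 + u + t * I)) -
        1 / (2 * ((k + 1 : ℕ) : ℂ) + (1 / 2 - u + t * I)) := by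
  have im1 : (trivialPole t k).im ≠ 0 := by simp [trivialPole, ht]
  have n1 := add_ne_zero_of_im (u := u) im1
  have n2 := sub_ne_zero_of_im (u := u) im1
  rw [show 2 * ((k + 1 : ℕ) : ℂ) + (1 / 2 + u + t * I) = u - trivialPole t k by
      simp [trivialPole]; ring,
    show 2 * ((k + 1 : ℕ) : ℂ) + (1 / 2 - u + t * I) = -(u + trivialPole t k) by
      simp [trivialPole]; ring,
    show (u : ℂ) ^ 2 - trivialPole t k ^ 2 = (u - trivialPole t k) * (u + trivialPole t k) by ring]
  field_simp
  ring

lemma conj_half_add (u t : ℝ) : conj (1 / 2 + u + t * I : ℂ) = 1 / 2 + u - t * I := by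
  apply Complex.ext <;> simp

/-- The part of the symmetrized explicit formula coming from the Gamma factor. -/
def gammaPart (u t : ℝ) : ℂ :=
  ((2 * (1 / (1 / 2 + u + t * I) + 1 / (1 / 2 + u + t * I - 1) +
    logDeriv Gammaℝ (1 / 2 + u + t * I) : ℂ).re : ℝ) : ℂ) +
    ∑' k : ℕ, 2 * u / ((u : ℂ) ^ 2 - trivialPole t k ^ 2) - 2 * u / ((u : ℂ) ^ 2 - zetaPole t ^ 2)

lemma logDeriv_Gammaℝ_conj {s : ℂ} (hs : 0 < s.re) :
    logDeriv Gammaℝ (conj s) = conj (logDeriv Gammaℝ s) := by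
  have h := (hasSum_logDeriv_Gammaℝ (s := conj s) (by simpa using hs)).tsum_eq
  have h' := (hasSum_conj'.2 (hasSum_logDeriv_Gammaℝ hs)).tsum_eq
  simp only [map_sub, map_div₀, map_add, map_mul, map_one, map_ofNat, map_natCast, conj_ofReal] at h'
  rw [h] at h'
  simpa using h'

/-- The weight of the pole removes two of the four rational terms, and one of the others completes
the trivial zeros by a k = 0 term. With s = 1/2 + u + it, the terms 1/(2k + s) cancel. What remains
is the Gamma series at conj s and at 1 - conj s, the form required by `norm_sub_log_le`. -/
lemma norm_gammaPart_sub_log_le {u t : ℝ} (hu : 0 < u) (ht : 1 ≤ t) :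
    ‖gammaPart u t - Real.log (t / (2 * Real.pi))‖ ≤ 18 * (1 + u) ^ 2 / t := by
  have ht0 : t ≠ 0 := by linarith
  refine norm_sub_log_le hu.le ht ?_
  have hre : (0 : ℝ) < (1 / 2 + u + t * I : ℂ).re := by simp; linarith
  have h1 := hasSum_logDeriv_Gammaℝ hre
  have h2 := hasSum_logDeriv_Gammaℝ (s := conj (1 / 2 + u + t * I)) (by rwa [conj_re])
  rw [logDeriv_Gammaℝ_conj hre] at h2
  have hs : Summable fun k : ℕ => 2 * u / ((u : ℂ) ^ 2 - trivialPole t k ^ 2) :=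
    (summable_trivial_weight hu ht0).of_norm
  have h3 : HasSum (fun k : ℕ => 1 / (2 * (k : ℂ) + (1 / 2 + u + t * I)) -
      1 / (2 * (k : ℂ) + (1 / 2 - u + t * I))) (∑' k : ℕ, 2 * u / ((u : ℂ) ^ 2 - trivialPole t k ^ 2) +
        (1 / (1 / 2 + u + t * I) - 1 / (1 / 2 - u + t * I))) := by
    rw [← hasSum_nat_add_iff' 1]
    have e : (fun k : ℕ => 2 * u / ((u : ℂ) ^ 2 - trivialPole t k ^ 2)) = _ :=
      funext fun k => trivial_weight_eq ht0 u k
    have := hs.hasSum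
    rw [e] at this
    simpa [trivial_weight_eq ht0] using this
  have h := (h1.add h2).add h3
  have e : (fun k : ℕ => 1 / ((k : ℂ) + 1) - (1 / (((2 * k + 1 / 2 : ℝ) : ℂ) + (u - t * I)) +
      1 / (((2 * k + 1 / 2 : ℝ) : ℂ) - (u - t * I)))) = fun k : ℕ =>
      (1 / (2 * (k : ℂ) + 2) - 1 / (2 * (k : ℂ) + (1 / 2 + u + t * I))) +
      (1 / (2 * (k : ℂ) + 2) - 1 / (2 * (k : ℂ) + conj (1 / 2 + u + t * I : ℂ))) +
      (1 / (2 * (k : ℂ) + (1 / 2 + u + t * I)) - 1 / (2 * (k : ℂ) + (1 / 2 - u + t * I))) := by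
    funext k
    have hk : (k : ℂ) + 1 ≠ 0 := by exact_mod_cast k.succ_ne_zero
    rw [show (2 * (k : ℂ) + 2) = 2 * (k + 1) by ring,
      show 2 * (k : ℂ) + conj (1 / 2 + u + t * I : ℂ) = ((2 * k + 1 / 2 : ℝ) : ℂ) + (u - t * I) by
        rw [conj_half_add]; push_cast; ring,
      show 2 * (k : ℂ) + (1 / 2 - u + t * I) = ((2 * k + 1 / 2 : ℝ) : ℂ) - (u - t * I) by
        push_cast; ring]
    field_simp
    ring
  have e2 : gammaPart u t + Real.log Real.pi + Real.eulerMascheroniConstant =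
      (logDeriv Gammaℝ (1 / 2 + u + t * I) + (Real.log Real.pi + Real.eulerMascheroniConstant) / 2) +
      (conj (logDeriv Gammaℝ (1 / 2 + u + t * I)) + (Real.log Real.pi + Real.eulerMascheroniConstant) / 2) +
      (∑' k : ℕ, 2 * u / ((u : ℂ) ^ 2 - trivialPole t k ^ 2) +
        (1 / (1 / 2 + u + t * I) - 1 / (1 / 2 - u + t * I))) := by
    have a1 : ∀ z : ℂ, ((2 * z.re : ℝ) : ℂ) = z + conj z := fun z => (add_conj z).symm
    have im2 : (zetaPole t).im ≠ 0 := by simp [zetaPole, ht0]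
    have n1 := add_ne_zero_of_im (u := u) im2
    have n2 := sub_ne_zero_of_im (u := u) im2
    have a2 : 2 * u / ((u : ℂ) ^ 2 - zetaPole t ^ 2) =
        1 / (u - zetaPole t) + 1 / (u + zetaPole t) := by
      rw [show (u : ℂ) ^ 2 - zetaPole t ^ 2 = (u - zetaPole t) * (u + zetaPole t) by ring]
      field_simp
      ring
    have c1 : (1 / 2 + u + t * I : ℂ) - 1 = u - zetaPole t := by simp [zetaPole]; ring
    have c2 : (1 / 2 + u - t * I : ℂ) = u + zetaPole t := by simp [zetaPole]; ring
    have c3 : (1 / 2 - u + t * I : ℂ) = -(1 / 2 + u - t * I - 1) := by ring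
    have c4 : ((starRingEnd ℂ) (1 / 2 + u + t * I)) = 1 / 2 + u - t * I := conj_half_add u t
    rw [gammaPart, a1, a2, c1, c3, div_neg]
    simp only [map_add, map_div₀, map_one]
    rw [show conj ((u : ℂ) - zetaPole t) = 1 / 2 + u - t * I - 1 by rw [← c1, map_sub, c4, map_one]]
    have c5 : ((starRingEnd ℂ) 1 / (starRingEnd ℂ) 2 + (starRingEnd ℂ) (u : ℂ) +
      (starRingEnd ℂ) (t * I)) = u + zetaPole t := by
      rw [← c2, ← c4]; simp
    simp only [map_one] at c5
    rw [c5]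
    ring
  rw [e, e2]
  exact h

open ArithmeticFunction in
/-- The symmetrized explicit formula for `ζ'/ζ`. -/
theorem symmetrized_explicit_formula (hRH : RiemannHypothesis) {u t X : ℝ} (hu : 0 < u) (ht : t ≠ 0)
    (hX : 0 ≤ X) :
    logDeriv riemannZeta (1 / 2 + u + t * I) * exp (u * X) +
      conj (logDeriv riemannZeta (1 / 2 + u + t * I)) * exp (-u * X) =
      -∑' m : ℕ, (Λ m : ℂ) * exp (-(1 / 2 + t * I) * Real.log m) *
        (if Real.log m ≤ X then exp (u * (X - Real.log m)) - exp (-u * (X - Real.log m)) else 0)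
      + ∑' ρ : NontrivialZero, ((ρ.mult * (2 * u / (u ^ 2 + (ρ.ordinate - t) ^ 2)) : ℝ) : ℂ) *
          exp ((ρ.ordinate - t : ℝ) * I * X)
      - gammaPart u t * exp (-u * X)
      + ∑' k : ℕ, 2 * u / ((u : ℂ) ^ 2 - trivialPole t k ^ 2) * exp (trivialPole t k * X)
      - 2 * u / ((u : ℂ) ^ 2 - zetaPole t ^ 2) * exp (zetaPole t * X) := by
  have h := explicit_formula hRH hu ht hX
  have hre : (1 / 2 + u + t * I : ℂ).re = 1 / 2 + u := by simp
  have hq := hasSum_re_logDeriv_xi hRH hu (t := t)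
  rw [logDeriv_xi_eq (by rw [hre]; linarith) (fun h => ht (by simpa using congrArg im h))
    (zeta_ne_zero_of_RH hRH (by rw [hre]; linarith))] at hq
  have s1 : Summable fun ρ : NontrivialZero =>
      ((ρ.mult * (2 * u / (u ^ 2 + (ρ.ordinate - t) ^ 2)) : ℝ) : ℂ) :=
    Complex.hasSum_ofReal.2 hq |>.summable
  have s2 : Summable fun ρ : NontrivialZero =>
      ((ρ.mult * (2 * u / (u ^ 2 + (ρ.ordinate - t) ^ 2)) : ℝ) : ℂ) *
          exp ((ρ.ordinate - t : ℝ) * I * X) := by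
    refine Summable.of_norm_bounded hq.summable fun ρ => ?_
    rw [norm_mul, norm_real, Real.norm_of_nonneg (by positivity),
      show ((ρ.ordinate - t : ℝ) : ℂ) * I * X = ((ρ.ordinate - t) * X : ℝ) * I by push_cast; ring,
      norm_exp_ofReal_mul_I, mul_one]
  have s3 : Summable fun k : ℕ => 2 * u / ((u : ℂ) ^ 2 - trivialPole t k ^ 2) :=
    (summable_trivial_weight hu ht).of_norm
  have s4 : Summable fun k : ℕ => 2 * u / ((u : ℂ) ^ 2 - trivialPole t k ^ 2) *
      exp (trivialPole t k * X) := by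
    refine Summable.of_norm_bounded (summable_trivial_weight hu ht) fun k => ?_
    rw [norm_mul, norm_exp]
    refine mul_le_of_le_one_right (norm_nonneg _) (Real.exp_le_one_iff.2 ?_)
    have hk : (0 : ℝ) ≤ k := by positivity
    rw [re_mul_ofReal]
    refine mul_nonpos_of_nonpos_of_nonneg ?_ hX
    simp [trivialPole]
    linarith
  have e1 : ∑' ρ : NontrivialZero, (ρ.mult : ℂ) * ((2 * u / (u ^ 2 + (ρ.ordinate - t) ^ 2) : ℝ) *
          (exp ((ρ.ordinate - t : ℝ) * I * X) - exp (-u * X))) =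
      ∑' ρ : NontrivialZero, ((ρ.mult * (2 * u / (u ^ 2 + (ρ.ordinate - t) ^ 2)) : ℝ) : ℂ) *
          exp ((ρ.ordinate - t : ℝ) * I * X) -
      (∑' ρ : NontrivialZero, ((ρ.mult * (2 * u / (u ^ 2 + (ρ.ordinate - t) ^ 2)) : ℝ) : ℂ)) *
        exp (-u * X) := by
    rw [← tsum_mul_right, ← s2.tsum_sub (s1.mul_right _)]
    refine tsum_congr fun ρ => ?_
    push_cast
    ring
  have e2 : ∑' k : ℕ, 2 * u / ((u : ℂ) ^ 2 - trivialPole t k ^ 2) *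
          (exp (trivialPole t k * X) - exp (-u * X)) =
      ∑' k : ℕ, 2 * u / ((u : ℂ) ^ 2 - trivialPole t k ^ 2) * exp (trivialPole t k * X) -
      (∑' k : ℕ, 2 * u / ((u : ℂ) ^ 2 - trivialPole t k ^ 2)) * exp (-u * X) := by
    rw [← tsum_mul_right, ← s4.tsum_sub (s3.mul_right _)]
    exact tsum_congr fun ρ => by ring
  rw [e1, e2, ← ofReal_tsum, hq.tsum_eq] at h
  have a1 : ∀ z : ℂ, ((2 * z.re : ℝ) : ℂ) = z + conj z := fun z => (add_conj z).symm
  rw [gammaPart]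
  -- The e^{-uX} part of the zero sum is 2 Re ξ'/ξ. Its share from ζ, z + conj z, turns the term -z
  -- e^{-uX} into conj(z) e^{-uX}.
  rw [add_re (_ + _ + _), mul_add, ofReal_add, a1 (logDeriv riemannZeta _)] at h
  linear_combination h

end ZetaArgument

end

/-! ### Bounds for ζ'/ζ to the right of the critical line. -/

noncomputable section

namespace ZetaArgument

open Complex Set Filter Topology MeasureTheory ComplexConjugate

/-- The logarithmic derivative of `(s - 1) ζ(s)`. -/
def regLogDeriv (s : ℂ) : ℂ := logDeriv xi s - 1 / s - logDeriv Gammaℝ s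

lemma logDeriv_zeta_eq_reg {s : ℂ} (hs : 0 < s.re) (h1 : s ≠ 1) (hζ : riemannZeta s ≠ 0) :
    logDeriv riemannZeta s = regLogDeriv s - 1 / (s - 1) := by
  rw [regLogDeriv, logDeriv_xi_eq hs h1 hζ]
  ring

/-- Writing the function through ξ makes it holomorphic at s = 1 as well, so Cauchy's theorem can be
used on rectangles touching the real axis. -/
lemma differentiableOn_regLogDeriv (hRH : RiemannHypothesis) :
    DifferentiableOn ℂ regLogDeriv {s | 1 / 2 < s.re} := by
  intro s hs
  have hs : 1 / 2 < s.re := hs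
  have h0 : s ≠ 0 := fun h => by rw [h] at hs; norm_num at hs
  have hx : DifferentiableAt ℂ (logDeriv xi) s :=
    ((differentiable_xi.analyticAt s).deriv.differentiableAt).div (differentiable_xi s)
      (xi_ne_zero_of_RH hRH hs.ne')
  have hG : DifferentiableAt ℂ (logDeriv Gammaℝ) s :=
    ((analyticAt_Gammaℝ (by linarith)).deriv.differentiableAt).div (differentiableAt_Gammaℝ (by linarith))
      (Gammaℝ_ne_zero_of_re_pos (by linarith))
  exact ((hx.sub ((differentiableAt_const _).div differentiableAt_id h0)).sub hG).differentiableWithinAt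

lemma regLogDeriv_conj {s : ℂ} (hs : 0 < s.re) : regLogDeriv (conj s) = conj (regLogDeriv s) := by
  rw [regLogDeriv, regLogDeriv, logDeriv_xi_conj hs, logDeriv_Gammaℝ_conj hs]
  simp

lemma continuousAt_logDeriv_zeta {s : ℂ} (h1 : s ≠ 1) (hζ : riemannZeta s ≠ 0) :
    ContinuousAt (logDeriv riemannZeta) s := by
  have ha : AnalyticAt ℂ riemannZeta s := by
    have hd : DifferentiableOn ℂ riemannZeta {1}ᶜ := fun z hz =>
      (differentiableAt_riemannZeta hz).differentiableWithinAt
    exact hd.analyticAt (isOpen_compl_singleton.mem_nhds h1)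
  exact (ha.deriv.continuousAt).div ha.continuousAt hζ

/-- Only m ≥ 2 contribute, and there log m ≥ 1/2. Hence m^{-σ} ≤ m^{-3/2} e^{-(σ - 3/2)/2}, and
e^{3/4} goes into the constant. -/
lemma exists_norm_logDeriv_zeta_le_exp :
    ∃ C : ℝ, 0 ≤ C ∧ ∀ s : ℂ, 2 ≤ s.re → ‖logDeriv riemannZeta s‖ ≤ C * Real.exp (-s.re / 2) := by
  have hs := summable_vonMangoldt_rpow (a := 3 / 2) (by norm_num)
  have h0 : ∀ m : ℕ, 0 ≤ ArithmeticFunction.vonMangoldt m * Real.exp (-(3 / 2) * Real.log m) := fun m =>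
    mul_nonneg ArithmeticFunction.vonMangoldt_nonneg (Real.exp_nonneg _)
  refine ⟨(∑' m : ℕ, ArithmeticFunction.vonMangoldt m * Real.exp (-(3 / 2) * Real.log m)) *
    Real.exp (3 / 4), mul_nonneg (tsum_nonneg h0) (Real.exp_nonneg _), fun s h2 => ?_⟩
  rw [← norm_neg, ← tsum_vonMangoldt (by linarith), mul_assoc, ← Real.exp_add]
  refine tsum_of_norm_bounded (hs.hasSum.mul_right _) fun m => ?_
  rw [norm_mul, norm_real, Real.norm_of_nonneg ArithmeticFunction.vonMangoldt_nonneg, norm_exp,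
    re_mul_ofReal, neg_re, mul_assoc]
  rcases lt_or_ge m 2 with hm | hm
  · have : m = 0 ∨ m = 1 := by omega
    rcases this with rfl | rfl <;> simp
  · refine mul_le_mul_of_nonneg_left ?_ ArithmeticFunction.vonMangoldt_nonneg
    rw [← Real.exp_add]
    refine Real.exp_le_exp.2 ?_
    have hl : 1 / 2 ≤ Real.log m := by
      have h1 := Real.log_two_gt_d9
      have h2 : Real.log 2 ≤ Real.log m := Real.log_le_log two_pos (by exact_mod_cast hm)
      linarith
    nlinarith

/-- Partial fractions relative to the point 3. As |3 - ρ| ≤ B + |w - ρ|, each difference is at most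
|3 - ρ|^{-2} (B + B²/|w - ρ|). The weights are summable and free of w, and only the singularities
1/|w - ρ| depend on w. -/
lemma exists_norm_logDeriv_zeta_add_le (hRH : RiemannHypothesis) (T : ℝ) (hT : 0 ≤ T) :
    ∃ C : ℝ, 0 ≤ C ∧ ∀ w : ℂ, 1 / 2 < w.re → w.re ≤ 2 → |w.im| ≤ T → w ≠ 1 →
      ‖logDeriv riemannZeta w + 1 / (w - 1)‖ ≤
        C * (1 + ∑' ρ : NontrivialZero, (ρ.mult : ℝ) / ‖3 - ρ.1‖ ^ 2 * (1 / ‖w - ρ.1‖)) := by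
  have hx3 : xi 3 ≠ 0 := xi_ne_zero_of_one_le_re (by norm_num)
  have hb := summable_mult_div_sq hx3
  set b : NontrivialZero → ℝ := fun ρ => (ρ.mult : ℝ) / ‖3 - ρ.1‖ ^ 2 with hbdef
  set B : ℝ := 3 + T with hB
  have hB0 : 0 ≤ B := by positivity
  have hb0 : ∀ ρ, 0 ≤ b ρ := fun ρ => by positivity
  set K : ℝ := ‖logDeriv riemannZeta 3 + 1 / (3 - 1)‖ + B * (∑' ρ, b ρ) +
    B * ∑' k : ℕ, 1 / ((k : ℝ) + 1) ^ 2 with hK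
  have hs0 : 0 ≤ ∑' ρ, b ρ := tsum_nonneg hb0
  have hk0 : 0 ≤ ∑' k : ℕ, 1 / ((k : ℝ) + 1) ^ 2 := tsum_nonneg fun k => by positivity
  have hK0 : 0 ≤ K := by positivity
  refine ⟨K + B * B, by positivity, fun w h1 h2 h3 hw => ?_⟩
  have hP := logDeriv_zeta_sub hRH (s := 3) (w := w) (by norm_num) h1 (by norm_num) hw
  have hw3 : ‖3 - w‖ ≤ B := by
    refine (norm_le_abs_re_add_abs_im _).trans ?_
    simp only [sub_re, sub_im, re_ofNat, im_ofNat, zero_sub, abs_neg]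
    rw [abs_of_nonneg (by linarith)]
    linarith
  have hne : ∀ ρ : NontrivialZero, 0 < ‖w - ρ.1‖ := fun ρ => by
    refine norm_pos_iff.2 fun h => ?_
    have := congrArg re h
    rw [sub_re, ρ.re_eq hRH, zero_re] at this
    linarith
  have hne3 : ∀ ρ : NontrivialZero, 0 < ‖3 - ρ.1‖ := fun ρ => by
    refine norm_pos_iff.2 fun h => ?_
    have := congrArg re h
    rw [sub_re, ρ.re_eq hRH, zero_re, re_ofNat] at this
    linarith
  have hbw : Summable fun ρ => b ρ * (1 / ‖w - ρ.1‖) := by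
    refine Summable.of_nonneg_of_le (fun ρ => mul_nonneg (hb0 ρ) (by positivity)) (fun ρ => ?_)
      (hb.mul_right (1 / (w.re - 1 / 2)))
    refine mul_le_mul_of_nonneg_left ?_ (hb0 ρ)
    refine one_div_le_one_div_of_le (by linarith) ?_
    have := re_le_norm (w - ρ.1)
    rwa [sub_re, ρ.re_eq hRH] at this
  have z1 : ‖∑' ρ : NontrivialZero, (ρ.mult : ℂ) * (1 / (w - ρ.1) - 1 / (3 - ρ.1))‖ ≤
      B * (∑' ρ, b ρ) + B * B * ∑' ρ, b ρ * (1 / ‖w - ρ.1‖) := by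
    refine tsum_of_norm_bounded ((hb.hasSum.mul_left B).add (hbw.hasSum.mul_left (B * B))) fun ρ => ?_
    have n1 : w - ρ.1 ≠ 0 := norm_pos_iff.1 (hne ρ)
    have n3 : 3 - ρ.1 ≠ 0 := norm_pos_iff.1 (hne3 ρ)
    have e : 1 / (w - ρ.1) - 1 / (3 - ρ.1) = (3 - w) / ((w - ρ.1) * (3 - ρ.1)) := by
      field_simp
      ring
    rw [e, norm_mul, norm_natCast, norm_div, norm_mul]
    have h4 : ‖3 - ρ.1‖ ≤ B + ‖w - ρ.1‖ := by
      calc ‖3 - ρ.1‖ = ‖(3 - w) + (w - ρ.1)‖ := by ring_nf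
        _ ≤ _ := (norm_add_le _ _).trans (by linarith)
    have hp := hne ρ
    have hp3 := hne3 ρ
    calc (ρ.mult : ℝ) * (‖3 - w‖ / (‖w - ρ.1‖ * ‖3 - ρ.1‖))
        ≤ (ρ.mult : ℝ) * (B / (‖w - ρ.1‖ * ‖3 - ρ.1‖)) := by gcongr
      _ = (ρ.mult : ℝ) / ‖3 - ρ.1‖ ^ 2 * (B * (‖3 - ρ.1‖ / ‖w - ρ.1‖)) := by field_simp
      _ ≤ (ρ.mult : ℝ) / ‖3 - ρ.1‖ ^ 2 * (B * ((B + ‖w - ρ.1‖) / ‖w - ρ.1‖)) := by gcongr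
      _ = B * b ρ + B * B * (b ρ * (1 / ‖w - ρ.1‖)) := by
        rw [hbdef]; field_simp; ring
  have z2 : ‖∑' k : ℕ, (1 / (2 * ((k : ℂ) + 1) + w) - 1 / (2 * ((k : ℂ) + 1) + 3))‖ ≤
      B * ∑' k : ℕ, 1 / ((k : ℝ) + 1) ^ 2 := by
    refine tsum_of_norm_bounded (summable_one_div_add_one_sq.hasSum.mul_left B) fun k => ?_
    have hk : (0 : ℝ) ≤ k := by positivity
    have a1 : (k : ℝ) + 1 ≤ ‖2 * ((k : ℂ) + 1) + w‖ := by
      refine le_trans ?_ (re_le_norm _)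
      simp; linarith
    have a2 : (k : ℝ) + 1 ≤ ‖2 * ((k : ℂ) + 1) + 3‖ := by
      refine le_trans ?_ (re_le_norm _)
      simp; linarith
    have n1 : 2 * ((k : ℂ) + 1) + w ≠ 0 := norm_pos_iff.1 (by linarith)
    have n2 : 2 * ((k : ℂ) + 1) + 3 ≠ 0 := norm_pos_iff.1 (by linarith)
    have e : 1 / (2 * ((k : ℂ) + 1) + w) - 1 / (2 * ((k : ℂ) + 1) + 3) =
        (3 - w) / ((2 * ((k : ℂ) + 1) + w) * (2 * ((k : ℂ) + 1) + 3)) := by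
      field_simp
      ring
    rw [e, norm_div, norm_mul]
    calc ‖3 - w‖ / (‖2 * ((k : ℂ) + 1) + w‖ * ‖2 * ((k : ℂ) + 1) + 3‖)
        ≤ B / (((k : ℝ) + 1) * ((k : ℝ) + 1)) := by gcongr
      _ = B * (1 / ((k : ℝ) + 1) ^ 2) := by field_simp
  have hQ : 0 ≤ ∑' ρ, b ρ * (1 / ‖w - ρ.1‖) := tsum_nonneg fun ρ => mul_nonneg (hb0 ρ) (by positivity)
  have e : logDeriv riemannZeta w + 1 / (w - 1) = (logDeriv riemannZeta 3 + 1 / (3 - 1)) +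
      ∑' ρ : NontrivialZero, (ρ.mult : ℂ) * (1 / (w - ρ.1) - 1 / (3 - ρ.1)) +
      ∑' k : ℕ, (1 / (2 * ((k : ℂ) + 1) + w) - 1 / (2 * ((k : ℂ) + 1) + 3)) := by
    linear_combination hP
  rw [e]
  refine (norm_add₃_le).trans ?_
  have : (K + B * B) * (1 + ∑' ρ, b ρ * (1 / ‖w - ρ.1‖)) =
      K + B * B * ∑' ρ, b ρ * (1 / ‖w - ρ.1‖) + (B * B + K * ∑' ρ, b ρ * (1 / ‖w - ρ.1‖)) := by ring
  change _ ≤ (K + B * B) * (1 + ∑' ρ, b ρ * (1 / ‖w - ρ.1‖))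
  rw [this]
  have h5 : 0 ≤ B * B + K * ∑' ρ, b ρ * (1 / ‖w - ρ.1‖) := by positivity
  linarith

end ZetaArgument

end

/-! ### Integrability of u^n ζ'/ζ in one and two variables. -/

noncomputable section

namespace ZetaArgument

open Complex Set Filter Topology MeasureTheory ComplexConjugate
open scoped ENNReal

/-- Under RH every zero is at distance at least u; `t` itself may be an ordinate. -/
lemma exists_norm_logDeriv_zeta_le_div (hRH : RiemannHypothesis) {t : ℝ} (ht : 0 < t) :
    ∃ C : ℝ, 0 ≤ C ∧ ∀ u : ℝ, 0 < u → u ≤ 3 / 2 →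
      ‖logDeriv riemannZeta (1 / 2 + u + t * I)‖ ≤ C / u := by
  obtain ⟨C, hC, h⟩ := exists_norm_logDeriv_zeta_add_le hRH t ht.le
  have hx3 : xi 3 ≠ 0 := xi_ne_zero_of_one_le_re (by norm_num)
  have hb := summable_mult_div_sq hx3
  set Q := ∑' ρ : NontrivialZero, (ρ.mult : ℝ) / ‖3 - ρ.1‖ ^ 2
  have hQ : 0 ≤ Q := tsum_nonneg fun ρ => by positivity
  refine ⟨C * (3 / 2 + Q) + 3 / (2 * t), by positivity, fun u hu hu2 => ?_⟩
  set w : ℂ := 1 / 2 + u + t * I with hw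
  have hre : w.re = 1 / 2 + u := by simp [hw]
  have him : w.im = t := by simp [hw]
  have h1 := h w (by linarith) (by linarith) (by rw [him, abs_of_pos ht])
    (fun h => ht.ne' (by simpa [him] using congrArg im h))
  have h2 : ∑' ρ : NontrivialZero, (ρ.mult : ℝ) / ‖3 - ρ.1‖ ^ 2 * (1 / ‖w - ρ.1‖) ≤ Q * (1 / u) := by
    have hle : ∀ ρ : NontrivialZero, (ρ.mult : ℝ) / ‖3 - ρ.1‖ ^ 2 * (1 / ‖w - ρ.1‖) ≤
        (ρ.mult : ℝ) / ‖3 - ρ.1‖ ^ 2 * (1 / u) := fun ρ => by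
      refine mul_le_mul_of_nonneg_left (one_div_le_one_div_of_le hu ?_) (by positivity)
      have := re_le_norm (w - ρ.1)
      rw [sub_re, ρ.re_eq hRH, hre] at this
      linarith
    rw [← tsum_mul_right]
    exact (Summable.of_nonneg_of_le (fun ρ => by positivity) hle (hb.mul_right _)).tsum_le_tsum hle
      (hb.mul_right _)
  have h3 : ‖1 / (w - 1)‖ ≤ 1 / t := by
    rw [norm_div, norm_one]
    refine one_div_le_one_div_of_le ht ?_
    have := (le_abs_self _).trans (abs_im_le_norm (w - 1))
    simpa [him] using this
  have h4 : ‖logDeriv riemannZeta w‖ ≤ ‖logDeriv riemannZeta w + 1 / (w - 1)‖ + ‖1 / (w - 1)‖ := by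
    have := norm_sub_le (logDeriv riemannZeta w + 1 / (w - 1)) (1 / (w - 1))
    rwa [add_sub_cancel_right] at this
  calc ‖logDeriv riemannZeta w‖ ≤ C * (1 + Q * (1 / u)) + 1 / t := by
        refine h4.trans (add_le_add (h1.trans ?_) h3)
        gcongr
    _ = C * (1 + Q * (1 / u)) + 1 / t * 1 := by ring
    _ ≤ C * (3 / 2 * (1 / u) + Q * (1 / u)) + 1 / t * (3 / 2 * (1 / u)) := by
        have : 1 ≤ 3 / 2 * (1 / u) := by
          rw [mul_one_div, le_div_iff₀ hu]; linarith
        gcongr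
    _ = _ := by field_simp

lemma continuousOn_logDeriv_zeta_line (hRH : RiemannHypothesis) {t : ℝ} (ht : t ≠ 0) :
    ContinuousOn (fun u : ℝ => logDeriv riemannZeta (1 / 2 + u + t * I)) (Ioi 0) := by
  intro u hu
  have hu : 0 < u := hu
  refine ContinuousAt.continuousWithinAt ?_
  have h := continuousAt_logDeriv_zeta (s := 1 / 2 + u + t * I)
    (fun h => ht (by simpa using congrArg im h)) (zeta_ne_zero_of_RH hRH (by simp [hu]))
  exact h.comp (f := fun u : ℝ => (1 / 2 + u + t * I : ℂ)) (by fun_prop)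

lemma integrableOn_pow_mul_exp (n : ℕ) : IntegrableOn (fun u : ℝ => u ^ n * Real.exp (-u / 2)) (Ioi 0) := by
  have h := integrableOn_rpow_mul_exp_neg_mul_rpow (p := 1) (s := n) (b := 1 / 2)
    (by have : (0 : ℝ) ≤ n := by positivity
        linarith) one_pos (by norm_num)
  refine h.congr_fun (fun u _ => ?_) measurableSet_Ioi
  simp only [Real.rpow_natCast, Real.rpow_one]
  ring_nf

/-- The condition n ≥ 1 absorbs the possible singularity 1/u at u = 0; at infinity ζ'/ζ decays
exponentially. -/
lemma integrableOn_pow_mul_logDeriv_zeta (hRH : RiemannHypothesis) {t : ℝ} (ht : 0 < t) {n : ℕ}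
    (hn : 1 ≤ n) :
    IntegrableOn (fun u : ℝ => (u : ℂ) ^ n * logDeriv riemannZeta (1 / 2 + u + t * I)) (Ioi 0) := by
  obtain ⟨C, hC, hnear⟩ := exists_norm_logDeriv_zeta_le_div hRH ht
  obtain ⟨D, hD, hfar⟩ := exists_norm_logDeriv_zeta_le_exp
  have hm : AEStronglyMeasurable (fun u : ℝ => (u : ℂ) ^ n *
      logDeriv riemannZeta (1 / 2 + u + t * I)) (volume.restrict (Ioi 0)) :=
    ContinuousOn.aestronglyMeasurable ((by fun_prop : Continuous fun u : ℝ => (u : ℂ) ^ n).continuousOn.mul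
      (continuousOn_logDeriv_zeta_line hRH ht.ne')) measurableSet_Ioi
  rw [← Ioc_union_Ioi_eq_Ioi (by norm_num : (0 : ℝ) ≤ 3 / 2)]
  refine IntegrableOn.union ?_ ?_
  · refine Integrable.mono' (g := fun _ => C * (3 / 2) ^ (n - 1)) (integrableOn_const measure_Ioc_lt_top.ne)
      (hm.mono_measure (Measure.restrict_mono Ioc_subset_Ioi_self le_rfl)) ?_
    refine (ae_restrict_iff' measurableSet_Ioc).2 (Eventually.of_forall fun u hu => ?_)
    have h := hnear u hu.1 hu.2
    have hu0 := hu.1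
    obtain ⟨m, rfl⟩ : ∃ m, n = m + 1 := ⟨n - 1, by omega⟩
    rw [norm_mul, norm_pow, norm_real, Real.norm_of_nonneg hu0.le]
    calc u ^ (m + 1) * _ ≤ u ^ (m + 1) * (C / u) := by gcongr
      _ = C * u ^ m := by rw [pow_succ]; field_simp
      _ ≤ _ := by
        rw [Nat.add_sub_cancel]
        have := hu.2
        gcongr
  · refine Integrable.mono' (g := fun u => D * (u ^ n * Real.exp (-u / 2)))
      (((integrableOn_pow_mul_exp n).mono_set (Ioi_subset_Ioi (by norm_num))).const_mul D)
      (hm.mono_measure (Measure.restrict_mono (Ioi_subset_Ioi (by norm_num)) le_rfl)) ?_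
    refine (ae_restrict_iff' measurableSet_Ioi).2 (Eventually.of_forall fun u hu => ?_)
    have hu : 3 / 2 < u := hu
    have h := hfar (1 / 2 + u + t * I) (by simp; linarith)
    have hre : (1 / 2 + u + t * I : ℂ).re = 1 / 2 + u := by simp
    rw [norm_mul, norm_pow, norm_real, Real.norm_of_nonneg (by linarith)]
    calc u ^ n * _ ≤ u ^ n * (D * Real.exp (-u / 2)) := by
          have hu0 : 0 ≤ u := by linarith
          gcongr
          refine h.trans ?_
          rw [hre]
          gcongr
          linarith
      _ = _ := by ring

/-- The weight `|x|^{-1/2}`, infinite at zero. -/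
def invSqrt (x : ℝ) : ℝ≥0∞ := ‖x‖ₑ ^ (-(1 / 2) : ℝ)

lemma measurable_invSqrt : Measurable invSqrt := by unfold invSqrt; fun_prop

/-- Separates the variables: 1/|z| is at most |Re z|^{-1/2} |Im z|^{-1/2}, so integrals over
rectangles split into one-dimensional ones. -/
lemma enorm_inv_le (z : ℂ) : ‖z‖ₑ⁻¹ ≤ invSqrt z.re * invSqrt z.im := by
  have h1 : ‖z.re‖ₑ ≤ ‖z‖ₑ := enorm_le_iff_norm_le.2 (by simpa using abs_re_le_norm z)
  have h2 : ‖z.im‖ₑ ≤ ‖z‖ₑ := enorm_le_iff_norm_le.2 (by simpa using abs_im_le_norm z)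
  by_cases hz : z = 0
  · simp [hz, invSqrt]
  have h0 : ‖z‖ₑ ≠ 0 := by simpa using hz
  calc ‖z‖ₑ⁻¹ = ‖z‖ₑ ^ (-(1 / 2) : ℝ) * ‖z‖ₑ ^ (-(1 / 2) : ℝ) := by
        rw [← ENNReal.rpow_add _ _ h0 enorm_ne_top, ← ENNReal.rpow_neg_one]
        norm_num
    _ ≤ _ := by
        refine mul_le_mul' ?_ ?_
        · rw [invSqrt, ENNReal.rpow_neg, ENNReal.rpow_neg]
          exact ENNReal.inv_le_inv.2 (ENNReal.rpow_le_rpow h1 (by norm_num))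
        · rw [invSqrt, ENNReal.rpow_neg, ENNReal.rpow_neg]
          exact ENNReal.inv_le_inv.2 (ENNReal.rpow_le_rpow h2 (by norm_num))

lemma lintegral_invSqrt_lt_top : ∫⁻ x in Icc (-1 : ℝ) 1, invSqrt x < ∞ := by
  have hpos : ∫⁻ x in Ioc (0 : ℝ) 1, invSqrt x < ∞ := by
    have h := (intervalIntegral.intervalIntegrable_rpow' (a := 0) (b := 1) (r := -(1 / 2))
      (by norm_num)).1
    refine lt_of_le_of_lt (le_of_eq ?_) h.2
    refine setLIntegral_congr_fun measurableSet_Ioc fun x hx => ?_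
    simp only [invSqrt]
    rw [Real.enorm_of_nonneg hx.1.le, Real.enorm_of_nonneg (Real.rpow_nonneg hx.1.le _),
      ENNReal.ofReal_rpow_of_pos hx.1]
  have hneg : ∫⁻ x in Ico (-1 : ℝ) 0, invSqrt x < ∞ := by
    refine lt_of_le_of_lt (le_of_eq ?_) hpos
    have := (Measure.measurePreserving_neg (volume : Measure ℝ)).setLIntegral_comp_preimage
      (s := Ioc 0 1) measurableSet_Ioc measurable_invSqrt
    rw [← this]
    simp [invSqrt]
  have hsub : Icc (-1 : ℝ) 1 ⊆ Ico (-1 : ℝ) 0 ∪ ({0} ∪ Ioc 0 1) := by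
    intro x hx
    rcases lt_trichotomy x 0 with h | h | h
    · exact Or.inl ⟨hx.1, h⟩
    · exact Or.inr (Or.inl h)
    · exact Or.inr (Or.inr ⟨h, hx.2⟩)
  refine (lintegral_mono_set hsub).trans_lt ((lintegral_union_le _ _ _).trans_lt ?_)
  refine ENNReal.add_lt_top.2 ⟨hneg, (lintegral_union_le _ _ _).trans_lt
    (ENNReal.add_lt_top.2 ⟨by simp, hpos⟩)⟩

/-- Uniformity in the shift `a` matters: one constant serves all ordinates. -/
lemma exists_lintegral_invSqrt_sub_le (T : ℝ) :
    ∃ K : ℝ≥0∞, K < ∞ ∧ ∀ a : ℝ, ∫⁻ x in Ioc 0 T, invSqrt (x - a) ≤ K := by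
  refine ⟨(∫⁻ x in Icc (-1 : ℝ) 1, invSqrt x) + volume (Ioc 0 T),
    ENNReal.add_lt_top.2 ⟨lintegral_invSqrt_lt_top, by simp⟩, fun a => ?_⟩
  have hle : ∀ x : ℝ, invSqrt x ≤ indicator (Icc (-1) 1) invSqrt x + 1 := fun x => by
    by_cases hx : x ∈ Icc (-1 : ℝ) 1
    · rw [indicator_of_mem hx]; exact le_self_add
    · rw [indicator_of_notMem hx, zero_add]
      have h1 : 1 ≤ ‖x‖ₑ := by
        rw [← enorm_one (G := ℝ)]
        refine enorm_le_iff_norm_le.2 ?_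
        rw [norm_one, Real.norm_eq_abs]
        by_contra h
        exact hx (abs_le.1 (not_le.1 h).le)
      exact ENNReal.rpow_le_one_of_one_le_of_neg h1 (by norm_num)
  calc ∫⁻ x in Ioc 0 T, invSqrt (x - a)
      ≤ ∫⁻ x in Ioc 0 T, (indicator (Icc (-1) 1) invSqrt (x - a) + 1) := lintegral_mono fun x => hle _
    _ = (∫⁻ x in Ioc 0 T, indicator (Icc (-1) 1) invSqrt (x - a)) + volume (Ioc 0 T) := by
        rw [lintegral_add_right _ measurable_const]; simp
    _ ≤ _ := by
        refine add_le_add ?_ le_rfl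
        refine (setLIntegral_le_lintegral _ _).trans ?_
        rw [lintegral_sub_right_eq_self (fun x => indicator (Icc (-1) 1) invSqrt x) a,
          lintegral_indicator measurableSet_Icc]

lemma continuousOn_logDeriv_zeta_prod (hRH : RiemannHypothesis) :
    ContinuousOn (fun p : ℝ × ℝ => logDeriv riemannZeta (1 / 2 + p.1 + p.2 * I)) (Ioi 0 ×ˢ Ioi 0) := by
  rintro ⟨u, τ⟩ ⟨hu, hτ⟩
  have hu : 0 < u := hu
  have hτ : 0 < τ := hτ
  refine ContinuousAt.continuousWithinAt ?_
  have h := continuousAt_logDeriv_zeta (s := 1 / 2 + u + τ * I)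
    (fun h => hτ.ne' (by simpa using congrArg im h)) (zeta_ne_zero_of_RH hRH (by simp [hu]))
  exact h.comp (f := fun p : ℝ × ℝ => (1 / 2 + p.1 + p.2 * I : ℂ)) (x := (u, τ)) (by fun_prop)

/-- Summability need not be assumed: a divergent real series has `tsum` zero, and the inequality is
then trivial. -/
lemma ofReal_tsum_mul_le {ι : Type*} {b c : ι → ℝ} {d : ι → ℝ≥0∞} (hb : ∀ i, 0 ≤ b i)
    (hc : ∀ i, 0 ≤ c i) (h : ∀ i, ENNReal.ofReal (c i) ≤ d i) :
    ENNReal.ofReal (∑' i, b i * c i) ≤ ∑' i, ENNReal.ofReal (b i) * d i := by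
  by_cases hsum : Summable fun i => b i * c i
  · rw [ENNReal.ofReal_tsum_of_nonneg (fun i => mul_nonneg (hb i) (hc i)) hsum]
    refine ENNReal.tsum_le_tsum fun i => ?_
    rw [ENNReal.ofReal_mul (hb i)]
    exact mul_le_mul' le_rfl (h i)
  · rw [tsum_eq_zero_of_not_summable hsum, ENNReal.ofReal_zero]
    exact zero_le

lemma exists_enorm_logDeriv_zeta_le (hRH : RiemannHypothesis) (T : ℝ) (hT : 0 ≤ T) :
    ∃ C : ℝ, 0 ≤ C ∧ ∀ u τ : ℝ, 0 < u → u ≤ 3 / 2 → 0 < τ → τ ≤ T →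
      ‖logDeriv riemannZeta (1 / 2 + u + τ * I)‖ₑ ≤
      ENNReal.ofReal C * (1 + ∑' ρ : NontrivialZero, ENNReal.ofReal ((ρ.mult : ℝ) / ‖3 - ρ.1‖ ^ 2) *
        (invSqrt (u - 0) * invSqrt (τ - ρ.ordinate))) +
        invSqrt (u - 1 / 2) * invSqrt (τ - 0) := by
  obtain ⟨C, hC, h⟩ := exists_norm_logDeriv_zeta_add_le hRH T hT
  refine ⟨C, hC, fun u τ hu hu2 hτ hτT => ?_⟩
  obtain ⟨w, hw⟩ : ∃ w : ℂ, w = 1 / 2 + u + τ * I := ⟨_, rfl⟩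
  rw [← hw]
  have hre : w.re = 1 / 2 + u := by simp [hw]
  have him : w.im = τ := by simp [hw]
  have h1 := h w (by linarith) (by linarith) (by rw [him, abs_of_pos hτ]; exact hτT)
    (fun h => hτ.ne' (by simpa [him] using congrArg im h))
  have h4 : ‖logDeriv riemannZeta w‖ₑ ≤ ‖logDeriv riemannZeta w + 1 / (w - 1)‖ₑ + ‖1 / (w - 1)‖ₑ := by
    have := enorm_sub_le (a := logDeriv riemannZeta w + 1 / (w - 1)) (b := 1 / (w - 1))
    rwa [add_sub_cancel_right] at this
  have hterm : ∀ ρ : NontrivialZero, ENNReal.ofReal (1 / ‖w - ρ.1‖) ≤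
      invSqrt (u - 0) * invSqrt (τ - ρ.ordinate) := fun ρ => by
    have hne : 0 < ‖w - ρ.1‖ := by
      refine norm_pos_iff.2 fun h => ?_
      have := congrArg re h
      rw [sub_re, ρ.re_eq hRH, zero_re] at this
      linarith
    have := enorm_inv_le (w - ρ.1)
    rw [sub_re, sub_im, ρ.re_eq hRH, hre, him, show 1 / 2 + u - 1 / 2 = u - 0 by ring] at this
    refine le_trans (le_of_eq ?_) this
    rw [one_div, ENNReal.ofReal_inv_of_pos hne, ofReal_norm]
  have htop := ofReal_tsum_mul_le (b := fun ρ : NontrivialZero => (ρ.mult : ℝ) / ‖3 - ρ.1‖ ^ 2)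
    (fun ρ => by positivity) (fun ρ => by positivity) hterm
  refine h4.trans (add_le_add ?_ ?_)
  · rw [← ofReal_norm]
    refine (ENNReal.ofReal_le_ofReal h1).trans ?_
    rw [ENNReal.ofReal_mul hC]
    refine mul_le_mul' le_rfl ?_
    refine ENNReal.ofReal_add_le.trans ?_
    rw [ENNReal.ofReal_one]
    exact add_le_add le_rfl htop
  · have := enorm_inv_le (w - 1)
    rw [sub_re, sub_im, one_re, one_im, hre, him, show 1 / 2 + u - 1 = u - 1 / 2 by ring] at this
    rwa [one_div, enorm_inv (by
      intro h; have := congrArg im h; simp [him] at this; exact hτ.ne' this)]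

lemma lintegral_invSqrt_bound_lt_top {ι : Type*} [Countable ι] {b γ : ι → ℝ} (hb0 : ∀ i, 0 ≤ b i)
    (hb : Summable b) (C T : ℝ) :
    ∫⁻ p in Ioc 0 (3 / 2) ×ˢ Ioc 0 T, (ENNReal.ofReal C * (1 + ∑' i, ENNReal.ofReal (b i) *
      (invSqrt ((p : ℝ × ℝ).1 - 0) * invSqrt (p.2 - γ i))) +
        invSqrt (p.1 - 1 / 2) * invSqrt (p.2 - 0)) < ∞ := by
  obtain ⟨K, hK, hK'⟩ := exists_lintegral_invSqrt_sub_le (3 / 2)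
  obtain ⟨M, hM, hM'⟩ := exists_lintegral_invSqrt_sub_le T
  have hm : ∀ c d : ℝ, Measurable fun p : ℝ × ℝ => invSqrt (p.1 - c) * invSqrt (p.2 - d) := fun c d =>
    (measurable_invSqrt.comp (measurable_fst.sub_const c)).mul
      (measurable_invSqrt.comp (measurable_snd.sub_const d))
  have hI : ∀ c d : ℝ, ∫⁻ p in Ioc 0 (3 / 2) ×ˢ Ioc 0 T, invSqrt ((p : ℝ × ℝ).1 - c) * invSqrt (p.2 - d) ≤ K * M :=
    fun c d => by
    rw [Measure.volume_eq_prod, ← Measure.prod_restrict,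
      lintegral_prod_mul (f := fun x => invSqrt (x - c)) (g := fun x => invSqrt (x - d))
      (measurable_invSqrt.comp (measurable_id.sub_const c)).aemeasurable
      (measurable_invSqrt.comp (measurable_id.sub_const d)).aemeasurable]
    exact mul_le_mul' (hK' c) (hM' d)
  rw [lintegral_add_right _ (hm _ _), lintegral_const_mul' _ _ ENNReal.ofReal_ne_top,
    lintegral_add_left measurable_const, lintegral_tsum fun i => ((hm 0 (γ i)).const_mul _).aemeasurable]
  have hKM : K * M < ∞ := ENNReal.mul_lt_top hK hM
  refine ENNReal.add_lt_top.2 ⟨ENNReal.mul_lt_top ENNReal.ofReal_lt_top (ENNReal.add_lt_top.2 ⟨?_, ?_⟩),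
    (hI _ _).trans_lt hKM⟩
  · rw [Measure.volume_eq_prod, ← Measure.prod_restrict]
    simp
  · calc _ ≤ ∑' i, ENNReal.ofReal (b i) * (K * M) := by
          refine ENNReal.tsum_le_tsum fun i => ?_
          rw [lintegral_const_mul _ (hm _ _)]
          exact mul_le_mul' le_rfl (hI _ _)
      _ = ENNReal.ofReal (∑' i, b i) * (K * M) := by
          rw [ENNReal.tsum_mul_right, ENNReal.ofReal_tsum_of_nonneg hb0 hb]
      _ < ∞ := ENNReal.mul_lt_top ENNReal.ofReal_lt_top hKM

lemma lintegral_logDeriv_zeta_lt_top (hRH : RiemannHypothesis) (T : ℝ) (hT : 0 ≤ T) :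
    ∫⁻ p in Ioc 0 (3 / 2) ×ˢ Ioc 0 T, ‖logDeriv riemannZeta (1 / 2 + (p : ℝ × ℝ).1 + p.2 * I)‖ₑ < ∞ := by
  obtain ⟨C, -, hle⟩ := exists_enorm_logDeriv_zeta_le hRH T hT
  exact (setLIntegral_mono' (measurableSet_Ioc.prod measurableSet_Ioc)
    fun p hp => hle p.1 p.2 hp.1.1 hp.1.2 hp.2.1 hp.2.2).trans_lt
    (lintegral_invSqrt_bound_lt_top (γ := NontrivialZero.ordinate) (fun ρ => by positivity)
      (summable_mult_div_sq (xi_ne_zero_of_one_le_re (by norm_num))) C T)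

/-- Here n = 0 is allowed, because singularities of type 1/|w - ρ| are integrable in the plane. -/
lemma integrableOn_pow_mul_logDeriv_zeta_prod (hRH : RiemannHypothesis) (T : ℝ) (hT : 0 ≤ T) (n : ℕ) :
    IntegrableOn (fun p : ℝ × ℝ => (p.1 : ℂ) ^ n * logDeriv riemannZeta (1 / 2 + p.1 + p.2 * I))
      (Ioi 0 ×ˢ Ioc 0 T) := by
  obtain ⟨D, hD, hfar⟩ := exists_norm_logDeriv_zeta_le_exp
  have hZ : AEStronglyMeasurable (fun p : ℝ × ℝ =>
      logDeriv riemannZeta (1 / 2 + p.1 + p.2 * I)) (volume.restrict (Ioi 0 ×ˢ Ioc 0 T)) :=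
    ContinuousOn.aestronglyMeasurable ((continuousOn_logDeriv_zeta_prod hRH).mono
      (prod_mono Subset.rfl Ioc_subset_Ioi_self)) (measurableSet_Ioi.prod measurableSet_Ioc)
  have hm : AEStronglyMeasurable (fun p : ℝ × ℝ => (p.1 : ℂ) ^ n *
      logDeriv riemannZeta (1 / 2 + p.1 + p.2 * I)) (volume.restrict (Ioi 0 ×ˢ Ioc 0 T)) :=
    (by fun_prop : Continuous fun p : ℝ × ℝ => (p.1 : ℂ) ^ n).aestronglyMeasurable.mul hZ
  have s1 : Ioc (0 : ℝ) (3 / 2) ×ˢ Ioc 0 T ⊆ Ioi 0 ×ˢ Ioc 0 T := prod_mono Ioc_subset_Ioi_self Subset.rfl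
  have s2 : Ioi (3 / 2 : ℝ) ×ˢ Ioc 0 T ⊆ Ioi 0 ×ˢ Ioc 0 T :=
    prod_mono (Ioi_subset_Ioi (by norm_num)) Subset.rfl
  have hu : Ioi (0 : ℝ) ×ˢ Ioc 0 T = (Ioc (0 : ℝ) (3 / 2) ×ˢ Ioc 0 T) ∪ (Ioi (3 / 2 : ℝ) ×ˢ Ioc 0 T) := by
    rw [← union_prod, Ioc_union_Ioi_eq_Ioi (by norm_num : (0 : ℝ) ≤ 3 / 2)]
  have i1 : IntegrableOn (fun p : ℝ × ℝ => (p.1 : ℂ) ^ n * logDeriv riemannZeta (1 / 2 + p.1 + p.2 * I))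
      (Ioc (0 : ℝ) (3 / 2) ×ˢ Ioc 0 T) := by
    refine Integrable.bdd_mul (c := (3 / 2) ^ n)
      ⟨hZ.mono_measure (Measure.restrict_mono s1 le_rfl), lintegral_logDeriv_zeta_lt_top hRH T hT⟩
      (by fun_prop : Continuous fun p : ℝ × ℝ => (p.1 : ℂ) ^ n).aestronglyMeasurable ?_
    refine (ae_restrict_iff' (measurableSet_Ioc.prod measurableSet_Ioc)).2
      (Eventually.of_forall fun p hp => ?_)
    rw [norm_pow, norm_real, Real.norm_of_nonneg hp.1.1.le]
    exact pow_le_pow_left₀ hp.1.1.le hp.1.2 n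
  have i2 : IntegrableOn (fun p : ℝ × ℝ => (p.1 : ℂ) ^ n * logDeriv riemannZeta (1 / 2 + p.1 + p.2 * I))
      (Ioi (3 / 2 : ℝ) ×ˢ Ioc 0 T) := by
    have hg : IntegrableOn (fun p : ℝ × ℝ => D * (p.1 ^ n * Real.exp (-p.1 / 2)))
        (Ioi (3 / 2 : ℝ) ×ˢ Ioc 0 T) := by
      rw [IntegrableOn, Measure.volume_eq_prod, ← Measure.prod_restrict]
      have h1 : Integrable (fun u : ℝ => D * (u ^ n * Real.exp (-u / 2))) (volume.restrict (Ioi (3 / 2))) :=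
        ((integrableOn_pow_mul_exp n).mono_set (Ioi_subset_Ioi (by norm_num))).const_mul D
      exact h1.comp_fst (volume.restrict (Ioc 0 T))
    refine Integrable.mono' hg (hm.mono_measure (Measure.restrict_mono s2 le_rfl)) ?_
    refine (ae_restrict_iff' (measurableSet_Ioi.prod measurableSet_Ioc)).2
      (Eventually.of_forall fun p hp => ?_)
    have hu : 3 / 2 < p.1 := hp.1
    have h := hfar (1 / 2 + p.1 + p.2 * I) (by simp; linarith)
    have hre : (1 / 2 + p.1 + p.2 * I : ℂ).re = 1 / 2 + p.1 := by simp
    rw [norm_mul, norm_pow, norm_real, Real.norm_of_nonneg (by linarith)]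
    calc p.1 ^ n * _ ≤ p.1 ^ n * (D * Real.exp (-p.1 / 2)) := by
          have hu0 : 0 ≤ p.1 := by linarith
          gcongr
          refine h.trans ?_
          rw [hre]
          gcongr
          linarith
      _ = _ := by ring
  rw [hu]
  exact i1.union i2

end ZetaArgument

end

/-! ### A branch of log ζ and vertical integrals of ζ'/ζ. -/

noncomputable section

namespace ZetaArgument

open Complex Set Filter Topology MeasureTheory ComplexConjugate

/-- The product of `f` with exp(-∫g) has derivative zero. `g` is extended constantly beyond the
interval so that its primitive is differentiable at the endpoints. -/
lemma eq_mul_exp_integral {f g : ℝ → ℂ} {a b : ℝ} (hab : a ≤ b)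
    (hf : ∀ x ∈ Icc a b, HasDerivAt f (f x * g x) x) (hg : ContinuousOn g (Icc a b)) :
    f b = f a * exp (∫ x in a..b, g x) := by
  set g' : ℝ → ℂ := IccExtend hab ((Icc a b).domRestrict g) with hg'
  have hc : Continuous g' := (continuousOn_iff_continuous_domRestrict.1 hg).Icc_extend'
  have he : ∀ x ∈ Icc a b, g' x = g x := fun x hx => by
    rw [hg', IccExtend_of_mem _ _ hx]; rfl
  have hφ : ∀ x ∈ Icc a b, HasDerivAt (fun x => f x * exp (-∫ y in a..x, g' y)) 0 x := fun x hx => by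
    have h1 := (hc.integral_hasStrictDerivAt a x).hasDerivAt
    refine ((hf x hx).mul h1.neg.cexp).congr_deriv ?_
    rw [he x hx]
    ring
  have h := constant_of_has_deriv_right_zero (fun x hx => (hφ x hx).continuousAt.continuousWithinAt)
    (fun x hx => (hφ x (Ico_subset_Icc_self hx)).hasDerivWithinAt) b (right_mem_Icc.2 hab)
  simp only [intervalIntegral.integral_same, neg_zero, exp_zero, mul_one] at h
  have hi : ∫ x in a..b, g x = ∫ x in a..b, g' x := by
    refine intervalIntegral.integral_congr fun x hx => ?_
    rw [uIcc_of_le hab] at hx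
    exact (he x hx).symm
  rw [hi, ← h, mul_assoc, ← exp_add, neg_add_cancel, exp_zero, mul_one]

lemma exists_norm_zeta_sub_one_le :
    ∃ C : ℝ, 0 ≤ C ∧ ∀ s : ℂ, 2 ≤ s.re → ‖riemannZeta s - 1‖ ≤ C * Real.exp (-s.re / 2) := by
  have hs : Summable fun n : ℕ => Real.exp (-(3 / 2) * Real.log ((n : ℝ) + 2)) := by
    have h := (summable_nat_add_iff 2).2 (Real.summable_nat_rpow (p := -(3 / 2)) |>.2 (by norm_num))
    refine h.congr fun n => ?_
    push_cast
    rw [Real.rpow_def_of_pos (by positivity)]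
    ring_nf
  refine ⟨(∑' n : ℕ, Real.exp (-(3 / 2) * Real.log ((n : ℝ) + 2))) * Real.exp (3 / 4),
    mul_nonneg (tsum_nonneg fun n => Real.exp_nonneg _) (Real.exp_nonneg _), fun s h2 => ?_⟩
  have h1 : Summable fun n : ℕ => 1 / ((n : ℂ) + 1) ^ s := by
    have := (summable_nat_add_iff 1).2 (Complex.summable_one_div_nat_cpow (p := s) |>.2 (by linarith))
    simpa using this
  have h3 : riemannZeta s - 1 = ∑' n : ℕ, 1 / ((n : ℂ) + 2) ^ s := by
    rw [zeta_eq_tsum_one_div_nat_add_one_cpow (by linarith), h1.tsum_eq_zero_add]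
    simp [add_assoc, one_add_one_eq_two]
  rw [h3, mul_assoc, ← Real.exp_add]
  refine tsum_of_norm_bounded (hs.hasSum.mul_right _) fun n => ?_
  have hn : (0 : ℝ) < (n : ℝ) + 2 := by positivity
  have e : ((n : ℂ) + 2) = ((n + 2 : ℝ) : ℂ) := by push_cast; ring
  rw [e, norm_div, norm_one, norm_cpow_eq_rpow_re_of_pos hn, Real.rpow_def_of_pos hn, one_div,
    ← Real.exp_neg, ← Real.exp_add]
  refine Real.exp_le_exp.2 ?_
  have hl : 1 / 2 ≤ Real.log ((n : ℝ) + 2) := by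
    have h1 := Real.log_two_gt_d9
    have h2 : Real.log 2 ≤ Real.log ((n : ℝ) + 2) :=
      Real.log_le_log two_pos (by linarith [(Nat.cast_nonneg n : (0 : ℝ) ≤ n)])
    linarith
  nlinarith

lemma tendsto_exp_neg_half (C : ℝ) : Tendsto (fun σ : ℝ => C * Real.exp (-σ / 2)) atTop (𝓝 0) := by
  have h : Tendsto (fun σ : ℝ => -σ / 2) atTop atBot := by
    have := tendsto_neg_atTop_atBot.comp (tendsto_id.atTop_div_const (by norm_num : (0 : ℝ) < 2))
    refine this.congr fun x => ?_
    simp [neg_div]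
  simpa using (Real.tendsto_exp_atBot.comp h).const_mul C

lemma tendsto_zeta_line (y : ℝ) : Tendsto (fun σ : ℝ => riemannZeta (σ + y * I)) atTop (𝓝 1) := by
  obtain ⟨C, -, h⟩ := exists_norm_zeta_sub_one_le
  rw [tendsto_iff_norm_sub_tendsto_zero]
  refine squeeze_zero' (Eventually.of_forall fun _ => norm_nonneg _) ?_ (tendsto_exp_neg_half C)
  filter_upwards [eventually_ge_atTop 2] with σ hσ
  have := h (σ + y * I) (by simpa using hσ)
  simpa using this

/-- `ζ` has no zeros or poles on the half-line from `σ + iy` to the right. -/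
def RegularRay (σ y : ℝ) : Prop :=
  ∀ r : ℝ, σ ≤ r → (r + y * I : ℂ) ≠ 1 ∧ riemannZeta (r + y * I) ≠ 0

lemma regularRay_of_RH (hRH : RiemannHypothesis) {σ y : ℝ} (hσ : 1 / 2 < σ) (hy : y ≠ 0) :
    RegularRay σ y := fun r hr =>
  ⟨fun h => hy (by simpa using congrArg im h), zeta_ne_zero_of_RH hRH (by simp; linarith)⟩

lemma regularRay_of_one_lt {σ : ℝ} (hσ : 1 < σ) (y : ℝ) : RegularRay σ y := fun r hr =>
  ⟨fun h => by have := congrArg re h; simp at this; linarith,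
    riemannZeta_ne_zero_of_one_lt_re (by simp; linarith)⟩

lemma RegularRay.mono {σ σ' y : ℝ} (h : RegularRay σ y) (hσ : σ ≤ σ') : RegularRay σ' y :=
  fun r hr => h r (hσ.trans hr)

lemma RegularRay.continuousOn {σ y : ℝ} (h : RegularRay σ y) :
    ContinuousOn (fun r : ℝ => logDeriv riemannZeta (r + y * I)) (Ici σ) := fun r hr =>
  ((continuousAt_logDeriv_zeta (h r hr).1 (h r hr).2).comp (f := fun r : ℝ => (r + y * I : ℂ))
    (by fun_prop)).continuousWithinAt

lemma integrableOn_exp_neg_half (a : ℝ) : IntegrableOn (fun r : ℝ => Real.exp (-r / 2)) (Ioi a) := by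
  have := integrableOn_exp_mul_Ioi (a := -(1 / 2)) (by norm_num) a
  refine this.congr_fun (fun r _ => ?_) measurableSet_Ioi
  simp only
  ring_nf

lemma RegularRay.integrableOn {σ y : ℝ} (h : RegularRay σ y) :
    IntegrableOn (fun r : ℝ => logDeriv riemannZeta (r + y * I)) (Ioi σ) := by
  obtain ⟨D, hD, hfar⟩ := exists_norm_logDeriv_zeta_le_exp
  have h1 : IntegrableOn (fun r : ℝ => logDeriv riemannZeta (r + y * I)) (Icc σ (max σ 2)) :=
    (h.continuousOn.mono Icc_subset_Ici_self).integrableOn_Icc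
  have h2 : IntegrableOn (fun r : ℝ => logDeriv riemannZeta (r + y * I)) (Ioi (max σ 2)) := by
    refine Integrable.mono' ((integrableOn_exp_neg_half _).const_mul D)
      (((h.mono (le_max_left σ 2)).continuousOn.mono Ioi_subset_Ici_self).aestronglyMeasurable
        measurableSet_Ioi) ?_
    refine (ae_restrict_iff' measurableSet_Ioi).2 (Eventually.of_forall fun r hr => ?_)
    have hr2 : 2 < r := (le_max_right σ 2).trans_lt hr
    simpa using hfar (r + y * I) (by simp; linarith)
  exact (h1.union h2).mono_set fun r hr => by
    rcases le_or_gt r (max σ 2) with h | h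
    · exact Or.inl ⟨le_of_lt hr, h⟩
    · exact Or.inr h

/-- The branch of `log ζ` obtained by continuation from `+∞` along horizontal lines. -/
def logZeta (σ y : ℝ) : ℂ := -∫ r in Ioi σ, logDeriv riemannZeta (r + y * I)

lemma hasDerivAt_zeta_line {r y : ℝ} (h1 : (r + y * I : ℂ) ≠ 1) (h2 : riemannZeta (r + y * I) ≠ 0) :
    HasDerivAt (fun r : ℝ => riemannZeta (r + y * I))
      (riemannZeta (r + y * I) * logDeriv riemannZeta (r + y * I)) r := by
  have h := (differentiableAt_riemannZeta h1).hasDerivAt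
  have h3 : HasDerivAt (fun r : ℝ => (r + y * I : ℂ)) 1 r := (ofRealCLM.hasDerivAt).add_const _
  refine (h.comp r h3).congr_deriv ?_
  rw [logDeriv_apply, mul_div_cancel₀ _ h2, mul_one]

lemma hasDerivAt_zeta_vertical {σ y : ℝ} (h1 : (σ + y * I : ℂ) ≠ 1) (h2 : riemannZeta (σ + y * I) ≠ 0) :
    HasDerivAt (fun y : ℝ => riemannZeta (σ + y * I))
      (riemannZeta (σ + y * I) * (I * logDeriv riemannZeta (σ + y * I))) y := by
  have h := (differentiableAt_riemannZeta h1).hasDerivAt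
  have h3 : HasDerivAt (fun y : ℝ => (σ + y * I : ℂ)) I y := by
    simpa using ((ofRealCLM.hasDerivAt (x := y)).mul_const I).const_add (σ : ℂ)
  refine (h.comp y h3).congr_deriv ?_
  rw [logDeriv_apply]
  field_simp

/-- ζ(b + iy) equals ζ(σ + iy) times the exponential of the integral up to b, and tends to 1 as b →
∞. -/
lemma RegularRay.exp_logZeta {σ y : ℝ} (h : RegularRay σ y) :
    exp (logZeta σ y) = riemannZeta (σ + y * I) := by
  have h1 : ∀ᶠ b : ℝ in atTop, riemannZeta (b + y * I) =
      riemannZeta (σ + y * I) * exp (∫ r in σ..b, logDeriv riemannZeta (r + y * I)) := by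
    filter_upwards [eventually_ge_atTop σ] with b hb
    exact eq_mul_exp_integral (f := fun r : ℝ => riemannZeta (r + y * I)) hb
      (fun r hr => hasDerivAt_zeta_line (h r hr.1).1 (h r hr.1).2)
      (h.continuousOn.mono Icc_subset_Ici_self)
  have h2 := intervalIntegral_tendsto_integral_Ioi σ h.integrableOn tendsto_id
  have h3 : Tendsto (fun b : ℝ => riemannZeta (σ + y * I) *
      exp (∫ r in σ..b, logDeriv riemannZeta (r + y * I))) atTop
      (𝓝 (riemannZeta (σ + y * I) * exp (∫ r in Ioi σ, logDeriv riemannZeta (r + y * I)))) :=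
    ((continuous_exp.tendsto _).comp h2).const_mul _
  have h4 := tendsto_nhds_unique (h3.congr' (h1.mono fun b hb => hb.symm)) (tendsto_zeta_line y)
  rw [logZeta, exp_neg]
  exact (eq_inv_of_mul_eq_one_left h4).symm

lemma RegularRay.re_logZeta {σ y : ℝ} (h : RegularRay σ y) :
    (logZeta σ y).re = Real.log ‖riemannZeta (σ + y * I)‖ := by
  rw [← h.exp_logZeta, norm_exp, Real.log_exp]

lemma RegularRay.logZeta_sub {σ σ' y : ℝ} (h : RegularRay σ y) (hσ : σ ≤ σ') :
    logZeta σ' y - logZeta σ y = ∫ r in σ..σ', logDeriv riemannZeta (r + y * I) := by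
  rw [logZeta, logZeta, ← intervalIntegral.integral_Ioi_sub_Ioi h.integrableOn hσ]
  ring

lemma integral_div_sq_add_sq {t : ℝ} (ht : t ≠ 0) (a b : ℝ) :
    ∫ r in a..b, t / (r ^ 2 + t ^ 2) = Real.arctan (b / t) - Real.arctan (a / t) := by
  refine intervalIntegral.integral_eq_sub_of_hasDerivAt (f := fun r => Real.arctan (r / t)) (fun r _ => ?_) ?_
  · refine ((hasDerivAt_id r).div_const t).arctan.congr_deriv ?_
    simp only [id]
    field_simp
    ring
  · refine Continuous.intervalIntegrable ?_ _ _
    refine continuous_const.div (by fun_prop) fun r => ?_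
    positivity

lemma regLogDeriv_ofReal_im {r : ℝ} (hr : 0 < r) : (regLogDeriv r).im = 0 := by
  have h := regLogDeriv_conj (s := r) (by simpa using hr)
  rw [conj_ofReal] at h
  exact conj_eq_iff_im.1 h.symm

lemma continuousOn_regLogDeriv_line (hRH : RiemannHypothesis) (y : ℝ) :
    ContinuousOn (fun r : ℝ => regLogDeriv (r + y * I)) (Ioi (1 / 2)) := by
  refine (differentiableOn_regLogDeriv hRH).continuousOn.comp (by fun_prop) fun r hr => ?_
  have hr : 1 / 2 < r := hr
  simpa using hr

lemma continuous_regLogDeriv_vertical (hRH : RiemannHypothesis) {σ : ℝ} (hσ : 1 / 2 < σ) :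
    Continuous (fun y : ℝ => regLogDeriv (σ + y * I)) := by
  rw [← continuousOn_univ]
  refine (differentiableOn_regLogDeriv hRH).continuousOn.comp (by fun_prop) fun r _ => ?_
  simpa using hσ

/-- Cauchy's theorem on a rectangle with its lower side on the real axis. The integrand is real
there, so that side drops out of the imaginary part of the identity. -/
lemma re_integral_regLogDeriv (hRH : RiemannHypothesis) {σ R t : ℝ} (hσ : 1 / 2 < σ) (hR : σ ≤ R) :
    ∫ τ in 0..t, (regLogDeriv (σ + τ * I)).re =
      (∫ τ in 0..t, (regLogDeriv (R + τ * I)).re) - ∫ r in σ..R, (regLogDeriv (r + t * I)).im := by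
  have h := integral_boundary_rect_eq_zero_of_differentiableOn regLogDeriv (σ : ℂ) (R + t * I)
    ((differentiableOn_regLogDeriv hRH).mono fun z hz => by
      have := hz.1
      simp only [ofReal_re, add_re, mul_re, I_re, mul_zero, ofReal_im, I_im, mul_one, sub_self,
        add_zero, mem_preimage, uIcc_of_le hR] at this
      exact hσ.trans_le this.1)
  simp only [ofReal_re, add_re, mul_re, I_re, mul_zero, ofReal_im, I_im, mul_one, sub_self,
    add_zero, add_im, mul_im, zero_add, ofReal_zero, zero_mul] at h
  have hc : ∀ y : ℝ, IntervalIntegrable (fun r : ℝ => regLogDeriv (r + y * I)) volume σ R := fun y =>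
    ((continuousOn_regLogDeriv_line hRH y).mono fun r hr => by
      rw [uIcc_of_le hR] at hr; exact hσ.trans_le hr.1).intervalIntegrable
  have hc0 : IntervalIntegrable (fun r : ℝ => regLogDeriv r) volume σ R := by simpa using hc 0
  have hv : ∀ r : ℝ, 1 / 2 < r → IntervalIntegrable (fun y : ℝ => regLogDeriv (r + y * I)) volume 0 t :=
    fun r hr => (continuous_regLogDeriv_vertical hRH hr).intervalIntegrable _ _
  have him : ∀ {f : ℝ → ℂ} {a b : ℝ}, IntervalIntegrable f volume a b →
      (∫ x in a..b, f x).im = ∫ x in a..b, (f x).im := fun {f a b} hf => by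
    simpa using (imCLM.intervalIntegral_comp_comm hf).symm
  have hre : ∀ {f : ℝ → ℂ} {a b : ℝ}, IntervalIntegrable f volume a b →
      (∫ x in a..b, f x).re = ∫ x in a..b, (f x).re := fun {f a b} hf => by
    simpa using (reCLM.intervalIntegral_comp_comm hf).symm
  have h2 := congrArg im h
  simp only [sub_im, add_im, smul_eq_mul, I_mul_im, zero_im] at h2
  rw [him hc0, him (hc t), hre (hv R (by linarith)), hre (hv σ hσ)] at h2
  have h0 : ∫ r in σ..R, (regLogDeriv r).im = 0 := by
    rw [← intervalIntegral.integral_zero (a := σ) (b := R)]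
    refine intervalIntegral.integral_congr fun r hr => ?_
    rw [uIcc_of_le hR] at hr
    exact regLogDeriv_ofReal_im (by linarith [hr.1])
  rw [h0] at h2
  linarith

lemma tendsto_integral_regLogDeriv (hRH : RiemannHypothesis) (t : ℝ) :
    Tendsto (fun R : ℝ => ∫ τ in 0..t, (regLogDeriv (R + τ * I)).re) atTop (𝓝 0) := by
  obtain ⟨D, hD, hfar⟩ := exists_norm_logDeriv_zeta_le_exp
  have hlim : Tendsto (fun R : ℝ => (D * Real.exp (-R / 2) + 1 / (R - 1)) * |t - 0|) atTop (𝓝 0) := by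
    have h1 : Tendsto (fun R : ℝ => 1 / (R - 1)) atTop (𝓝 0) := by
      simp only [one_div]
      exact tendsto_inv_atTop_zero.comp (tendsto_atTop_add_const_right _ (-1) tendsto_id)
    simpa using ((tendsto_exp_neg_half D).add h1).mul_const |t - 0|
  refine squeeze_zero_norm' ?_ hlim
  filter_upwards [eventually_ge_atTop 2] with R hR
  refine intervalIntegral.norm_integral_le_of_norm_le_const fun τ _ => ?_
  have hre : (R + τ * I : ℂ).re = R := by simp
  have h1 : (R + τ * I : ℂ) ≠ 1 := fun h => by rw [h, one_re] at hre; linarith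
  have e : regLogDeriv (R + τ * I) = logDeriv riemannZeta (R + τ * I) + 1 / (R + τ * I - 1) := by
    rw [logDeriv_zeta_eq_reg (by rw [hre]; linarith) h1 (zeta_ne_zero_of_RH hRH (by rw [hre]; linarith))]
    ring
  refine (abs_re_le_norm _).trans ?_
  rw [e]
  refine (norm_add_le _ _).trans (add_le_add ?_ ?_)
  · simpa using hfar (R + τ * I) (by rw [hre]; exact hR)
  · rw [norm_div, norm_one]
    refine one_div_le_one_div_of_le (by linarith) ?_
    have := re_le_norm ((R : ℂ) + τ * I - 1)
    rw [sub_re, hre, one_re] at this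
    exact this

lemma continuous_logDeriv_zeta_vertical (hRH : RiemannHypothesis) {σ : ℝ} (hσ : 1 / 2 < σ) (h1 : σ ≠ 1) :
    Continuous (fun y : ℝ => logDeriv riemannZeta (σ + y * I)) := by
  rw [continuous_iff_continuousAt]
  intro y
  exact (continuousAt_logDeriv_zeta (s := σ + y * I)
    (fun h => h1 (by simpa using congrArg re h)) (zeta_ne_zero_of_RH hRH (by simpa using hσ))).comp
    (f := fun y : ℝ => (σ + y * I : ℂ)) (by fun_prop)

/-- Removing the pole produces two arctangents, from the vertical and from the horizontal side.
Their arguments are reciprocal, so their sum is π/2 or -π/2 according to the sign of σ - 1; this is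
the jump by π. -/
lemma re_integral_logDeriv_zeta (hRH : RiemannHypothesis) {σ t : ℝ} (hσ : 1 / 2 < σ) (h1 : σ ≠ 1)
    (ht : 0 < t) :
    (∫ τ in 0..t, logDeriv riemannZeta (σ + τ * I)).re =
      (logZeta σ t).im + if σ < 1 then Real.pi else 0 := by
  have hy : σ - 1 ≠ 0 := sub_ne_zero.2 h1
  have hray := regularRay_of_RH hRH hσ ht.ne'
  have hV := continuous_logDeriv_zeta_vertical hRH hσ h1
  have hreg : ∀ s : ℂ, 1 / 2 < s.re → s ≠ 1 → regLogDeriv s = logDeriv riemannZeta s + 1 / (s - 1) :=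
    fun s hs hs1 => by
      rw [logDeriv_zeta_eq_reg (by linarith) hs1 (zeta_ne_zero_of_RH hRH hs)]
      ring
  have e1 : ∫ τ in 0..t, (regLogDeriv (σ + τ * I)).re =
      (∫ τ in 0..t, logDeriv riemannZeta (σ + τ * I)).re + Real.arctan (t / (σ - 1)) := by
    have hre := reCLM.intervalIntegral_comp_comm (hV.intervalIntegrable (μ := volume) 0 t)
    simp only [reCLM_apply] at hre
    have h3 := integral_div_sq_add_sq hy 0 t
    rw [zero_div, Real.arctan_zero, sub_zero] at h3
    rw [← hre, ← h3, ← intervalIntegral.integral_add]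
    · refine intervalIntegral.integral_congr fun τ _ => ?_
      rw [hreg _ (by simpa using hσ) (fun h => h1 (by simpa using congrArg re h)), add_re, one_div, inv_re,
        normSq_apply]
      simp
      ring
    · exact (continuous_re.comp hV).intervalIntegrable _ _
    · refine Continuous.intervalIntegrable ?_ _ _
      refine continuous_const.div (by fun_prop) fun r => ?_
      positivity
  have e2 : ∀ R, σ ≤ R → ∫ r in σ..R, (regLogDeriv (r + t * I)).im =
      (∫ r in σ..R, logDeriv riemannZeta (r + t * I)).im -
        (Real.arctan ((R - 1) / t) - Real.arctan ((σ - 1) / t)) := fun R hR => by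
    have hI : IntervalIntegrable (fun r : ℝ => logDeriv riemannZeta (r + t * I)) volume σ R :=
      (hray.continuousOn.mono fun r hr => by
        rw [uIcc_of_le hR] at hr; exact hr.1).intervalIntegrable
    have him := imCLM.intervalIntegral_comp_comm hI
    simp only [imCLM_apply] at him
    have h3 := integral_div_sq_add_sq ht.ne' (σ - 1) (R - 1)
    rw [← him, ← h3, ← intervalIntegral.integral_comp_sub_right (fun r => t / (r ^ 2 + t ^ 2)) 1,
      ← intervalIntegral.integral_sub]
    · refine intervalIntegral.integral_congr fun r hr => ?_
      rw [uIcc_of_le hR] at hr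
      rw [hreg _ (by simpa using hσ.trans_le hr.1) (fun h => ht.ne' (by simpa using congrArg im h)), add_im,
        one_div, inv_im, normSq_apply]
      simp
      ring
    · exact (continuous_im.comp_continuousOn (hray.continuousOn.mono fun r hr => by
        rw [uIcc_of_le hR] at hr; exact hr.1)).intervalIntegrable
    · refine Continuous.intervalIntegrable ?_ _ _
      refine continuous_const.div (by fun_prop) fun r => ?_
      positivity
  have hlim : Tendsto (fun R : ℝ => (∫ τ in 0..t, (regLogDeriv (R + τ * I)).re) -
      ((∫ r in σ..R, logDeriv riemannZeta (r + t * I)).im -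
        (Real.arctan ((R - 1) / t) - Real.arctan ((σ - 1) / t)))) atTop
      (𝓝 (0 - ((∫ r in Ioi σ, logDeriv riemannZeta (r + t * I)).im -
        (Real.pi / 2 - Real.arctan ((σ - 1) / t))))) := by
    refine (tendsto_integral_regLogDeriv hRH t).sub (Tendsto.sub ?_ (Tendsto.sub ?_ tendsto_const_nhds))
    · exact (continuous_im.tendsto _).comp
        (intervalIntegral_tendsto_integral_Ioi σ hray.integrableOn tendsto_id)
    · have h4 : Tendsto (fun R : ℝ => (R - 1) / t) atTop atTop :=
        (tendsto_atTop_add_const_right _ (-1) tendsto_id).atTop_div_const ht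
      exact (Real.tendsto_arctan_atTop.mono_right nhdsWithin_le_nhds).comp h4
  have hconst : Tendsto (fun R : ℝ => (∫ τ in 0..t, (regLogDeriv (R + τ * I)).re) -
      ((∫ r in σ..R, logDeriv riemannZeta (r + t * I)).im -
        (Real.arctan ((R - 1) / t) - Real.arctan ((σ - 1) / t)))) atTop
      (𝓝 ((∫ τ in 0..t, logDeriv riemannZeta (σ + τ * I)).re + Real.arctan (t / (σ - 1)))) := by
    refine tendsto_const_nhds.congr' ?_
    filter_upwards [eventually_ge_atTop σ] with R hR
    rw [← e1, re_integral_regLogDeriv hRH hσ hR, e2 R hR]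
  have hfin := tendsto_nhds_unique hconst hlim
  have hl : (logZeta σ t).im = -(∫ r in Ioi σ, logDeriv riemannZeta (r + t * I)).im := by
    rw [logZeta, neg_im]
  rw [hl]
  have hinv : t / (σ - 1) = ((σ - 1) / t)⁻¹ := by rw [inv_div]
  split_ifs with hlt
  · rw [hinv, Real.arctan_inv_of_neg (div_neg_of_neg_of_pos (by linarith) ht)] at hfin
    linarith
  · have : 1 < σ := lt_of_le_of_ne (not_lt.1 hlt) (Ne.symm h1)
    rw [hinv, Real.arctan_inv_of_pos (div_pos (by linarith) ht)] at hfin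
    linarith

/-- Compares the absolute values of ζ at both ends of the vertical segment. -/
lemma im_integral_logDeriv_zeta (hRH : RiemannHypothesis) {σ t : ℝ} (hσ : 1 / 2 < σ) (h1 : σ ≠ 1)
    (ht : 0 < t) :
    (∫ τ in 0..t, logDeriv riemannZeta (σ + τ * I)).im =
      Real.log ‖riemannZeta σ‖ - (logZeta σ t).re := by
  have hV := continuous_logDeriv_zeta_vertical hRH hσ h1
  have hne : ∀ y : ℝ, (σ + y * I : ℂ) ≠ 1 ∧ riemannZeta (σ + y * I) ≠ 0 := fun y =>
    ⟨fun h => h1 (by simpa using congrArg re h), zeta_ne_zero_of_RH hRH (by simpa using hσ)⟩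
  have h := eq_mul_exp_integral (f := fun y : ℝ => riemannZeta (σ + y * I)) ht.le
    (fun y _ => hasDerivAt_zeta_vertical (hne y).1 (hne y).2) (continuous_const.mul hV).continuousOn
  rw [intervalIntegral.integral_const_mul] at h
  simp only [ofReal_zero, zero_mul, add_zero] at h
  have hn0 : ‖riemannZeta σ‖ ≠ 0 := by
    have := (hne 0).2
    simpa using this
  rw [(regularRay_of_RH hRH hσ ht.ne').re_logZeta, h, norm_mul, norm_exp,
    Real.log_mul hn0 (Real.exp_ne_zero _), Real.log_exp, I_mul_re]
  ring

/-- The vertical integral of `ζ'/ζ` in terms of the branch of `log ζ`. -/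
lemma integral_logDeriv_zeta_vertical (hRH : RiemannHypothesis) {σ t : ℝ} (hσ : 1 / 2 < σ) (h1 : σ ≠ 1)
    (ht : 0 < t) :
    ∫ τ in 0..t, logDeriv riemannZeta (σ + τ * I) =
      -I * (logZeta σ t - Real.log ‖riemannZeta σ‖ + (if σ < 1 then Real.pi else 0 : ℝ) * I) := by
  apply Complex.ext
  · rw [re_integral_logDeriv_zeta hRH hσ h1 ht]
    simp
  · rw [im_integral_logDeriv_zeta hRH hσ h1 ht]
    simp

end ZetaArgument

end

/-! ### Moments of ζ'/ζ and their integrals in t. -/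

noncomputable section

namespace ZetaArgument

open Complex Set Filter Topology MeasureTheory ComplexConjugate

lemma integral_Ioi_add_left {E : Type*} [NormedAddCommGroup E] [NormedSpace ℝ E] (f : ℝ → E) (a b : ℝ) :
    ∫ v in Ioi (a + b), f v = ∫ u in Ioi b, f (a + u) := by
  have h := (measurePreserving_add_left (volume : Measure ℝ) a).setIntegral_preimage_emb
    (MeasurableEquiv.addLeft a).measurableEmbedding f (Ioi (a + b))
  rw [← h]
  congr 2
  ext u
  simp

lemma integrableOn_Ioi_add_left {E : Type*} [NormedAddCommGroup E] (f : ℝ → E) (a b : ℝ) :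
    IntegrableOn (fun u => f (a + u)) (Ioi b) ↔ IntegrableOn f (Ioi (a + b)) := by
  have h := (measurePreserving_add_left (volume : Measure ℝ) a).integrableOn_comp_preimage
    (MeasurableEquiv.addLeft a).measurableEmbedding (f := f) (s := Ioi (a + b))
  rw [← h]
  have : (fun x => a + x) ⁻¹' Ioi (a + b) = Ioi b := by ext u; simp
  rw [this]
  rfl

/-- Exchange of integrals over a half-plane `a < u < r`. -/
lemma integral_tail_swap {E : Type*} [NormedAddCommGroup E] [NormedSpace ℝ E] [CompleteSpace E]
    {a : ℝ} {φ : ℝ → E} {k : ℝ → ℝ → ℝ} (hk : Continuous (Function.uncurry k))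
    (hk0 : ∀ u r, a < u → u < r → 0 ≤ k u r)
    (hφ : AEStronglyMeasurable φ (volume.restrict (Ioi a)))
    (hint : IntegrableOn (fun r => (∫ u in a..r, k u r) • φ r) (Ioi a)) :
    IntegrableOn (fun u => ∫ r in Ioi u, k u r • φ r) (Ioi a) ∧
      ∫ u in Ioi a, ∫ r in Ioi u, k u r • φ r = ∫ r in Ioi a, (∫ u in a..r, k u r) • φ r := by
  set μ : Measure ℝ := volume.restrict (Ioi a) with hμ
  set F : ℝ × ℝ → E := indicator {p | p.1 < p.2} fun p => k p.1 p.2 • φ p.2 with hF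
  have hms : MeasurableSet {p : ℝ × ℝ | p.1 < p.2} := measurableSet_lt measurable_fst measurable_snd
  have hFm : AEStronglyMeasurable F (μ.prod μ) :=
    (AEStronglyMeasurable.smul hk.aestronglyMeasurable hφ.comp_snd).indicator hms
  have hsec : ∀ r, (fun u => F (u, r)) = indicator (Iio r) fun u => k u r • φ r := fun r => by
    funext u
    simp only [hF, indicator, mem_ofPred_eq, mem_Iio]
  have hsec' : ∀ u, (fun r => F (u, r)) = indicator (Ioi u) fun r => k u r • φ r := fun u => by
    funext r
    simp only [hF, indicator, mem_ofPred_eq, mem_Ioi]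
  have hinter : ∀ r, μ.restrict (Iio r) = volume.restrict (Ioo a r) := fun r => by
    rw [hμ, Measure.restrict_restrict measurableSet_Iio, inter_comm, Ioi_inter_Iio]
  have hcr : ∀ r, Continuous fun u => k u r := fun r => hk.comp (by fun_prop : Continuous fun u : ℝ => (u, r))
  have hio : ∀ r, IntegrableOn (fun u => k u r) (Ioo a r) := fun r =>
    ((hcr r).integrableOn_Icc (a := a) (b := r)).mono_set Ioo_subset_Icc_self
  have hsint : ∀ r, ∫ u, F (u, r) ∂μ = if a ≤ r then (∫ u in a..r, k u r) • φ r else 0 := fun r => by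
    rw [hsec, integral_indicator measurableSet_Iio, hinter]
    split_ifs with h
    · rw [integral_smul_const, intervalIntegral.integral_of_le h, integral_Ioc_eq_integral_Ioo]
    · rw [Ioo_eq_empty (by linarith), Measure.restrict_empty, integral_zero_measure]
  have hI : Integrable F (μ.prod μ) := by
    rw [integrable_prod_iff' hFm]
    refine ⟨Eventually.of_forall fun r => ?_, ?_⟩
    · rw [hsec, integrable_indicator_iff measurableSet_Iio, IntegrableOn, hinter]
      exact (hio r).smul_const _
    · refine hint.norm.congr ?_
      rw [hμ]
      refine (ae_restrict_iff' measurableSet_Ioi).2 (Eventually.of_forall fun r hr => ?_)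
      have hr : a < r := hr
      have hn : (fun u => ‖F (u, r)‖) = indicator (Iio r) fun u => ‖k u r • φ r‖ := by
        funext u
        rw [congrFun (hsec r) u, norm_indicator_eq_indicator_norm]
      simp only
      rw [hn, integral_indicator measurableSet_Iio, ← hμ, hinter, norm_smul,
        intervalIntegral.integral_of_le hr.le, integral_Ioc_eq_integral_Ioo,
        Real.norm_of_nonneg (setIntegral_nonneg measurableSet_Ioo fun u hu => hk0 u r hu.1 hu.2),
        ← integral_mul_const]
      refine setIntegral_congr_fun measurableSet_Ioo fun u hu => ?_
      rw [norm_smul, Real.norm_of_nonneg (hk0 u r hu.1 hu.2)]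
  have hin : ∀ u ∈ Ioi a, ∫ r, F (u, r) ∂μ = ∫ r in Ioi u, k u r • φ r := fun u hu => by
    rw [hsec', integral_indicator measurableSet_Ioi, hμ, Measure.restrict_restrict measurableSet_Ioi,
      Ioi_inter_Ioi, sup_of_le_left (le_of_lt hu)]
  constructor
  · exact hI.integral_prod_left.congr ((ae_restrict_iff' measurableSet_Ioi).2
      (Eventually.of_forall hin))
  · rw [← setIntegral_congr_fun measurableSet_Ioi hin]
    rw [integral_integral_swap (f := fun u r => F (u, r)) hI]
    refine setIntegral_congr_fun measurableSet_Ioi fun r hr => ?_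
    rw [hsint, if_pos (le_of_lt hr)]

/-- The moments of `ζ'/ζ` on horizontal half-lines starting at the critical line. -/
def moment (n : ℕ) (t : ℝ) : ℂ :=
  ∫ u in Ioi (0 : ℝ), (u : ℂ) ^ n * logDeriv riemannZeta (1 / 2 + u + t * I)

lemma logZeta_half_add (u t : ℝ) :
    logZeta (1 / 2 + u) t = -∫ r in Ioi u, logDeriv riemannZeta (1 / 2 + r + t * I) := by
  rw [logZeta, integral_Ioi_add_left]
  simp

/-- With log ζ written as a tail integral, the exchange of integrals turns u^n into r^{n+1}/(n+1).
-/
lemma integral_pow_mul_logZeta (hRH : RiemannHypothesis) {t : ℝ} (ht : 0 < t) (n : ℕ) :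
    IntegrableOn (fun u : ℝ => (u : ℂ) ^ n * logZeta (1 / 2 + u) t) (Ioi 0) ∧
      ∫ u in Ioi (0 : ℝ), (u : ℂ) ^ n * logZeta (1 / 2 + u) t = -(moment (n + 1) t / (n + 1)) := by
  have hw : ∀ r : ℝ, ∫ u in (0 : ℝ)..r, u ^ n = r ^ (n + 1) / (n + 1) := fun r => by
    rw [integral_pow]; simp
  have h0 := integrableOn_pow_mul_logDeriv_zeta hRH ht (n := n + 1) (by omega)
  have e : ∀ r : ℝ, (∫ u in (0 : ℝ)..r, u ^ n) • logDeriv riemannZeta (1 / 2 + r + t * I) =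
      1 / ((n : ℂ) + 1) * ((r : ℂ) ^ (n + 1) * logDeriv riemannZeta (1 / 2 + r + t * I)) := fun r => by
    rw [hw, real_smul]
    push_cast
    ring
  have h := integral_tail_swap (a := 0) (φ := fun r : ℝ => logDeriv riemannZeta (1 / 2 + r + t * I))
    (k := fun u _ => u ^ n) (by fun_prop) (fun u r hu _ => by positivity)
    ((continuousOn_logDeriv_zeta_line hRH ht.ne').aestronglyMeasurable measurableSet_Ioi)
    (by simp only [e]; exact h0.const_mul _)
  have e2 : (fun u : ℝ => (u : ℂ) ^ n * logZeta (1 / 2 + u) t) =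
      fun u : ℝ => -∫ r in Ioi u, (u ^ n : ℝ) • logDeriv riemannZeta (1 / 2 + r + t * I) := by
    funext u
    rw [integral_smul, real_smul, logZeta_half_add]
    push_cast
    ring
  rw [e2]
  refine ⟨h.1.neg, ?_⟩
  rw [integral_neg, h.2]
  simp only [e]
  rw [integral_const_mul, moment]
  ring

lemma integral_moment (hRH : RiemannHypothesis) {t : ℝ} (ht : 0 < t) (n : ℕ) :
    IntervalIntegrable (moment n) volume 0 t ∧
    IntegrableOn (fun u : ℝ => (u : ℂ) ^ n * ∫ τ in 0..t, logDeriv riemannZeta ((1 / 2 + u : ℝ) + τ * I)) (Ioi 0) ∧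
    ∫ τ in 0..t, moment n τ =
      ∫ u in Ioi (0 : ℝ), (u : ℂ) ^ n * ∫ τ in 0..t, logDeriv riemannZeta ((1 / 2 + u : ℝ) + τ * I) := by
  have h := integrableOn_pow_mul_logDeriv_zeta_prod hRH t ht.le n
  rw [IntegrableOn, Measure.volume_eq_prod, ← Measure.prod_restrict] at h
  have e : ∀ u : ℝ, ∫ τ in Ioc 0 t, (u : ℂ) ^ n * logDeriv riemannZeta (1 / 2 + u + τ * I) =
      (u : ℂ) ^ n * ∫ τ in 0..t, logDeriv riemannZeta ((1 / 2 + u : ℝ) + τ * I) := fun u => by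
    rw [integral_const_mul, intervalIntegral.integral_of_le ht.le]
    push_cast
    rfl
  refine ⟨?_, ?_, ?_⟩
  · rw [intervalIntegrable_iff_integrableOn_Ioc_of_le ht.le]
    exact h.integral_prod_right
  · exact h.integral_prod_left.congr (Eventually.of_forall e)
  · rw [intervalIntegral.integral_of_le ht.le]
    have := integral_integral_swap (f := fun u τ : ℝ => (u : ℂ) ^ n *
      logDeriv riemannZeta (1 / 2 + u + τ * I)) h
    simp only [e] at this
    exact this.symm

/-- The total contribution of the jump π on 1/2 < σ < 1, the source of the constants δ of even
index. -/
lemma integral_pow_mul_indicator (n : ℕ) :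
    IntegrableOn (fun u : ℝ => (u : ℂ) ^ n * ((if 1 / 2 + u < 1 then Real.pi else 0 : ℝ) : ℂ)) (Ioi 0) ∧
      ∫ u in Ioi (0 : ℝ), (u : ℂ) ^ n * ((if 1 / 2 + u < 1 then Real.pi else 0 : ℝ) : ℂ) =
        Real.pi * ((1 / 2) ^ (n + 1) / (n + 1)) := by
  have e : (fun u : ℝ => (u : ℂ) ^ n * ((if 1 / 2 + u < 1 then Real.pi else 0 : ℝ) : ℂ)) =
      indicator (Iio (1 / 2)) fun u : ℝ => ((u ^ n * Real.pi : ℝ) : ℂ) := by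
    funext u
    simp only [indicator, mem_Iio]
    have : 1 / 2 + u < 1 ↔ u < 1 / 2 := by constructor <;> intro h <;> linarith
    simp only [this]
    split_ifs <;> simp
  have hr : ((volume : Measure ℝ).restrict (Ioi 0)).restrict (Iio (1 / 2)) = volume.restrict (Ioo 0 (1 / 2)) := by
    rw [Measure.restrict_restrict measurableSet_Iio, inter_comm, Ioi_inter_Iio]
  rw [e]
  constructor
  · rw [IntegrableOn, integrable_indicator_iff measurableSet_Iio, IntegrableOn, hr]
    exact ((by fun_prop : Continuous fun u : ℝ => ((u ^ n * Real.pi : ℝ) : ℂ)).integrableOn_Icc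
      (a := 0) (b := 1 / 2)).mono_set Ioo_subset_Icc_self
  · rw [integral_indicator measurableSet_Iio, hr, ← integral_Ioc_eq_integral_Ioo,
      ← intervalIntegral.integral_of_le (by norm_num), intervalIntegral.integral_ofReal,
      intervalIntegral.integral_mul_const, integral_pow]
    push_cast
    simp
    ring

/-- Only almost everywhere: at u = 1/2 the vertical line starts at the pole. -/
lemma pow_mul_integral_vertical (hRH : RiemannHypothesis) {t : ℝ} (ht : 0 < t) (n : ℕ) :
    ∀ᵐ u : ℝ ∂volume.restrict (Ioi 0),
      (u : ℂ) ^ n * ∫ τ in 0..t, logDeriv riemannZeta ((1 / 2 + u : ℝ) + τ * I) =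
      -I * ((u : ℂ) ^ n * logZeta (1 / 2 + u) t) +
      I * ((u ^ n * Real.log ‖riemannZeta ((1 / 2 + u : ℝ) : ℂ)‖ : ℝ) : ℂ) +
      (u : ℂ) ^ n * ((if 1 / 2 + u < 1 then Real.pi else 0 : ℝ) : ℂ) := by
  have h1 : ∀ᵐ u : ℝ ∂volume.restrict (Ioi 0), u ≠ 1 / 2 :=
    ae_restrict_of_ae (Measure.ae_ne volume (1 / 2))
  filter_upwards [h1, ae_restrict_mem measurableSet_Ioi] with u hu hu0
  have hu0 : 0 < u := hu0
  rw [integral_logDeriv_zeta_vertical hRH (by linarith) (fun h => hu (by linarith)) ht]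
  push_cast
  linear_combination (-(u : ℂ) ^ n * ((if 1 / 2 + u < 1 then Real.pi else 0 : ℝ) : ℂ)) * I_sq

/-- Solves `pow_mul_integral_vertical` at t = 1 for the term with log|ζ|. All other terms are known
to be integrable, so the logarithmic singularity at the pole needs no separate treatment. -/
lemma integrableOn_pow_mul_log_zeta (hRH : RiemannHypothesis) (n : ℕ) :
    IntegrableOn (fun u : ℝ => u ^ n * Real.log ‖riemannZeta ((1 / 2 + u : ℝ) : ℂ)‖) (Ioi 0) := by
  have h1 := (integral_moment hRH one_pos n).2.1
  have h2 := (integral_pow_mul_logZeta hRH one_pos n).1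
  have h3 := (integral_pow_mul_indicator n).1
  have h := (((h1.sub (h2.const_mul (-I))).sub h3).const_mul (-I)).re
  refine h.congr ?_
  filter_upwards [pow_mul_integral_vertical hRH one_pos n] with u hu
  simp only [Pi.sub_apply]
  rw [hu]
  have e : ∀ a b c : ℂ, -I * (-I * a + I * b + c - -I * a - c) = b := fun a b c => by
    linear_combination -b * I_sq
  rw [e]
  exact ofReal_re _

lemma integral_moment_eq (hRH : RiemannHypothesis) {t : ℝ} (ht : 0 < t) (n : ℕ) :
    ∫ τ in 0..t, moment n τ = I * (moment (n + 1) t / (n + 1)) +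
      I * ((∫ u in Ioi (0 : ℝ), u ^ n * Real.log ‖riemannZeta ((1 / 2 + u : ℝ) : ℂ)‖ : ℝ) : ℂ) +
      Real.pi * ((1 / 2) ^ (n + 1) / (n + 1)) := by
  have h2 := (integral_pow_mul_logZeta hRH ht n)
  have h3 := (integral_pow_mul_indicator n)
  have h4 := integrableOn_pow_mul_log_zeta hRH n
  have hA : IntegrableOn (fun u : ℝ => -I * ((u : ℂ) ^ n * logZeta (1 / 2 + u) t)) (Ioi 0) :=
    h2.1.const_mul _
  have hB : IntegrableOn (fun u : ℝ =>
      I * ((u ^ n * Real.log ‖riemannZeta ((1 / 2 + u : ℝ) : ℂ)‖ : ℝ) : ℂ)) (Ioi 0) :=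
    h4.ofReal.const_mul I
  have hAB : IntegrableOn (fun u : ℝ => -I * ((u : ℂ) ^ n * logZeta (1 / 2 + u) t) +
      I * ((u ^ n * Real.log ‖riemannZeta ((1 / 2 + u : ℝ) : ℂ)‖ : ℝ) : ℂ)) (Ioi 0) := hA.add hB
  rw [(integral_moment hRH ht n).2.2, integral_congr_ae (pow_mul_integral_vertical hRH ht n),
    integral_add hAB h3.1, integral_add hA hB, integral_const_mul, integral_const_mul, h2.2, h3.2]
  have h5 : ∫ u in Ioi (0 : ℝ), ((u ^ n * Real.log ‖riemannZeta ((1 / 2 + u : ℝ) : ℂ)‖ : ℝ) : ℂ) =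
      ((∫ u in Ioi (0 : ℝ), u ^ n * Real.log ‖riemannZeta ((1 / 2 + u : ℝ) : ℂ)‖ : ℝ) : ℂ) := integral_ofReal
  rw [h5]
  ring

end ZetaArgument

end

/-! ### Identification of S_n with a moment. -/

noncomputable section

namespace ZetaArgument

open Complex Set Filter Topology MeasureTheory ComplexConjugate

lemma iterOne_eq (j : ℕ) (σ : ℝ) : iterOne j σ = (1 - σ) ^ j / (j.factorial : ℝ) := by
  induction j generalizing σ with
  | zero => simp [iterOne]
  | succ j ih =>
    have hj : ((j : ℝ) + 1) ≠ 0 := by positivity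
    simp only [iterOne, ih]
    rw [intervalIntegral.integral_comp_sub_left (fun v => v ^ j / (j.factorial : ℝ)) 1, sub_self,
      intervalIntegral.integral_div, integral_pow, Nat.factorial_succ]
    push_cast
    field_simp
    ring

lemma integrableOn_shift_pow_mul_log_zeta (hRH : RiemannHypothesis) (n : ℕ) {σ : ℝ} (hσ : 1 / 2 ≤ σ) :
    IntegrableOn (fun v : ℝ => (v - σ) ^ n * Real.log ‖riemannZeta (v : ℂ)‖) (Ioi σ) := by
  have h : ∀ m : ℕ, IntegrableOn (fun v : ℝ => (v - 1 / 2) ^ m * Real.log ‖riemannZeta (v : ℂ)‖)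
      (Ioi (1 / 2)) := fun m => by
    have h1 := integrableOn_pow_mul_log_zeta hRH m
    have h2 := (integrableOn_Ioi_add_left
      (fun v : ℝ => (v - 1 / 2) ^ m * Real.log ‖riemannZeta (v : ℂ)‖) (1 / 2) 0)
    rw [add_zero] at h2
    refine h2.1 (h1.congr_fun (fun u _ => ?_) measurableSet_Ioi)
    simp only
    rw [add_sub_cancel_left]
  have hm := ((h 0).mono_set (Ioi_subset_Ioi hσ)).aestronglyMeasurable
  simp only [pow_zero, one_mul] at hm
  refine Integrable.mono ((h n).mono_set (Ioi_subset_Ioi hσ))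
    ((by fun_prop : Continuous fun v : ℝ => (v - σ) ^ n).aestronglyMeasurable.mul hm) ?_
  refine (ae_restrict_iff' measurableSet_Ioi).2 (Eventually.of_forall fun v hv => ?_)
  have hv : σ < v := hv
  rw [norm_mul, norm_mul, norm_pow, norm_pow, Real.norm_of_nonneg (by linarith : 0 ≤ v - σ),
    Real.norm_of_nonneg (by linarith : 0 ≤ v - 1 / 2)]
  have : v - σ ≤ v - 1 / 2 := by linarith
  have h0 : 0 ≤ v - σ := by linarith
  gcongr

/-- Cauchy's formula for repeated integration; the lower limit must be at least 1/2 for the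
integrability used in the exchange. -/
lemma iterLogZeta_succ_eq (hRH : RiemannHypothesis) (j : ℕ) {σ : ℝ} (hσ : 1 / 2 ≤ σ) :
    iterLogZeta (j + 1) σ =
      ∫ v in Ioi σ, (v - σ) ^ j / (j.factorial : ℝ) * Real.log ‖riemannZeta (v : ℂ)‖ := by
  induction j generalizing σ with
  | zero => simp [iterLogZeta]
  | succ j ih =>
    have hj : ((j : ℝ) + 1) ≠ 0 := by positivity
    have hw : ∀ r : ℝ, ∫ u in σ..r, (r - u) ^ j / (j.factorial : ℝ) =
        (r - σ) ^ (j + 1) / ((j + 1).factorial : ℝ) := fun r => by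
      rw [intervalIntegral.integral_comp_sub_left (fun v => v ^ j / (j.factorial : ℝ)) r, sub_self,
        intervalIntegral.integral_div, integral_pow, Nat.factorial_succ]
      push_cast
      field_simp
      ring
    have hm := (integrableOn_shift_pow_mul_log_zeta hRH 0 hσ).aestronglyMeasurable
    simp only [pow_zero, one_mul] at hm
    have h := (integral_tail_swap (a := σ) (φ := fun v : ℝ => Real.log ‖riemannZeta (v : ℂ)‖)
      (k := fun u r => (r - u) ^ j / (j.factorial : ℝ)) (by fun_prop)
      (fun u r _ hr => by have : 0 ≤ r - u := by linarith
                          positivity) hm (by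
        simp only [hw, smul_eq_mul]
        refine ((integrableOn_shift_pow_mul_log_zeta hRH (j + 1) hσ).div_const
          ((j + 1).factorial : ℝ)).congr (Eventually.of_forall fun v => ?_)
        simp only
        ring)).2
    simp only [hw, smul_eq_mul] at h
    rw [← h, iterLogZeta]
    refine setIntegral_congr_fun measurableSet_Ioi fun v hv => ?_
    exact ih (hσ.trans (le_of_lt hv))

lemma I_pow_two_mul (k : ℕ) : I ^ (2 * k) = (((-1) ^ k : ℝ) : ℂ) := by simp [pow_mul]

lemma I_pow_two_mul_im (k : ℕ) : (I ^ (2 * k)).im = 0 := by rw [I_pow_two_mul, ofReal_im]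

lemma I_pow_two_mul_add_one_im (k : ℕ) : (I ^ (2 * k + 1)).im = (-1) ^ k := by
  rw [pow_succ, I_pow_two_mul, im_ofReal_mul, I_im, mul_one]

/-- Merges the two parities into one formula, since exactly one of Im i^n and Im i^{n+1} vanishes.
-/
lemma delta_succ (hRH : RiemannHypothesis) (n : ℕ) :
    delta (n + 1) = 1 / (Real.pi * n.factorial) * ((I ^ (n + 1)).im *
      (∫ u in Ioi (0 : ℝ), u ^ n * Real.log ‖riemannZeta ((1 / 2 + u : ℝ) : ℂ)‖) +
      Real.pi * (I ^ n).im * ((1 / 2) ^ (n + 1) / (n + 1))) := by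
  have hn : ((n : ℝ) + 1) ≠ 0 := by positivity
  have hpi := Real.pi_ne_zero
  have hf : (n.factorial : ℝ) ≠ 0 := by positivity
  have hi : iterLogZeta (n + 1) (1 / 2) = 1 / (n.factorial : ℝ) *
      ∫ u in Ioi (0 : ℝ), u ^ n * Real.log ‖riemannZeta ((1 / 2 + u : ℝ) : ℂ)‖ := by
    rw [iterLogZeta_succ_eq hRH n le_rfl, ← integral_const_mul]
    have := integral_Ioi_add_left (fun v : ℝ => (v - 1 / 2) ^ n / (n.factorial : ℝ) *
      Real.log ‖riemannZeta (v : ℂ)‖) (1 / 2) 0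
    rw [add_zero] at this
    rw [this]
    refine setIntegral_congr_fun measurableSet_Ioi fun u _ => ?_
    rw [add_sub_cancel_left]
    ring
  unfold delta
  rcases Nat.even_or_odd' n with ⟨k, rfl | rfl⟩
  · have e1 : (I ^ (2 * k + 1)).im = (-1) ^ k := I_pow_two_mul_add_one_im k
    have e2 : (I ^ (2 * k)).im = 0 := I_pow_two_mul_im k
    rw [if_pos (odd_two_mul_add_one k), hi, e1, e2, show (2 * k + 1 - 1) / 2 = k by omega]
    field_simp
    ring
  · have e1 : (I ^ (2 * k + 1)).im = (-1) ^ k := I_pow_two_mul_add_one_im k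
    have e2 : (I ^ (2 * k + 1 + 1)).im = 0 := by
      rw [show 2 * k + 1 + 1 = 2 * (k + 1) by ring, I_pow_two_mul_im]
    rw [if_neg (by rw [Nat.not_odd_iff_even]; exact ⟨k + 1, by ring⟩), iterOne_eq, e1, e2,
      show (2 * k + 1 + 1 - 1) / 2 = k by omega, Nat.factorial_succ (2 * k + 1)]
    push_cast at hn ⊢
    field_simp
    ring

/-- The closed form of `S_n` as a moment of `ζ'/ζ`. -/
def momentArg (n : ℕ) (t : ℝ) : ℝ := -(1 / (Real.pi * n.factorial)) * (I ^ n * moment n t).im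

/-- The constants in `integral_moment_eq`, multiplied by i^n, have the imaginary part that
`delta_succ` cancels. -/
lemma integral_momentArg (hRH : RiemannHypothesis) {t : ℝ} (ht : 0 < t) (n : ℕ) :
    (∫ τ in 0..t, momentArg n τ) + delta (n + 1) = momentArg (n + 1) t := by
  have h := (integral_moment hRH ht n).1
  have e : ∫ τ in 0..t, momentArg n τ =
      -(1 / (Real.pi * n.factorial)) * (I ^ n * ∫ τ in 0..t, moment n τ).im := by
    simp only [momentArg]
    have h2 := imCLM.intervalIntegral_comp_comm (h.const_mul (I ^ n))
    rw [intervalIntegral.integral_const_mul] at h2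
    simp only [imCLM_apply] at h2
    rw [intervalIntegral.integral_const_mul, h2]
  have hn : ((n : ℝ) + 1) ≠ 0 := by positivity
  have hpi := Real.pi_ne_zero
  have hf : (n.factorial : ℝ) ≠ 0 := by positivity
  rw [e, delta_succ hRH, integral_moment_eq hRH ht, momentArg, Nat.factorial_succ]
  set Q := ∫ u in Ioi (0 : ℝ), u ^ n * Real.log ‖riemannZeta ((1 / 2 + u : ℝ) : ℂ)‖
  have e2 : I ^ n * (I * (moment (n + 1) t / (n + 1)) + I * (Q : ℂ) +
      Real.pi * ((1 / 2) ^ (n + 1) / (n + 1))) =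
      (I ^ (n + 1) * moment (n + 1) t) * ((1 / ((n : ℝ) + 1) : ℝ) : ℂ) + I ^ (n + 1) * (Q : ℂ) +
      I ^ n * ((Real.pi * ((1 / 2) ^ (n + 1) / (n + 1)) : ℝ) : ℂ) := by
    push_cast
    ring
  rw [e2, add_im, add_im, im_mul_ofReal, im_mul_ofReal, im_mul_ofReal]
  push_cast
  field_simp
  ring

/-- φ takes values in 2πℤ. If it were nonzero somewhere, it would pass through π or -π. -/
lemma eq_zero_of_exp_mul_I_eq_one {s : Set ℝ} (hs : IsPreconnected s) {φ : ℝ → ℝ} (hφ : ContinuousOn φ s)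
    (h1 : ∀ x ∈ s, exp (φ x * I) = 1) {x₀ : ℝ} (hx₀ : x₀ ∈ s) (h0 : φ x₀ = 0) {x : ℝ} (hx : x ∈ s) :
    φ x = 0 := by
  have hpi := Real.pi_pos
  have hne : exp (Real.pi * I) ≠ 1 := by rw [exp_pi_mul_I]; norm_num
  have hne' : exp ((-Real.pi : ℝ) * I) ≠ 1 := by
    rw [ofReal_neg, neg_mul, exp_neg, exp_pi_mul_I]; norm_num
  obtain ⟨n, hn⟩ := exp_eq_one_iff.1 (h1 x hx)
  have hn' : φ x = n * (2 * Real.pi) := by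
    have h2 : ((φ x : ℝ) : ℂ) = ((n * (2 * Real.pi) : ℝ) : ℂ) := by
      apply mul_right_cancel₀ I_ne_zero
      rw [hn]; push_cast; ring
    exact_mod_cast h2
  rcases lt_trichotomy n 0 with h | h | h
  · exfalso
    have hn1 : (n : ℝ) ≤ -1 := by exact_mod_cast (by omega : n ≤ -1)
    obtain ⟨y, hy, hy'⟩ := hs.intermediate_value hx hx₀ hφ
      (show -Real.pi ∈ Icc (φ x) (φ x₀) by rw [h0, hn']; constructor <;> nlinarith)
    exact hne' (hy' ▸ h1 y hy)
  · rw [hn', h]; simp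
  · exfalso
    have hn1 : (1 : ℝ) ≤ n := by exact_mod_cast (by omega : 1 ≤ n)
    obtain ⟨y, hy, hy'⟩ := hs.intermediate_value hx₀ hx hφ
      (show Real.pi ∈ Icc (φ x₀) (φ x) by rw [h0, hn']; constructor <;> nlinarith)
    exact hne (hy' ▸ h1 y hy)

lemma RegularRay.zeta_eq_norm_mul_exp {σ y : ℝ} (h : RegularRay σ y) :
    riemannZeta (σ + y * I) = ‖riemannZeta (σ + y * I)‖ * exp ((logZeta σ y).im * I) := by
  rw [← h.exp_logZeta, norm_exp, ofReal_exp, ← exp_add, re_add_im]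

lemma logDeriv_zeta_ofReal_im {r : ℝ} (hr : 1 < r) : (logDeriv riemannZeta r).im = 0 := by
  have hr' : (r : ℂ) ≠ 1 := by exact_mod_cast hr.ne'
  rw [logDeriv_zeta_eq_reg (by rw [ofReal_re]; linarith) hr'
    (riemannZeta_ne_zero_of_one_lt_re (by simpa using hr)), sub_im, regLogDeriv_ofReal_im (by linarith)]
  norm_cast

lemma continuous_logZeta_two : Continuous fun y : ℝ => logZeta 2 y := by
  obtain ⟨D, hD, hfar⟩ := exists_norm_logDeriv_zeta_le_exp
  refine Continuous.neg ?_
  refine continuous_of_dominated (bound := fun r => D * Real.exp (-r / 2)) (fun y => ?_) (fun y => ?_)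
    ((integrableOn_exp_neg_half 2).const_mul D) ?_
  · exact ((regularRay_of_one_lt one_lt_two y).continuousOn.mono Ioi_subset_Ici_self).aestronglyMeasurable
      measurableSet_Ioi
  · refine (ae_restrict_iff' measurableSet_Ioi).2 (Eventually.of_forall fun r hr => ?_)
    simpa using hfar (r + y * I) (by simpa using le_of_lt hr)
  · refine (ae_restrict_iff' measurableSet_Ioi).2 (Eventually.of_forall fun r hr => ?_)
    have hr : 2 < r := hr
    rw [continuous_iff_continuousAt]
    intro y
    have h := regularRay_of_one_lt (by linarith : 1 < r) y r le_rfl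
    exact (continuousAt_logDeriv_zeta h.1 h.2).comp (f := fun y : ℝ => (r + y * I : ℂ)) (by fun_prop)

lemma logZeta_two_zero_im : (logZeta 2 0).im = 0 := by
  have hi := (regularRay_of_one_lt one_lt_two 0).integrableOn
  have h2 := imCLM.integral_comp_comm hi
  simp only [imCLM_apply] at h2
  rw [logZeta, neg_im, ← h2, neg_eq_zero]
  refine (setIntegral_congr_fun measurableSet_Ioi fun r hr => ?_).trans (integral_zero ℝ ℝ)
  have hr : 2 < r := hr
  simpa using logDeriv_zeta_ofReal_im (by linarith : 1 < r)

lemma RegularRay.continuousOn_logZeta {σ₀ σ₁ y : ℝ} (h : RegularRay σ₀ y) :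
    ContinuousOn (fun σ => logZeta σ y) (Icc σ₀ σ₁) := by
  have h1 : ContinuousOn (fun σ => logZeta σ₀ y +
      ∫ r in Ioc σ₀ σ, logDeriv riemannZeta (r + y * I)) (Icc σ₀ σ₁) :=
    continuousOn_const.add (intervalIntegral.continuousOn_primitive
      ((h.continuousOn.mono Icc_subset_Ici_self).integrableOn_Icc))
  refine h1.congr fun σ hσ => ?_
  beta_reduce
  rw [← intervalIntegral.integral_of_le hσ.1, ← h.logZeta_sub hσ.1]
  ring

lemma regularRay_of_not_ordinate {t : ℝ} (ht : 0 < t) (ho : ¬ IsOrdinate t) (σ : ℝ) : RegularRay σ t :=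
  fun r _ => ⟨fun h => ht.ne' (by simpa using congrArg im h), fun h => ho ⟨_, h, by simp⟩⟩

/-- The branch continued from +∞ is real at 2 and continuous along both segments, so it is the
argument prescribed in the definition. -/
lemma isArgValue_logZeta {t : ℝ} (ht : 0 < t) (ho : ¬ IsOrdinate t) :
    IsArgValue t (logZeta (1 / 2) t).im := by
  have h2 : ∀ y, RegularRay 2 y := regularRay_of_one_lt one_lt_two
  have hr := regularRay_of_not_ordinate ht ho
  refine ⟨fun y => (logZeta 2 y).im, fun σ => (logZeta σ t).im,
    (continuous_im.comp continuous_logZeta_two).continuousOn,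
    continuous_im.comp_continuousOn (hr (1 / 2)).continuousOn_logZeta, logZeta_two_zero_im,
    fun y _ => ?_, rfl, fun σ _ => ⟨(hr σ σ le_rfl).2, (hr σ).zeta_eq_norm_mul_exp⟩, rfl⟩
  have h3 := (h2 y 2 le_rfl).2
  have h4 := (h2 y).zeta_eq_norm_mul_exp
  push_cast at h3 h4
  exact ⟨h3, h4⟩

lemma exp_sub_mul_I_eq_one {z : ℂ} {a b : ℝ} (hz : z ≠ 0) (ha : z = ‖z‖ * exp (a * I))
    (hb : z = ‖z‖ * exp (b * I)) : exp ((a - b : ℝ) * I) = 1 := by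
  have hn : (‖z‖ : ℂ) ≠ 0 := by exact_mod_cast norm_ne_zero_iff.2 hz
  have h : exp (a * I) = exp (b * I) := mul_left_cancel₀ hn (ha.symm.trans hb)
  rw [ofReal_sub, sub_mul, exp_sub, h, div_self (exp_ne_zero _)]

lemma IsArgValue.unique {t a b : ℝ} (ht : 0 < t) (ha : IsArgValue t a) (hb : IsArgValue t b) : a = b := by
  obtain ⟨α, β, hα, hβ, hα0, hα1, hβ2, hβ1, rfl⟩ := ha
  obtain ⟨α', β', hα', hβ', hα0', hα1', hβ2', hβ1', rfl⟩ := hb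
  have h1 := eq_zero_of_exp_mul_I_eq_one isPreconnected_Icc (hα.sub hα')
    (fun y hy => exp_sub_mul_I_eq_one (hα1 y hy).1 (hα1 y hy).2 (hα1' y hy).2)
    (left_mem_Icc.2 ht.le) (by simp [hα0, hα0']) (right_mem_Icc.2 ht.le)
  have h2 := eq_zero_of_exp_mul_I_eq_one isPreconnected_Icc (hβ.sub hβ')
    (fun y hy => exp_sub_mul_I_eq_one (hβ1 y hy).1 (hβ1 y hy).2 (hβ1' y hy).2)
    (right_mem_Icc.2 (by norm_num)) (by simpa [hβ2, hβ2'] using h1) (left_mem_Icc.2 (by norm_num))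
  simpa [sub_eq_zero] using h2

lemma S_eq_momentArg {t : ℝ} (ht : 0 < t) (ho : ¬ IsOrdinate t) : S t = momentArg 0 t := by
  have h : IsArgValue t (argZeta t) := Classical.epsilon_spec ⟨_, isArgValue_logZeta ht ho⟩
  rw [S, if_neg ho, h.unique ht (isArgValue_logZeta ht ho), momentArg, moment]
  have := logZeta_half_add 0 t
  rw [add_zero] at this
  rw [this]
  simp
  ring

lemma countable_ordinates (hRH : RiemannHypothesis) : {t : ℝ | 0 < t ∧ IsOrdinate t}.Countable := by
  refine (countable_range NontrivialZero.ordinate).mono ?_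
  rintro t ⟨ht, s, hs, hst⟩
  have hre : s.re = 1 / 2 := by
    refine hRH s hs ?_ ?_
    · rintro ⟨n, rfl⟩
      simp at hst
      exact ht.ne hst
    · rintro rfl
      simp at hst
      exact ht.ne hst
  exact ⟨⟨s, hs, by rw [hre]; norm_num, by rw [hre]; norm_num⟩, hst⟩

/-- Under the Riemann hypothesis `S_n` is a moment of `ζ'/ζ`. -/
theorem Sn_eq_momentArg (hRH : RiemannHypothesis) (n : ℕ) {t : ℝ} (ht : 0 < t) :
    Sn (n + 1) t = momentArg (n + 1) t := by
  induction n generalizing t with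
  | zero =>
    rw [← integral_momentArg hRH ht 0, Sn]
    congr 1
    refine intervalIntegral.integral_congr_ae ?_
    -- The ordinates form a null set, so the limiting values of `S` there play no role in the
    -- integral.
    filter_upwards [(countable_ordinates hRH).ae_notMem volume] with τ hτ hτ'
    rw [uIoc_of_le ht.le] at hτ'
    rw [Sn]
    exact S_eq_momentArg hτ'.1 fun h => hτ ⟨hτ'.1, h⟩
  | succ n ih =>
    rw [← integral_momentArg hRH ht (n + 1), Sn]
    congr 1
    refine intervalIntegral.integral_congr_ae (Eventually.of_forall fun τ hτ => ?_)
    rw [uIoc_of_le ht.le] at hτ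
    exact ih hτ.1

end ZetaArgument

end

/-! ### The weights in y: kernel bounds and the constant μ_n. -/

noncomputable section

namespace ZetaArgument

open Complex Set Filter Topology MeasureTheory ComplexConjugate

/-- The denominator `e^y + (-1)^{n+1} e^{-y}`. -/
def denom (n : ℕ) (y : ℝ) : ℝ := Real.exp y + (-1) ^ (n + 1) * Real.exp (-y)

/-- For even k the denominator is 2 cosh y. For odd k it is 2 sinh y, whose zero at the origin is
absorbed by y^k since then k ≥ 1. -/
lemma pow_div_denom_le (k : ℕ) {y : ℝ} (hy : 0 < y) :
    0 < denom (k + 1) y ∧ y ^ k / denom (k + 1) y ≤ (1 + y) ^ (k + 1) * Real.exp (-y) := by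
  have he : Real.exp y * Real.exp (-y) = 1 := by rw [← Real.exp_add]; simp
  have hp := Real.exp_pos y
  have hm := Real.exp_pos (-y)
  rcases Nat.even_or_odd k with hk | hk
  · have e : denom (k + 1) y = Real.exp y + Real.exp (-y) := by
      rw [denom, (hk.add (by norm_num : Even 2)).neg_one_pow, one_mul]
    have hd : 0 < denom (k + 1) y := by rw [e]; positivity
    refine ⟨hd, ?_⟩
    rw [div_le_iff₀ hd, e]
    have h1 : y ^ k ≤ (1 + y) ^ (k + 1) := by
      calc y ^ k ≤ (1 + y) ^ k := by gcongr; linarith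
        _ ≤ (1 + y) ^ (k + 1) := pow_le_pow_right₀ (by linarith) (by omega)
    calc y ^ k ≤ (1 + y) ^ (k + 1) * 1 := by linarith
      _ ≤ (1 + y) ^ (k + 1) * (Real.exp (-y) * (Real.exp y + Real.exp (-y))) := by
        gcongr
        nlinarith
      _ = _ := by ring
  · have e : denom (k + 1) y = Real.exp y - Real.exp (-y) := by
      rw [denom, (hk.add_even (by norm_num : Even 2)).neg_one_pow]; ring
    have hlt : Real.exp (-y) < Real.exp y := Real.exp_lt_exp.2 (by linarith)
    have hd : 0 < denom (k + 1) y := by rw [e]; linarith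
    refine ⟨hd, ?_⟩
    obtain ⟨j, rfl⟩ : ∃ j, k = j + 1 := ⟨k - 1, by have := hk.pos; omega⟩
    rw [div_le_iff₀ hd, e]
    have h2 : y ≤ (1 + y) * (Real.exp (-y) * (Real.exp y - Real.exp (-y))) := by
      have h3 : 1 + 2 * y ≤ Real.exp (2 * y) := by
        have := Real.add_one_le_exp (2 * y)
        linarith
      have h4 : Real.exp (-y) * Real.exp (-y) = (Real.exp (2 * y))⁻¹ := by
        rw [← Real.exp_add, ← Real.exp_neg]; ring_nf
      have h5 : (Real.exp (2 * y))⁻¹ ≤ (1 + 2 * y)⁻¹ := inv_anti₀ (by linarith) h3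
      have h6 : Real.exp (-y) * (Real.exp y - Real.exp (-y)) = 1 - (Real.exp (2 * y))⁻¹ := by
        rw [mul_sub, h4, mul_comm, he]
      rw [h6]
      calc y ≤ (1 + y) * (1 - (1 + 2 * y)⁻¹) := by
            have h7 : (1 + y) * (1 - (1 + 2 * y)⁻¹) - y = y / (1 + 2 * y) := by
              have : 1 + 2 * y ≠ 0 := by linarith
              field_simp
              ring
            have h8 : 0 ≤ y / (1 + 2 * y) := by positivity
            linarith
        _ ≤ _ := by gcongr
    calc y ^ (j + 1) = y ^ j * y := pow_succ _ _
      _ ≤ (1 + y) ^ (j + 1) * ((1 + y) * (Real.exp (-y) * (Real.exp y - Real.exp (-y)))) := by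
        refine mul_le_mul ?_ h2 hy.le (by positivity)
        calc y ^ j ≤ (1 + y) ^ j := by gcongr; linarith
          _ ≤ (1 + y) ^ (j + 1) := pow_le_pow_right₀ (by linarith) (by omega)
      _ = _ := by ring

lemma continuous_denom (n : ℕ) : Continuous (denom n) := by unfold denom; fun_prop

lemma integrableOn_one_add_pow_mul_exp (m : ℕ) {c : ℝ} (hc : 0 < c) :
    IntegrableOn (fun y : ℝ => (1 + y) ^ m * Real.exp (-c * y)) (Ioi 0) := by
  have h := integrableOn_rpow_mul_exp_neg_mul_rpow (p := 1) (s := m) (b := c)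
    (by have : (0 : ℝ) ≤ m := by positivity
        linarith) one_pos hc
  have h1 := (integrableOn_Ioi_add_left _ 1 0).2 (h.mono_set (Ioi_subset_Ioi (by norm_num : (0 : ℝ) ≤ 1 + 0)))
  refine IntegrableOn.congr_fun (h1.const_mul (Real.exp c)) (fun y _ => ?_) measurableSet_Ioi
  simp only [Real.rpow_natCast, Real.rpow_one]
  rw [mul_left_comm, ← Real.exp_add]
  ring_nf

lemma integrableOn_weight (k j : ℕ) {g : ℝ → ℝ} (hg : ContinuousOn g (Ioi 0)) {B c : ℝ} (hc : 0 < c)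
    (hB : ∀ y, 0 < y → |g y| ≤ B * (1 + y) ^ j * Real.exp ((1 - c) * y)) :
    IntegrableOn (fun y : ℝ => y ^ k * g y / denom (k + 1) y) (Ioi 0) := by
  refine Integrable.mono' ((integrableOn_one_add_pow_mul_exp (k + 1 + j) hc).const_mul B)
    (ContinuousOn.aestronglyMeasurable ?_ measurableSet_Ioi) ?_
  · exact ((continuous_pow k).continuousOn.mul hg).div (continuous_denom _).continuousOn
      fun y hy => (pow_div_denom_le k hy).1.ne'
  · refine (ae_restrict_iff' measurableSet_Ioi).2 (Eventually.of_forall fun y hy => ?_)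
    have hy : 0 < y := hy
    obtain ⟨hd, hle⟩ := pow_div_denom_le k hy
    rw [Real.norm_eq_abs, mul_div_right_comm, abs_mul, abs_of_nonneg (by positivity)]
    calc y ^ k / denom (k + 1) y * |g y|
        ≤ ((1 + y) ^ (k + 1) * Real.exp (-y)) * (B * (1 + y) ^ j * Real.exp ((1 - c) * y)) :=
          mul_le_mul hle (hB y hy) (abs_nonneg _) (by positivity)
      _ = B * ((1 + y) ^ (k + 1 + j) * (Real.exp (-y) * Real.exp ((1 - c) * y))) := by
          rw [pow_add]; ring
      _ = _ := by rw [← Real.exp_add]; ring_nf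

lemma kernel_eq (k : ℕ) (v : ℝ) :
    kernel (k + 1) v = ∫ y in Ioi (0 : ℝ), y ^ k * (2 * y ^ 2 / (y ^ 2 + v ^ 2)) / denom (k + 1) y := by
  unfold kernel
  refine setIntegral_congr_fun measurableSet_Ioi fun y _ => ?_
  simp only [denom]
  ring

lemma kernel_integrand_le (v : ℝ) {y : ℝ} (hy : 0 < y) :
    2 * y ^ 2 / (y ^ 2 + v ^ 2) ≤ 1 / (1 + v ^ 2) * (2 * (1 + y ^ 2)) := by
  rw [div_le_iff₀ (by positivity), one_div_mul_eq_div, div_mul_eq_mul_div, le_div_iff₀ (by positivity)]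
  nlinarith [mul_pos hy hy, sq_nonneg v, sq_nonneg (y ^ 2)]

lemma integrableOn_kernel_integrand (k : ℕ) (v : ℝ) :
    IntegrableOn (fun y : ℝ => y ^ k * (2 * y ^ 2 / (y ^ 2 + v ^ 2)) / denom (k + 1) y) (Ioi 0) := by
  refine integrableOn_weight k 0 (B := 2) (c := 1) ?_ one_pos fun y hy => ?_
  · refine ContinuousOn.div (by fun_prop) (by fun_prop) fun y hy => ?_
    have hy : 0 < y := hy
    positivity
  · rw [abs_of_nonneg (by positivity)]
    simp
    rw [div_le_iff₀ (by positivity)]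
    nlinarith [sq_nonneg v]

/-- Quadratic decay in v makes the sum over zeros converge absolutely. -/
lemma exists_kernel_le (k : ℕ) : ∃ K : ℝ, 0 ≤ K ∧ ∀ v : ℝ, 0 ≤ kernel (k + 1) v ∧
    kernel (k + 1) v ≤ K * (1 / (1 + v ^ 2)) := by
  have hI : IntegrableOn (fun y : ℝ => y ^ k * (2 * (1 + y ^ 2)) / denom (k + 1) y) (Ioi 0) := by
    refine integrableOn_weight k 2 (B := 2) (c := 1) (by fun_prop) one_pos fun y hy => ?_
    rw [abs_of_nonneg (by positivity)]
    simp
    nlinarith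
  have hd : ∀ y ∈ Ioi (0 : ℝ), 0 < denom (k + 1) y := fun y hy => (pow_div_denom_le k hy).1
  refine ⟨∫ y in Ioi (0 : ℝ), y ^ k * (2 * (1 + y ^ 2)) / denom (k + 1) y,
    setIntegral_nonneg measurableSet_Ioi fun y hy => ?_, fun v => ⟨?_, ?_⟩⟩
  · have := hd y hy
    have hy : 0 < y := hy
    positivity
  · rw [kernel_eq]
    refine setIntegral_nonneg measurableSet_Ioi fun y hy => ?_
    have := hd y hy
    have hy : 0 < y := hy
    positivity
  · rw [kernel_eq, ← integral_mul_const]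
    refine setIntegral_mono_on (integrableOn_kernel_integrand k v) (hI.mul_const _) measurableSet_Ioi
      fun y hy => ?_
    have h := hd y hy
    have hy : 0 < y := hy
    calc y ^ k * (2 * y ^ 2 / (y ^ 2 + v ^ 2)) / denom (k + 1) y
        ≤ y ^ k * (1 / (1 + v ^ 2) * (2 * (1 + y ^ 2))) / denom (k + 1) y := by
          have := kernel_integrand_le v hy
          gcongr
      _ = _ := by ring

lemma integral_pow_mul_exp_neg (n : ℕ) {a : ℝ} (ha : 0 < a) :
    ∫ y in Ioi (0 : ℝ), y ^ n * Real.exp (-(a * y)) = n.factorial * (1 / a ^ (n + 1)) := by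
  have h := Real.integral_rpow_mul_exp_neg_mul_Ioi (a := n + 1) (r := a) (by positivity) ha
  rw [Real.Gamma_nat_eq_factorial] at h
  have e : (1 / a) ^ ((n : ℝ) + 1) = 1 / a ^ (n + 1) := by
    rw [← Nat.cast_succ, Real.rpow_natCast, one_div_pow]
  rw [e] at h
  rw [mul_comm, ← h]
  refine setIntegral_congr_fun measurableSet_Ioi fun y _ => ?_
  simp

lemma integrableOn_pow_mul_exp_neg (n : ℕ) {a : ℝ} (ha : 0 < a) :
    IntegrableOn (fun y : ℝ => y ^ n * Real.exp (-(a * y))) (Ioi 0) := by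
  have h := integrableOn_rpow_mul_exp_neg_mul_rpow (p := 1) (s := n) (b := a)
    (by have : (0 : ℝ) ≤ n := by positivity
        linarith) one_pos ha
  refine h.congr_fun (fun u _ => ?_) measurableSet_Ioi
  simp only [Real.rpow_natCast, Real.rpow_one]
  ring_nf

lemma zeta_nat_re {n : ℕ} (hn : 1 ≤ n) :
    (riemannZeta ((n : ℂ) + 1)).re = ∑' k : ℕ, 1 / ((k : ℝ) + 1) ^ (n + 1) ∧
      Summable fun k : ℕ => 1 / ((k : ℝ) + 1) ^ (n + 1) := by
  have hs : Summable fun k : ℕ => 1 / ((k : ℝ) + 1) ^ (n + 1) := by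
    have := (summable_nat_add_iff 1).2 (Real.summable_one_div_nat_pow (p := n + 1) |>.2 (by omega))
    simpa using this
  refine ⟨?_, hs⟩
  have h := zeta_eq_tsum_one_div_nat_add_one_cpow (s := (n : ℂ) + 1) (by simp; omega)
  have e : (fun k : ℕ => 1 / ((k : ℂ) + 1) ^ ((n : ℂ) + 1)) =
      fun k : ℕ => ((1 / ((k : ℝ) + 1) ^ (n + 1) : ℝ) : ℂ) := by
    funext k
    rw [show (n : ℂ) + 1 = ((n + 1 : ℕ) : ℂ) by push_cast; rfl, cpow_natCast]
    push_cast
    rfl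
  rw [h, e, ← ofReal_tsum, ofReal_re]

lemma integral_pow_div_exp_sub_one {n : ℕ} (hn : 1 ≤ n) {a : ℝ} (ha : 0 < a) :
    IntegrableOn (fun y : ℝ => y ^ n * (1 / (Real.exp (a * y) - 1))) (Ioi 0) ∧
    ∫ y in Ioi (0 : ℝ), y ^ n * (1 / (Real.exp (a * y) - 1)) =
      n.factorial * (1 / a ^ (n + 1)) * (riemannZeta ((n : ℂ) + 1)).re := by
  obtain ⟨hz, hs⟩ := zeta_nat_re hn
  have hk : ∀ k : ℕ, 0 < a * ((k : ℝ) + 1) := fun k => by positivity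
  have hval : ∀ k : ℕ, ∫ y in Ioi (0 : ℝ), y ^ n * Real.exp (-(a * ((k : ℝ) + 1) * y)) =
      n.factorial * (1 / a ^ (n + 1)) * (1 / ((k : ℝ) + 1) ^ (n + 1)) := fun k => by
    rw [integral_pow_mul_exp_neg n (hk k), mul_pow]
    field_simp
  have hnorm : ∀ k : ℕ, ∫ y in Ioi (0 : ℝ), ‖y ^ n * Real.exp (-(a * ((k : ℝ) + 1) * y))‖ =
      n.factorial * (1 / a ^ (n + 1)) * (1 / ((k : ℝ) + 1) ^ (n + 1)) := fun k => by
    rw [← hval k]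
    refine setIntegral_congr_fun measurableSet_Ioi fun y hy => ?_
    have hy : 0 < y := hy
    exact Real.norm_of_nonneg (by positivity)
  have hsum : ∀ y ∈ Ioi (0 : ℝ), HasSum (fun k : ℕ => y ^ n * Real.exp (-(a * ((k : ℝ) + 1) * y)))
      (y ^ n * (1 / (Real.exp (a * y) - 1))) := fun y hy => by
    have hy : 0 < y := hy
    have hlt : Real.exp (-(a * y)) < 1 := Real.exp_lt_one_iff.2 (by have := mul_pos ha hy; linarith)
    have hgt : 1 < Real.exp (a * y) := Real.one_lt_exp_iff.2 (mul_pos ha hy)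
    have hg := ((hasSum_geometric_of_lt_one (Real.exp_nonneg _) hlt).mul_left (Real.exp (-(a * y)))).mul_left
      (y ^ n)
    have e1 : Real.exp (-(a * y)) * (1 - Real.exp (-(a * y)))⁻¹ = 1 / (Real.exp (a * y) - 1) := by
      rw [Real.exp_neg]
      have h1 : Real.exp (a * y) ≠ 0 := by positivity
      have h2 : Real.exp (a * y) - 1 ≠ 0 := by linarith
      have h3 : 1 - (Real.exp (a * y))⁻¹ ≠ 0 := by rw [← Real.exp_neg]; linarith
      field_simp
    rw [e1] at hg
    refine hg.congr_fun fun k => ?_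
    rw [← Real.exp_nat_mul, ← Real.exp_add]
    ring_nf
  have hF : ∀ k : ℕ, IntegrableOn (fun y : ℝ => y ^ n * Real.exp (-(a * ((k : ℝ) + 1) * y))) (Ioi 0) :=
    fun k => integrableOn_pow_mul_exp_neg n (hk k)
  have hsn : Summable fun k : ℕ => ∫ y in Ioi (0 : ℝ), ‖y ^ n * Real.exp (-(a * ((k : ℝ) + 1) * y))‖ := by
    simp only [hnorm]
    exact hs.mul_left _
  have hI := hasSum_integral_of_summable_integral_norm hF hsn
  have e : ∫ y in Ioi (0 : ℝ), ∑' k : ℕ, y ^ n * Real.exp (-(a * ((k : ℝ) + 1) * y)) =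
      ∫ y in Ioi (0 : ℝ), y ^ n * (1 / (Real.exp (a * y) - 1)) :=
    setIntegral_congr_fun measurableSet_Ioi fun y hy => (hsum y hy).tsum_eq
  have hv : ∫ y in Ioi (0 : ℝ), y ^ n * (1 / (Real.exp (a * y) - 1)) =
      n.factorial * (1 / a ^ (n + 1)) * (riemannZeta ((n : ℂ) + 1)).re := by
    rw [← e, ← hI.tsum_eq]
    simp only [hval]
    rw [tsum_mul_left, hz]
  refine ⟨?_, hv⟩
  -- The integral of a non-integrable function is zero by convention, whereas the value found is
  -- positive.
  by_contra h
  have h0 := integral_undef h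
  rw [hv, hz] at h0
  have hpos : 0 < ∑' k : ℕ, 1 / ((k : ℝ) + 1) ^ (n + 1) :=
    hs.tsum_pos (fun k => by positivity) 0 (by simp)
  have : 0 < (n.factorial : ℝ) * (1 / a ^ (n + 1)) * ∑' k : ℕ, 1 / ((k : ℝ) + 1) ^ (n + 1) := by positivity
  exact this.ne' h0

/-- For odd n the quotient is 1/(e^{2y}+1) = 1/(e^{2y}-1) - 2/(e^{4y}-1), and each part is a Bose
integral with value a multiple of ζ(n+1). -/
lemma integral_pow_mul_exp_neg_div_denom {n : ℕ} (hn : Odd n) :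
    ∫ y in Ioi (0 : ℝ), y ^ n * Real.exp (-y) / denom n y = n.factorial * mu n := by
  have hn1 : 1 ≤ n := hn.pos
  obtain ⟨i2, h2⟩ := integral_pow_div_exp_sub_one hn1 (a := 2) two_pos
  obtain ⟨i4, h4⟩ := integral_pow_div_exp_sub_one hn1 (a := 4) four_pos
  have e : ∀ y ∈ Ioi (0 : ℝ), y ^ n * Real.exp (-y) / denom n y =
      y ^ n * (1 / (Real.exp (2 * y) - 1)) - 2 * (y ^ n * (1 / (Real.exp (4 * y) - 1))) := fun y hy => by
    have hy : 0 < y := hy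
    set q := Real.exp y
    have hq : 1 < q := Real.one_lt_exp_iff.2 hy
    have q2 : Real.exp (2 * y) = q ^ 2 := by rw [← Real.exp_nat_mul]; norm_num
    have q4 : Real.exp (4 * y) = q ^ 4 := by rw [← Real.exp_nat_mul]; norm_num
    have n1 : q ^ 2 - 1 ≠ 0 := by nlinarith
    have n2 : q ^ 2 + 1 ≠ 0 := by positivity
    have n3 : q ≠ 0 := by positivity
    rw [denom, (hn.add_odd odd_one).neg_one_pow, Real.exp_neg, q2, q4,
      show q ^ 4 - 1 = (q ^ 2 - 1) * (q ^ 2 + 1) by ring]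
    change y ^ n * q⁻¹ / (q + 1 * q⁻¹) = _
    have n4 : q + 1 * q⁻¹ ≠ 0 := by positivity
    field_simp
    ring
  rw [setIntegral_congr_fun measurableSet_Ioi e, integral_sub i2 (i4.const_mul 2), integral_const_mul, h2, h4,
    mu, if_pos hn]
  have p4 : (4 : ℝ) ^ (n + 1) = 2 ^ (n + 1) * 2 ^ (n + 1) := by rw [← mul_pow]; norm_num
  rw [p4, inv_pow, inv_pow, pow_succ (2 : ℝ) n]
  field_simp

end ZetaArgument

end

/-! ### Estimates for the individual terms of the symmetrized formula. -/

noncomputable section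

namespace ZetaArgument

open Complex Set Filter Topology MeasureTheory ComplexConjugate

/-- Conjugating z multiplies Im(i^n z) by (-1)^{n+1}; this is where the denominators of the theorem
originate. -/
lemma im_I_pow_mul_symm (n : ℕ) (z : ℂ) (y : ℝ) :
    (I ^ n * (z * exp y + conj z * exp (-y))).im = (I ^ n * z).im * denom n y := by
  have h : (I ^ n * conj z).im = (-1) ^ (n + 1) * (I ^ n * z).im := by
    rcases Nat.even_or_odd' n with ⟨k, rfl | rfl⟩
    · rw [I_pow_two_mul, im_ofReal_mul, im_ofReal_mul, conj_im, (odd_two_mul_add_one k).neg_one_pow]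
      ring
    · rw [pow_succ, I_pow_two_mul, mul_assoc, mul_assoc, im_ofReal_mul, im_ofReal_mul, I_mul_im, I_mul_im,
        conj_re, show 2 * k + 1 + 1 = 2 * (k + 1) by ring, (even_two_mul _).neg_one_pow, one_mul]
  rw [mul_add, ← mul_assoc, ← mul_assoc, add_im, ← ofReal_neg, ← ofReal_exp, ← ofReal_exp, im_mul_ofReal,
    im_mul_ofReal, h, denom]
  ring

lemma norm_I_pow_mul (n : ℕ) (z : ℂ) : |(I ^ n * z).im| ≤ ‖z‖ := by
  refine (abs_im_le_norm _).trans (le_of_eq ?_)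
  rw [norm_mul, norm_pow, norm_I, one_pow, one_mul]

/-- The contribution of the trivial zeros to the symmetrized explicit formula. -/
def trivialPart (u t X : ℝ) : ℂ :=
  ∑' k : ℕ, 2 * u / ((u : ℂ) ^ 2 - trivialPole t k ^ 2) * exp (trivialPole t k * X)

/-- The contribution of the pole of `ζ` to the symmetrized explicit formula. -/
def polePart (u t X : ℝ) : ℂ := 2 * u / ((u : ℂ) ^ 2 - zetaPole t ^ 2) * exp (zetaPole t * X)

/-- Both linear factors have modulus at least t. One of them is only used as a bound by 1, since a
single power of t is needed. -/
lemma norm_weight_le {u t : ℝ} {a : ℂ} (hu : 0 < u) (ht : 1 ≤ t) (ha : a.im = -t) :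
    ‖2 * u / ((u : ℂ) ^ 2 - a ^ 2)‖ ≤ 2 * u / t := by
  have h1 : t ≤ ‖(u : ℂ) - a‖ := by
    have := (le_abs_self _).trans (abs_im_le_norm ((u : ℂ) - a))
    simpa [ha] using this
  have h2 : t ≤ ‖(u : ℂ) + a‖ := by
    have := (neg_le_abs _).trans (abs_im_le_norm ((u : ℂ) + a))
    simpa [ha] using this
  rw [show (u : ℂ) ^ 2 - a ^ 2 = (u - a) * (u + a) by ring, norm_div, norm_mul, norm_mul, Complex.norm_ofNat,
    norm_real, Real.norm_of_nonneg hu.le]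
  have ht0 : 0 < t := by linarith
  calc 2 * u / (‖(u : ℂ) - a‖ * ‖(u : ℂ) + a‖) ≤ 2 * u / (t * 1) := by
        gcongr
        exact ht.trans h2
    _ = _ := by rw [mul_one]

lemma norm_polePart_le {u t x : ℝ} (hu : 0 < u) (ht : 1 ≤ t) (hx : 4 ≤ x) :
    ‖polePart u t (Real.log x)‖ ≤ 2 * u / t * √x := by
  have hx0 : 0 < x := by linarith
  rw [polePart, norm_mul, norm_exp]
  have e : (zetaPole t * Real.log x).re = Real.log x * (1 / 2) := by
    rw [re_mul_ofReal]; simp [zetaPole]; ring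
  rw [e, ← Real.rpow_def_of_pos hx0, ← Real.sqrt_eq_rpow]
  exact mul_le_mul_of_nonneg_right (norm_weight_le hu ht (by simp [zetaPole])) (Real.sqrt_nonneg _)

lemma norm_trivialPart_le {u t x : ℝ} (hu : 0 < u) (ht : 1 ≤ t) (hx : 4 ≤ x) :
    ‖trivialPart u t (Real.log x)‖ ≤ 2 * u / t := by
  have hx0 : 0 < x := by linarith
  have hL : 1 < Real.log x := by
    rw [Real.lt_log_iff_exp_lt hx0]
    have := Real.exp_one_lt_d9
    linarith
  have hg := ((hasSum_geometric_two.mul_left (1 / 2)).mul_left (2 * u / t))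
  have h2 : (2 * u / t) * (1 / 2 * 2) = 2 * u / t := by ring
  rw [h2] at hg
  refine tsum_of_norm_bounded hg fun k => ?_
  rw [norm_mul, norm_exp]
  have e : (trivialPole t k * Real.log x).re = -(2 * ((k : ℝ) + 1) + 1 / 2) * Real.log x := by
    rw [re_mul_ofReal]; simp [trivialPole]
  have ht0 : 0 < t := by linarith
  refine mul_le_mul (norm_weight_le hu ht (by simp [trivialPole])) ?_ (Real.exp_nonneg _) (by positivity)
  rw [e]
  have h3 : (1 / 2 : ℝ) * (1 / 2) ^ k = (Real.exp (-Real.log 2)) ^ (k + 1) := by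
    rw [Real.exp_neg, Real.exp_log two_pos, pow_succ]; norm_num; ring
  rw [h3, ← Real.exp_nat_mul]
  refine Real.exp_le_exp.2 ?_
  have hk : (0 : ℝ) ≤ k := by positivity
  have := Real.log_two_lt_d9
  push_cast
  nlinarith

open ArithmeticFunction in
-- The series is finite: Λ vanishes at 0 and 1, and the cutoff removes m > x.
lemma tsum_primes_eq {x : ℝ} (hx : 4 ≤ x) (t : ℝ) {y : ℝ} :
    ∑' m : ℕ, (Λ m : ℂ) * exp (-(1 / 2 + t * I) * Real.log m) *
        (if Real.log m ≤ Real.log x then exp ((y / Real.log x : ℝ) * (Real.log x - Real.log m)) -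
          exp (-(y / Real.log x : ℝ) * (Real.log x - Real.log m)) else 0) =
      ∑ m ∈ Finset.Icc 2 ⌊x⌋₊, (m : ℂ) ^ (-(I * (t : ℂ))) * ((Λ m / √(m : ℝ) *
        (2 * Real.sinh (y * (1 - Real.log m / Real.log x))) : ℝ) : ℂ) := by
  have hx0 : 0 < x := by linarith
  have hL : 0 < Real.log x := Real.log_pos (by linarith)
  rw [tsum_eq_sum (s := Finset.Icc 2 ⌊x⌋₊)]
  · refine Finset.sum_congr rfl fun m hm => ?_
    rw [Finset.mem_Icc] at hm
    have hm0 : 0 < (m : ℝ) := by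
      have : 0 < m := by omega
      exact_mod_cast this
    have hmx : (m : ℝ) ≤ x := (Nat.cast_le.2 hm.2).trans (Nat.floor_le hx0.le)
    rw [if_pos (Real.log_le_log hm0 hmx)]
    have hm1 : (m : ℂ) ≠ 0 := by
      have : m ≠ 0 := by omega
      exact_mod_cast this
    have e1 : exp (-(1 / 2 + t * I) * Real.log m) = (m : ℂ) ^ (-(I * (t : ℂ))) * ((1 / √(m : ℝ) : ℝ) : ℂ) := by
      rw [Real.sqrt_eq_rpow, one_div ((m : ℝ) ^ (1 / 2 : ℝ)), ← Real.rpow_neg hm0.le,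
        Real.rpow_def_of_pos hm0, ofReal_exp, cpow_def_of_ne_zero hm1, ← exp_add, ← natCast_log]
      congr 1
      push_cast
      ring
    have e2 : ((y / Real.log x : ℝ) : ℂ) * (Real.log x - Real.log m) =
        ((y * (1 - Real.log m / Real.log x) : ℝ) : ℂ) := by
      rw [← ofReal_sub, ← ofReal_mul]
      congr 1
      field_simp
    rw [neg_mul (((y / Real.log x : ℝ) : ℂ)), e2, e1, Real.sinh_eq]
    push_cast
    ring
  · intro m hm
    rw [Finset.mem_Icc, not_and_or, not_le, not_le] at hm
    rcases hm with hm | hm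
    · have : m = 0 ∨ m = 1 := by omega
      rcases this with rfl | rfl <;> simp
    · have hxm : x < m := (Nat.floor_lt hx0.le).1 hm
      rw [if_neg (not_le.2 (Real.log_lt_log hx0 hxm)), mul_zero]

lemma sqrt_bounds {x : ℝ} (hx : 4 ≤ x) : 1 < Real.log x ∧ Real.log x ≤ 2 * √x ∧ 1 ≤ √x := by
  have hx0 : 0 < x := by linarith
  have hs : 0 < √x := Real.sqrt_pos.2 hx0
  refine ⟨?_, ?_, ?_⟩
  · rw [Real.lt_log_iff_exp_lt hx0]
    have := Real.exp_one_lt_d9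
    linarith
  · have h1 : Real.log x = 2 * Real.log √x := by
      rw [Real.log_sqrt hx0.le]; ring
    have h2 := Real.log_le_sub_one_of_pos hs
    linarith
  · rw [Real.one_le_sqrt]; linarith

/-- Since L ≥ 1, the kernel is dominated by 1/(1 + (γ-t)²), the zero weight at u = 1. -/
lemma summable_mult_kernel (hRH : RiemannHypothesis) (k : ℕ) (t : ℝ) {L : ℝ} (hL : 1 ≤ L) :
    Summable fun ρ : NontrivialZero => (ρ.mult : ℝ) * kernel (k + 1) ((ρ.ordinate - t) * L) := by
  obtain ⟨K, hK, hk⟩ := exists_kernel_le k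
  refine Summable.of_nonneg_of_le (fun ρ => mul_nonneg (by positivity) (hk _).1) (fun ρ => ?_)
    ((summable_zero_weight hRH one_pos t).mul_left (K / 2))
  have h1 : (ρ.ordinate - t) ^ 2 ≤ ((ρ.ordinate - t) * L) ^ 2 := by
    rw [mul_pow]
    exact le_mul_of_one_le_right (sq_nonneg _) (one_le_pow₀ hL)
  calc (ρ.mult : ℝ) * kernel (k + 1) ((ρ.ordinate - t) * L)
      ≤ (ρ.mult : ℝ) * (K * (1 / (1 + (ρ.ordinate - t) ^ 2))) := by
        refine mul_le_mul_of_nonneg_left ((hk _).2.trans ?_) (by positivity)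
        gcongr
    _ = _ := by rw [one_pow]; ring

lemma zeroTerm_eq (n : ℕ) (t x : ℝ) (ρ : NontrivialZero) :
    zeroTerm n t x ρ = -((ρ.mult : ℝ) * kernel n ((ρ.ordinate - t) * Real.log x) *
      (I ^ n * exp ((ρ.ordinate - t : ℝ) * I * Real.log x)).im) := by
  rw [zeroTerm, pow_add, I_sq, show I * (((ρ.ordinate - t) * Real.log x : ℝ) : ℂ) =
    (ρ.ordinate - t : ℝ) * I * Real.log x by push_cast; ring]
  rw [mul_neg_one, neg_mul, neg_im]
  ring

lemma abs_im_phase_le (n : ℕ) (v L : ℝ) : |(I ^ n * exp ((v : ℂ) * I * L)).im| ≤ 1 := by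
  refine (norm_I_pow_mul n _).trans (le_of_eq ?_)
  rw [show (v : ℂ) * I * L = (v * L : ℝ) * I by push_cast; ring, norm_exp_ofReal_mul_I]

lemma summable_zeroTerm (hRH : RiemannHypothesis) {n : ℕ} (hn : 1 ≤ n) (t : ℝ) {x : ℝ} (hx : 4 ≤ x) :
    Summable (zeroTerm n t x) := by
  obtain ⟨k, rfl⟩ : ∃ k, n = k + 1 := ⟨n - 1, by omega⟩
  obtain ⟨K, hK, hk⟩ := exists_kernel_le k
  refine Summable.of_norm_bounded (summable_mult_kernel hRH k t (sqrt_bounds hx).1.le) fun ρ => ?_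
  rw [zeroTerm_eq, norm_neg, norm_mul, Real.norm_of_nonneg (mul_nonneg (by positivity) (hk _).1)]
  exact mul_le_of_le_one_right (mul_nonneg (by positivity) (hk _).1) (abs_im_phase_le _ _ _)

end ZetaArgument

end

/-! ### Integration over y and the final formula. -/

noncomputable section

namespace ZetaArgument

open Complex Set Filter Topology MeasureTheory ComplexConjugate

lemma integrable_tsum_of_summable_integral_norm {ι : Type*} [Countable ι] {F : ι → ℝ → ℝ} {s : Set ℝ}
    (hF : ∀ i, IntegrableOn (F i) s) (hm : ∀ i, Measurable (F i))
    (hs : Summable fun i => ∫ y in s, ‖F i y‖) : IntegrableOn (fun y => ∑' i, F i y) s := by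
  refine ⟨(Measurable.tsum hm).aestronglyMeasurable, ?_⟩
  have hle : ∀ y, ‖∑' i, F i y‖ₑ ≤ ∑' i, ‖F i y‖ₑ := fun y => by
    by_cases h : Summable fun i => F i y
    · have h1 : Summable fun i => ‖F i y‖ := h.norm
      rw [← ofReal_norm]
      refine (ENNReal.ofReal_le_ofReal (norm_tsum_le_tsum_norm h1)).trans (le_of_eq ?_)
      rw [ENNReal.ofReal_tsum_of_nonneg (fun _ => norm_nonneg _) h1]
      simp only [ofReal_norm]
    · rw [tsum_eq_zero_of_not_summable h]; simp
  refine (lintegral_mono hle).trans_lt ?_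
  rw [lintegral_tsum fun i => (hm i).enorm.aemeasurable]
  have e : ∀ i, ∫⁻ y in s, ‖F i y‖ₑ = ENNReal.ofReal (∫ y in s, ‖F i y‖) := fun i =>
    (ofReal_integral_norm_eq_lintegral_enorm (hF i)).symm
  simp only [e]
  rw [← ENNReal.ofReal_tsum_of_nonneg (fun i => integral_nonneg fun y => norm_nonneg _) hs]
  exact ENNReal.ofReal_lt_top

/-- The integrand belonging to a single zero. -/
def zeroIntegrand (k : ℕ) (t x : ℝ) (ρ : NontrivialZero) (y : ℝ) : ℝ :=
  (ρ.mult : ℝ) * (I ^ (k + 1) * exp ((ρ.ordinate - t : ℝ) * I * Real.log x)).im * Real.log x *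
    (y ^ k * (2 * y ^ 2 / (y ^ 2 + ((ρ.ordinate - t) * Real.log x) ^ 2)) / denom (k + 1) y)

lemma integral_zeroIntegrand (hRH : RiemannHypothesis) (k : ℕ) (t : ℝ) {x : ℝ} (hx : 4 ≤ x) :
    IntegrableOn (fun y => ∑' ρ, zeroIntegrand k t x ρ y) (Ioi 0) ∧
      ∫ y in Ioi (0 : ℝ), ∑' ρ, zeroIntegrand k t x ρ y = -Real.log x * ∑' ρ, zeroTerm (k + 1) t x ρ := by
  have hL := (sqrt_bounds hx).1
  have hF : ∀ ρ, IntegrableOn (zeroIntegrand k t x ρ) (Ioi 0) := fun ρ =>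
    (integrableOn_kernel_integrand k _).const_mul _
  have hm : ∀ ρ, Measurable (zeroIntegrand k t x ρ) := fun ρ => by
    have := (continuous_denom (k + 1)).measurable
    unfold zeroIntegrand
    fun_prop
  have hs : Summable fun ρ => ∫ y in Ioi (0 : ℝ), ‖zeroIntegrand k t x ρ y‖ := by
    refine Summable.of_nonneg_of_le (fun ρ => integral_nonneg fun y => norm_nonneg _) (fun ρ => ?_)
      ((summable_mult_kernel hRH k t hL.le).mul_left (Real.log x))
    rw [kernel_eq, ← mul_assoc, ← integral_const_mul]
    refine setIntegral_mono_on (hF ρ).norm ((integrableOn_kernel_integrand k _).const_mul _) measurableSet_Ioi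
      fun y hy => ?_
    have hd := (pow_div_denom_le k hy).1
    have hy : 0 < y := hy
    rw [zeroIntegrand, norm_mul]
    rw [Real.norm_of_nonneg (by positivity : 0 ≤ y ^ k * (2 * y ^ 2 / (y ^ 2 +
      ((ρ.ordinate - t) * Real.log x) ^ 2)) / denom (k + 1) y)]
    refine mul_le_mul_of_nonneg_right ?_ (by positivity)
    rw [norm_mul, norm_mul, Real.norm_natCast, Real.norm_of_nonneg (by linarith : 0 ≤ Real.log x),
      mul_comm (Real.log x)]
    refine mul_le_mul_of_nonneg_right ?_ (by linarith)
    exact mul_le_of_le_one_right (by positivity) (abs_im_phase_le _ _ _)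
  refine ⟨integrable_tsum_of_summable_integral_norm hF hm hs, ?_⟩
  rw [← (hasSum_integral_of_summable_integral_norm hF hs).tsum_eq, ← tsum_mul_left]
  refine tsum_congr fun ρ => ?_
  simp only [zeroIntegrand]
  rw [integral_const_mul, ← kernel_eq, zeroTerm_eq]
  ring

/-- Writes the zero part, after division by the denominator, as a series that can be integrated term
by term. -/
lemma im_tsum_zeros (hRH : RiemannHypothesis) (k : ℕ) (t : ℝ) {x y : ℝ} (hx : 4 ≤ x) (hy : 0 < y) :
    y ^ (k + 1) / denom (k + 1) y * (I ^ (k + 1) * ∑' ρ : NontrivialZero,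
      ((ρ.mult * (2 * (y / Real.log x) / ((y / Real.log x) ^ 2 + (ρ.ordinate - t) ^ 2)) : ℝ) : ℂ) *
          exp ((ρ.ordinate - t : ℝ) * I * Real.log x)).im = ∑' ρ, zeroIntegrand k t x ρ y := by
  have hL : 0 < Real.log x := by linarith [(sqrt_bounds hx).1]
  have hu : 0 < y / Real.log x := div_pos hy hL
  have s2 : Summable fun ρ : NontrivialZero =>
      ((ρ.mult * (2 * (y / Real.log x) / ((y / Real.log x) ^ 2 + (ρ.ordinate - t) ^ 2)) : ℝ) : ℂ) *
          exp ((ρ.ordinate - t : ℝ) * I * Real.log x) := by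
    refine Summable.of_norm_bounded (summable_zero_weight hRH hu t) fun ρ => ?_
    rw [norm_mul, norm_real, Real.norm_of_nonneg (by positivity),
      show ((ρ.ordinate - t : ℝ) : ℂ) * I * Real.log x = ((ρ.ordinate - t) * Real.log x : ℝ) * I by
        push_cast; ring,
      norm_exp_ofReal_mul_I, mul_one]
  rw [← tsum_mul_left, im_tsum (s2.mul_left _), ← tsum_mul_left]
  refine tsum_congr fun ρ => ?_
  rw [mul_left_comm, im_ofReal_mul, zeroIntegrand]
  have hq : (y / Real.log x) ^ 2 + (ρ.ordinate - t) ^ 2 =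
      (y ^ 2 + ((ρ.ordinate - t) * Real.log x) ^ 2) / Real.log x ^ 2 := by
    field_simp
  have hp : 0 < y ^ 2 + ((ρ.ordinate - t) * Real.log x) ^ 2 := by positivity
  have hd := (pow_div_denom_le k hy).1
  rw [hq]
  field_simp
  ring

/-- The integrand belonging to a single prime power. -/
def primeIntegrand (k : ℕ) (t x : ℝ) (m : ℕ) (y : ℝ) : ℝ :=
  (I ^ (k + 1) * (m : ℂ) ^ (-(I * (t : ℂ)))).im * (ArithmeticFunction.vonMangoldt m / √(m : ℝ)) *
    (y ^ (k + 1) * (2 * Real.sinh (y * (1 - Real.log m / Real.log x)) / denom (k + 1) y))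

/-- Integrable because sinh grows like e^{y(1 - log m/log x)}, leaving the decay e^{-y log m/log x}
with m ≥ 2. -/
lemma integral_primeIntegrand (k : ℕ) (t : ℝ) {x : ℝ} (hx : 4 ≤ x) {m : ℕ} (hm : m ∈ Finset.Icc 2 ⌊x⌋₊) :
    IntegrableOn (primeIntegrand k t x m) (Ioi 0) ∧
      ∫ y in Ioi (0 : ℝ), primeIntegrand k t x m y = (k + 1).factorial * Real.log x ^ (k + 2) *
        ((I ^ (k + 1) * (m : ℂ) ^ (-(I * (t : ℂ)))).im *
        (ArithmeticFunction.vonMangoldt m / (√(m : ℝ) * Real.log m ^ (k + 2))) *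
          f (k + 1) (Real.log m / Real.log x)) := by
  have hx0 : 0 < x := by linarith
  have hL : 0 < Real.log x := by linarith [(sqrt_bounds hx).1]
  rw [Finset.mem_Icc] at hm
  have hm0 : 0 < (m : ℝ) := by
    have : 0 < m := by omega
    exact_mod_cast this
  have hm1 : (1 : ℝ) < m := by exact_mod_cast (by omega : 1 < m)
  have hmx : (m : ℝ) ≤ x := (Nat.cast_le.2 hm.2).trans (Nat.floor_le hx0.le)
  have hlm : 0 < Real.log m := Real.log_pos hm1
  have hle : Real.log m / Real.log x ≤ 1 := (div_le_one hL).2 (Real.log_le_log hm0 hmx)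
  have hpos : 0 < Real.log m / Real.log x := div_pos hlm hL
  constructor
  · refine Integrable.const_mul ?_ _
    have := integrableOn_weight k 1 (B := 2) (g := fun y => y * (2 * Real.sinh (y * (1 - Real.log m / Real.log x))))
      (by fun_prop) hpos fun y hy => ?_
    · refine this.congr_fun (fun y _ => ?_) measurableSet_Ioi
      simp only
      ring
    · have h0 : 0 ≤ y * (1 - Real.log m / Real.log x) := mul_nonneg hy.le (by linarith)
      have h1 : 0 ≤ Real.sinh (y * (1 - Real.log m / Real.log x)) := Real.sinh_nonneg_iff.2 h0
      rw [abs_of_nonneg (by positivity), pow_one]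
      have h2 : Real.sinh (y * (1 - Real.log m / Real.log x)) ≤
          Real.exp ((1 - Real.log m / Real.log x) * y) := by
        rw [Real.sinh_eq, mul_comm y]
        have := Real.exp_pos ((1 - Real.log m / Real.log x) * y)
        have := Real.exp_pos (-((1 - Real.log m / Real.log x) * y))
        linarith
      calc y * (2 * Real.sinh (y * (1 - Real.log m / Real.log x)))
          ≤ (1 + y) * (2 * Real.exp ((1 - Real.log m / Real.log x) * y)) := by
            gcongr
            linarith
        _ = _ := by ring
  · simp only [primeIntegrand]
    have hf' : f (k + 1) (Real.log m / Real.log x) = (Real.log m / Real.log x) ^ (k + 1 + 1) /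
        ((k + 1).factorial : ℝ) * ∫ y in Ioi (0 : ℝ), y ^ (k + 1) *
          (2 * Real.sinh (y * (1 - Real.log m / Real.log x)) / denom (k + 1) y) := rfl
    rw [integral_const_mul, hf']
    generalize (∫ y in Ioi (0 : ℝ), y ^ (k + 1) *
      (2 * Real.sinh (y * (1 - Real.log m / Real.log x)) / denom (k + 1) y)) = J
    have hf : ((k + 1).factorial : ℝ) ≠ 0 := by positivity
    rw [div_pow]
    field_simp

/-- The integrand of `S_n` after rescaling by `log x`. -/
def momentIntegrand (n : ℕ) (t x y : ℝ) : ℝ :=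
  y ^ n * (I ^ n * logDeriv riemannZeta (1 / 2 + (y / Real.log x : ℝ) + t * I)).im

lemma integral_momentIntegrand (hRH : RiemannHypothesis) {n : ℕ} (hn : 1 ≤ n) {t x : ℝ} (ht : 0 < t)
    (hx : 4 ≤ x) :
    IntegrableOn (momentIntegrand n t x) (Ioi 0) ∧
      (I ^ n * moment n t).im = 1 / Real.log x ^ (n + 1) * ∫ y in Ioi (0 : ℝ), momentIntegrand n t x y := by
  have hL : 0 < Real.log x := by linarith [(sqrt_bounds hx).1]
  have hi := integrableOn_pow_mul_logDeriv_zeta hRH ht hn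
  set g : ℝ → ℝ := fun u => u ^ n * (I ^ n * logDeriv riemannZeta (1 / 2 + u + t * I)).im with hg
  have e : ∀ u : ℝ, (I ^ n * ((u : ℂ) ^ n * logDeriv riemannZeta (1 / 2 + u + t * I))).im = g u := fun u => by
    rw [mul_left_comm, ← ofReal_pow, im_ofReal_mul]
  have hgi : IntegrableOn g (Ioi 0) := by
    have h1 : IntegrableOn (fun u : ℝ => (I ^ n * ((u : ℂ) ^ n *
      logDeriv riemannZeta (1 / 2 + u + t * I))).im) (Ioi 0) := (hi.const_mul (I ^ n)).im
    simpa only [e] using h1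
  have e2 : ∀ y : ℝ, momentIntegrand n t x y = Real.log x ^ n * g ((Real.log x)⁻¹ * y) := fun y => by
    simp only [momentIntegrand, hg]
    rw [show (Real.log x)⁻¹ * y = y / Real.log x by ring, div_pow]
    field_simp
  have h2 : (I ^ n * moment n t).im = ∫ u in Ioi (0 : ℝ), g u := by
    rw [moment, ← integral_const_mul]
    have h3 := imCLM.integral_comp_comm (hi.const_mul (I ^ n))
    simp only [imCLM_apply] at h3
    rw [← h3]
    simp only [e]
  constructor
  · have h3 := (integrableOn_Ioi_comp_mul_left_iff g 0 (inv_pos.2 hL)).2 (by simpa using hgi)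
    have h4 : IntegrableOn (fun y => Real.log x ^ n * g ((Real.log x)⁻¹ * y)) (Ioi 0) :=
      h3.const_mul (Real.log x ^ n)
    exact h4.congr_fun (fun y _ => (e2 y).symm) measurableSet_Ioi
  · simp only [e2]
    rw [integral_const_mul, integral_comp_mul_left_Ioi g 0 (inv_pos.2 hL), mul_zero, h2, smul_eq_mul, inv_inv,
      pow_succ]
    field_simp

/-- The logarithmic integrand. -/
def logIntegrand (k : ℕ) (t y : ℝ) : ℝ :=
  (I ^ (k + 1)).im * Real.log (t / (2 * Real.pi)) * (y ^ (k + 1) * Real.exp (-y) / denom (k + 1) y)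

lemma integral_logIntegrand (k : ℕ) (t : ℝ) :
    IntegrableOn (logIntegrand k t) (Ioi 0) ∧ ∫ y in Ioi (0 : ℝ), logIntegrand k t y =
      (I ^ (k + 1)).im * Real.log (t / (2 * Real.pi)) * ((k + 1).factorial * mu (k + 1)) := by
  constructor
  · refine Integrable.const_mul ?_ _
    have := integrableOn_weight k 1 (B := 1) (c := 1) (g := fun y => y * Real.exp (-y)) (by fun_prop) one_pos
      fun y hy => ?_
    · refine this.congr_fun (fun y _ => ?_) measurableSet_Ioi
      simp only
      ring
    · rw [abs_of_nonneg (by positivity)]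
      have : Real.exp (-y) ≤ 1 := Real.exp_le_one_iff.2 (by linarith)
      simp
      nlinarith
  · simp only [logIntegrand]
    rw [integral_const_mul]
    -- For even index Im i^{k+1} = 0, so the value of `mu` is irrelevant.
    rcases Nat.even_or_odd (k + 1) with h | h
    · obtain ⟨j, hj⟩ := h
      rw [hj, ← two_mul, I_pow_two_mul_im]
      simp
    · rw [integral_pow_mul_exp_neg_div_denom h]

/-- The error weight. -/
def errorWeight (k : ℕ) (y : ℝ) : ℝ := y ^ (k + 1) * (1 + y) ^ 2 / denom (k + 1) y

lemma integrableOn_errorWeight (k : ℕ) : IntegrableOn (errorWeight k) (Ioi 0) := by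
  have := integrableOn_weight k 3 (B := 1) (c := 1) (g := fun y => y * (1 + y) ^ 2) (by fun_prop) one_pos
    fun y hy => ?_
  · refine this.congr_fun (fun y _ => ?_) measurableSet_Ioi
    simp only [errorWeight]
    ring
  · rw [abs_of_nonneg (by positivity), pow_succ (1 + y) 2]
    simp
    rw [mul_comm]
    gcongr
    linarith

/-- The symmetrized formula at u = y/log x, divided by the denominator. What is left over is the
Stirling error, the trivial zeros and the pole. -/
lemma abs_remainder_le (hRH : RiemannHypothesis) (k : ℕ) {t x y : ℝ} (ht : 1 ≤ t) (hx : 4 ≤ x) (hy : 0 < y) :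
    |momentIntegrand (k + 1) t x y - (-∑ m ∈ Finset.Icc 2 ⌊x⌋₊, primeIntegrand k t x m y +
      ∑' ρ, zeroIntegrand k t x ρ y - logIntegrand k t y)| ≤
      40 * (√x / (t * Real.log x)) * errorWeight k y := by
  obtain ⟨hL1, hL2, hs1⟩ := sqrt_bounds hx
  have hL : 0 < Real.log x := by linarith
  have ht0 : 0 < t := by linarith
  have hd := (pow_div_denom_le k hy).1
  obtain ⟨u, hu⟩ : ∃ u : ℝ, u = y / Real.log x := ⟨_, rfl⟩
  have hu0 : 0 < u := hu ▸ div_pos hy hL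
  have huy : u * Real.log x = y := by rw [hu]; field_simp
  have h := symmetrized_explicit_formula hRH hu0 ht0.ne' hL.le
  have e1 : (u : ℂ) * Real.log x = y := by exact_mod_cast huy
  have e2 : -(u : ℂ) * Real.log x = -y := by rw [neg_mul, e1]
  rw [e1, e2] at h
  have h2 := congrArg (fun z => (I ^ (k + 1) * z).im) h
  beta_reduce at h2
  rw [im_I_pow_mul_symm] at h2
  have hP := tsum_primes_eq hx t (y := y)
  rw [← hu] at hP
  rw [hP] at h2
  have hZ := im_tsum_zeros hRH k t hx hy
  rw [← hu] at hZ
  set Z := ∑' ρ : NontrivialZero, ((ρ.mult * (2 * u / (u ^ 2 + (ρ.ordinate - t) ^ 2)) : ℝ) : ℂ) *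
          exp ((ρ.ordinate - t : ℝ) * I * Real.log x)
  change _ = (I ^ (k + 1) * (-(∑ m ∈ Finset.Icc 2 ⌊x⌋₊, _) + Z - gammaPart u t * exp (-y) +
    trivialPart u t (Real.log x) - polePart u t (Real.log x))).im at h2
  have hg := norm_gammaPart_sub_log_le hu0 ht
  obtain ⟨E, hE⟩ : ∃ E : ℂ, E = gammaPart u t - Real.log (t / (2 * Real.pi)) := ⟨_, rfl⟩
  rw [← hE] at hg
  have hgp : gammaPart u t = Real.log (t / (2 * Real.pi)) + E := by rw [hE]; ring
  have hPi : (y ^ (k + 1) / denom (k + 1) y) * (I ^ (k + 1) * ∑ m ∈ Finset.Icc 2 ⌊x⌋₊,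
      (m : ℂ) ^ (-(I * (t : ℂ))) * ((ArithmeticFunction.vonMangoldt m / √(m : ℝ) *
        (2 * Real.sinh (y * (1 - Real.log m / Real.log x))) : ℝ) : ℂ)).im =
      ∑ m ∈ Finset.Icc 2 ⌊x⌋₊, primeIntegrand k t x m y := by
    rw [Finset.mul_sum, im_sum, Finset.mul_sum]
    refine Finset.sum_congr rfl fun m _ => ?_
    rw [← mul_assoc, im_mul_ofReal, primeIntegrand]
    ring
  set P := ∑ m ∈ Finset.Icc 2 ⌊x⌋₊,
      (m : ℂ) ^ (-(I * (t : ℂ))) * ((ArithmeticFunction.vonMangoldt m / √(m : ℝ) *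
        (2 * Real.sinh (y * (1 - Real.log m / Real.log x))) : ℝ) : ℂ)
  set W := logDeriv riemannZeta (1 / 2 + u + t * I)
  have hG : momentIntegrand (k + 1) t x y =
      y ^ (k + 1) / denom (k + 1) y * ((I ^ (k + 1) * W).im * denom (k + 1) y) := by
    rw [momentIntegrand, ← hu]
    generalize (I ^ (k + 1) * W).im = w
    field_simp
  have hrem : momentIntegrand (k + 1) t x y - (-∑ m ∈ Finset.Icc 2 ⌊x⌋₊, primeIntegrand k t x m y +
      ∑' ρ, zeroIntegrand k t x ρ y - logIntegrand k t y) =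
      y ^ (k + 1) / denom (k + 1) y * (I ^ (k + 1) * (-(E * exp (-y)) + trivialPart u t (Real.log x) -
        polePart u t (Real.log x))).im := by
    rw [hG, h2, ← hPi, ← hZ, hgp, logIntegrand]
    have e3 : I ^ (k + 1) * (-P + Z - (Real.log (t / (2 * Real.pi)) + E) * exp (-y) +
        trivialPart u t (Real.log x) - polePart u t (Real.log x)) =
        -(I ^ (k + 1) * P) + I ^ (k + 1) * Z -
          I ^ (k + 1) * ((Real.log (t / (2 * Real.pi)) * Real.exp (-y) : ℝ) : ℂ) +
        I ^ (k + 1) * (-(E * exp (-y)) + trivialPart u t (Real.log x) - polePart u t (Real.log x)) := by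
      push_cast
      ring
    rw [e3, add_im, sub_im, add_im, neg_im, im_mul_ofReal]
    ring
  rw [hrem, abs_mul, abs_of_nonneg (by positivity)]
  have hb : ‖-(E * exp (-y)) + trivialPart u t (Real.log x) - polePart u t (Real.log x)‖ ≤
      40 * (√x / (t * Real.log x)) * (1 + y) ^ 2 := by
    have b1 : ‖-(E * exp (-y))‖ ≤ 18 * (1 + u) ^ 2 / t := by
      rw [norm_neg, norm_mul, norm_exp]
      refine (mul_le_of_le_one_right (norm_nonneg _) (Real.exp_le_one_iff.2 ?_)).trans hg
      simp [hy.le]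
    have b2 := norm_trivialPart_le hu0 ht hx
    have b3 := norm_polePart_le hu0 ht hx
    have huy' : u ≤ y := by rw [hu]; exact div_le_self hy.le hL1.le
    -- The Stirling error lacks the factor 1/log x; log x ≤ 2√x supplies it at the price of √x. The
    -- constants 36, 2 and 2 add up to 40.
    have c1 : 18 * (1 + u) ^ 2 / t ≤ 36 * (√x / (t * Real.log x)) * (1 + y) ^ 2 := by
      have : 1 ≤ 2 * √x / Real.log x := by rw [le_div_iff₀ hL]; linarith
      calc 18 * (1 + u) ^ 2 / t ≤ 18 * (1 + y) ^ 2 / t * 1 := by rw [mul_one]; gcongr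
        _ ≤ 18 * (1 + y) ^ 2 / t * (2 * √x / Real.log x) := by gcongr
        _ = _ := by field_simp; ring
    have hyy : y ≤ (1 + y) ^ 2 := by nlinarith
    have c2 : 2 * u / t ≤ 2 * (√x / (t * Real.log x)) * (1 + y) ^ 2 := by
      calc 2 * u / t = 2 * (1 / (t * Real.log x)) * y := by rw [hu]; field_simp
        _ ≤ _ := by gcongr
    have c3 : 2 * u / t * √x ≤ 2 * (√x / (t * Real.log x)) * (1 + y) ^ 2 := by
      calc 2 * u / t * √x = 2 * (√x / (t * Real.log x)) * y := by rw [hu]; field_simp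
        _ ≤ _ := by gcongr
    refine (norm_sub_le _ _).trans ((add_le_add (norm_add_le _ _) le_rfl).trans ?_)
    linarith
  calc y ^ (k + 1) / denom (k + 1) y * |(I ^ (k + 1) * (-(E * exp (-y)) + trivialPart u t (Real.log x) -
        polePart u t (Real.log x))).im|
      ≤ y ^ (k + 1) / denom (k + 1) y * (40 * (√x / (t * Real.log x)) * (1 + y) ^ 2) := by
        gcongr
        exact (norm_I_pow_mul _ _).trans hb
    _ = _ := by rw [errorWeight]; ring

/-- The approximate formula for `S_n`. -/
theorem abs_Sn_sub_le (hRH : RiemannHypothesis) (k : ℕ) {t x : ℝ} (ht : 1 ≤ t) (hx : 4 ≤ x) :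
    |Sn (k + 1) t -
        (1 / (Real.pi * ((k + 1).factorial : ℝ) * Real.log x ^ (k + 1)) *
            (∑' ρ : NontrivialZero, zeroTerm (k + 1) t x ρ)
          + 1 / Real.pi * (∑ m ∈ Finset.Icc 2 ⌊x⌋₊,
              (I ^ (k + 1) * (m : ℂ) ^ (-(I * (t : ℂ)))).im *
                (ArithmeticFunction.vonMangoldt m / (√(m : ℝ) * Real.log m ^ (k + 2))) *
                f (k + 1) (Real.log m / Real.log x))
          + mu (k + 1) * ((I ^ (k + 1)).im / (Real.pi * Real.log x ^ (k + 2))) *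
              Real.log (t / (2 * Real.pi)))|
      ≤ 40 / (Real.pi * (k + 1).factorial) * (∫ y in Ioi (0 : ℝ), errorWeight k y) *
        (√x / (t * Real.log x ^ (k + 3))) := by
  have ht0 : 0 < t := by linarith
  have hL : 0 < Real.log x := by linarith [(sqrt_bounds hx).1]
  have hpi := Real.pi_pos
  have hf : (0 : ℝ) < (k + 1).factorial := by positivity
  obtain ⟨iG, hG⟩ := integral_momentIntegrand hRH (n := k + 1) (by omega) ht0 hx
  obtain ⟨iZ, hZ⟩ := integral_zeroIntegrand hRH k t hx
  obtain ⟨iL, hLg⟩ := integral_logIntegrand k t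
  have iP : IntegrableOn (fun y => ∑ m ∈ Finset.Icc 2 ⌊x⌋₊, primeIntegrand k t x m y) (Ioi 0) :=
    integrable_finsetSum _ fun m hm => (integral_primeIntegrand k t hx hm).1
  have hP : ∫ y in Ioi (0 : ℝ), ∑ m ∈ Finset.Icc 2 ⌊x⌋₊, primeIntegrand k t x m y =
      (k + 1).factorial * Real.log x ^ (k + 2) * ∑ m ∈ Finset.Icc 2 ⌊x⌋₊,
        ((I ^ (k + 1) * (m : ℂ) ^ (-(I * (t : ℂ)))).im *
        (ArithmeticFunction.vonMangoldt m / (√(m : ℝ) * Real.log m ^ (k + 2))) *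
          f (k + 1) (Real.log m / Real.log x)) := by
    rw [integral_finsetSum _ fun m hm => (integral_primeIntegrand k t hx hm).1, Finset.mul_sum]
    exact Finset.sum_congr rfl fun m hm => (integral_primeIntegrand k t hx hm).2
  have iM1 : IntegrableOn (fun y => -∑ m ∈ Finset.Icc 2 ⌊x⌋₊, primeIntegrand k t x m y +
      ∑' ρ, zeroIntegrand k t x ρ y) (Ioi 0) := iP.neg.add iZ
  have iM : IntegrableOn (fun y => -∑ m ∈ Finset.Icc 2 ⌊x⌋₊, primeIntegrand k t x m y +
      ∑' ρ, zeroIntegrand k t x ρ y - logIntegrand k t y) (Ioi 0) := iM1.sub iL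
  have hR : |∫ y in Ioi (0 : ℝ), (momentIntegrand (k + 1) t x y -
      (-∑ m ∈ Finset.Icc 2 ⌊x⌋₊, primeIntegrand k t x m y +
      ∑' ρ, zeroIntegrand k t x ρ y - logIntegrand k t y))| ≤
      40 * (√x / (t * Real.log x)) * ∫ y in Ioi (0 : ℝ), errorWeight k y := by
    rw [← integral_const_mul, ← Real.norm_eq_abs]
    refine norm_integral_le_of_norm_le ((integrableOn_errorWeight k).const_mul _) ?_
    exact (ae_restrict_iff' measurableSet_Ioi).2
      (Eventually.of_forall fun y hy => abs_remainder_le hRH k ht hx hy)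
  have iN : IntegrableOn (fun y => -∑ m ∈ Finset.Icc 2 ⌊x⌋₊, primeIntegrand k t x m y) (Ioi 0) := iP.neg
  rw [integral_sub iG iM, integral_sub iM1 iL, integral_add iN iZ, integral_neg, hP, hZ, hLg] at hR
  rw [Sn_eq_momentArg hRH k ht0, momentArg, hG]
  set G := ∫ y in Ioi (0 : ℝ), momentIntegrand (k + 1) t x y
  set Q := ∑' ρ : NontrivialZero, zeroTerm (k + 1) t x ρ
  set Pr := ∑ m ∈ Finset.Icc 2 ⌊x⌋₊, ((I ^ (k + 1) * (m : ℂ) ^ (-(I * (t : ℂ)))).im *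
        (ArithmeticFunction.vonMangoldt m / (√(m : ℝ) * Real.log m ^ (k + 2))) *
          f (k + 1) (Real.log m / Real.log x))
  set J := ∫ y in Ioi (0 : ℝ), errorWeight k y
  set l := Real.log (t / (2 * Real.pi))
  -- Undoes the scaling: the integrals of the prime, zero and logarithmic parts become the three
  -- main terms, with the signs of `momentArg`.
  have e : -(1 / (Real.pi * ((k + 1).factorial : ℝ))) * (1 / Real.log x ^ (k + 1 + 1) * G) -
      (1 / (Real.pi * ((k + 1).factorial : ℝ) * Real.log x ^ (k + 1)) * Q + 1 / Real.pi * Pr +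
        mu (k + 1) * ((I ^ (k + 1)).im / (Real.pi * Real.log x ^ (k + 2))) * l) =
      -(1 / (Real.pi * ((k + 1).factorial : ℝ) * Real.log x ^ (k + 2))) *
      (G - (-(((k + 1).factorial : ℝ) * Real.log x ^ (k + 2) * Pr) + -Real.log x * Q -
        (I ^ (k + 1)).im * l * (((k + 1).factorial : ℝ) * mu (k + 1)))) := by
    rw [pow_succ (Real.log x) (k + 1)]
    field_simp
    ring
  rw [e, abs_mul, abs_neg, abs_of_nonneg (by positivity)]
  calc _ ≤ 1 / (Real.pi * ((k + 1).factorial : ℝ) * Real.log x ^ (k + 2)) *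
        (40 * (√x / (t * Real.log x)) * J) := by gcongr
    _ = _ := by
      rw [pow_succ (Real.log x) (k + 2)]
      field_simp

end ZetaArgument

end

open ZetaArgument in
theorem mainTheorem4 (hRH : RiemannHypothesis) (n : ℕ) (hn : 1 ≤ n) :
    (∀ t x : ℝ, 1 ≤ t → 4 ≤ x → Summable (zeroTerm n t x)) ∧
    ∃ C : ℝ, ∀ t x : ℝ, 1 ≤ t → 4 ≤ x →
      |Sn n t -
        (1 / (Real.pi * (n.factorial : ℝ) * Real.log x ^ n) *
            (∑' ρ : NontrivialZero, zeroTerm n t x ρ)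
          + 1 / Real.pi * (∑ m ∈ Finset.Icc 2 ⌊x⌋₊,
              (Complex.I ^ n * (m : ℂ) ^ (-(Complex.I * (t : ℂ)))).im *
                (ArithmeticFunction.vonMangoldt m / (√(m : ℝ) * Real.log m ^ (n + 1))) *
                f n (Real.log m / Real.log x))
          + mu n * ((Complex.I ^ n).im / (Real.pi * Real.log x ^ (n + 1))) *
              Real.log (t / (2 * Real.pi)))|
        ≤ C * (√x / (t * Real.log x ^ (n + 2))) := by
  refine ⟨fun t x _ hx => summable_zeroTerm hRH hn t hx, ?_⟩
  obtain ⟨k, rfl⟩ : ∃ k, n = k + 1 := ⟨n - 1, by omega⟩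
  exact ⟨_, fun t x ht hx => abs_Sn_sub_le hRH k ht hx⟩
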